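/- All algebras are associative complex algebras, not necessarily unital, and all maps are linear; products such as $XY$ of subspaces denote linear spans. \textbf{Multiplier bialgebroids.} Let $A$ be a non-degenerate ($ab=0$ for all $b$, or $ba=0$ for all $b$, implies $a=0$) and idempotent ($AA=A$) algebra with multiplier algebra $M(A)$. Let $B,C\subseteq M(A)$ be commuting subalgebras with anti-isomorphisms $S_B\colon B\to C$ and $S_C\colon C\to B$ (not necessarily inverse to each other). For $x\in B$, $y\in C$, $a,b\in A$ consider the quotients of $A\otimes A$ by the indicated relations: \[ {}_BA\otimes A^B:\ xa\otimes b=a\otimes S_B(x)b;\qquad {}^CA\otimes A_C:\ aS_C(y)\otimes b=a\otimes by; \] \[ A_B\otimes{}_BA:\ ax\otimes b=a\otimes xb;\quad A_C\otimes{}_CA:\ ay\otimes b=a\otimes yb;\quad {}_BA\otimes A_B:\ xa\otimes b=a\otimes bx;\quad {}_CA\otimes A_C:\ ya\otimes b=a\otimes by. \] Assume that the modules ${}_BA$ ($x\cdot a=xa$), $A^B$ ($a\cdot x=S_B(x)a$), $A_C$ ($a\cdot y=ay$) and ${}^CA$ ($y\cdot a=aS_C(y)$) are faithful and idempotent, that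 ${}_BA\otimes A^B$ is non-degenerate as a right module over $A\otimes1$ and over $1\otimes A$, and that ${}^CA\otimes A_C$ is non-degenerate as a left module over $A\otimes 1$ and over $1\otimes A$. A multiplier bialgebroid $\mathcal A=(A,B,C,S_B,S_C,\Delta_B,\Delta_C)$ consists of such data and homomorphisms $\Delta_B\colon A\to\operatorname{End}({}_BA\otimes A^B)$ and $\Delta_C\colon A\to\operatorname{End}({}^CA\otimes A_C)^{\mathrm{op}}$ (the latter acting from the right) such that the following holds. (i) For all $a,b\in A$ there are elements $\Delta_B(b)(a\otimes1),\ \Delta_B(a)(1\otimes b)\in{}_BA\otimes A^B$ and $(a\otimes1)\Delta_C(b),\ (1\otimes b)\Delta_C(a)\in{}^CA\otimes A_C$ with $\Delta_B(d)(a\otimes b)=(\Delta_B(d)(a\otimes1))(1\otimes b)=(\Delta_B(d)(1\otimes b))(a\otimes1)$ and $(a\otimes b)\Delta_C(d)=(1\otimes b)((a\otimes1)\Delta_C(d))=(a\otimes1)((1\otimes b)\Delta_C(d))$ for all $a,b,d\in A$. (ii) $\Delta(xyax'y')=(y\otimes x)\Delta(a)(y'\otimes x')$ for $\Delta=\Delta_B,\Delta_C$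 and all $x,x'\in B$, $y,y'\in C$, $a\in A$. Consequently the following canonical maps are well defined: \[ T_\lambda\colon{}_CA\otimes A_C\to{}_BA\otimes A^B,\ a\otimes b\mapsto\Delta_B(b)(a\otimes1);\qquad T_\rho\colon A_B\otimes{}_BA\to{}_BA\otimes A^B,\ a\otimes b\mapsto\Delta_B(a)(1\otimes b); \] \[ {}_\lambda T\colon A_C\otimes{}_CA\to{}^CA\otimes A_C,\ a\otimes b\mapsto(a\otimes1)\Delta_C(b);\qquad {}_\rho T\colon{}_BA\otimes A_B\to{}^CA\otimes A_C,\ a\otimes b\mapsto(1\otimes b)\Delta_C(a). \] (iii) Writing $T_\lambda,T_\rho,{}_\lambda T,{}_\rho T$ also for the corresponding maps on $A\otimes A$, co-associativity and mixed co-associativity hold: $(\iota\otimes T')(T\otimes\iota)=(T\otimes\iota)(\iota\otimes T')$ on $A\otimes A\otimes A$, as maps into the respective threefold balanced tensor product, for $(T,T')=(T_\lambda,T_\rho),\ ({}_\lambda T,{}_\rho T),\ (T_\lambda,{}_\rho T),\ ({}_\lambda T,T_\rho)$. \textbf{Regular multiplier Hopf algebroids.} Let ${}_BI, I^B\subseteq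 B$ and $I_C,{}^CI\subseteq C$ be the linear spans of all $\omega(a)$ with $a\in A$ and $\omega$ in $\operatorname{Hom}({}_BA,{}_BB)$, $\operatorname{Hom}(A^B,B_B)$, $\operatorname{Hom}(A_C,C_C)$ and $\operatorname{Hom}({}^CA,{}_CC)$, respectively. $\mathcal A$ is called a regular multiplier Hopf algebroid if $S_B({}_BI)A=A$, $I^BA=A$, $A\,S_C(I_C)=A$, $A\,({}^CI)=A$, and $T_\lambda,T_\rho,{}_\lambda T,{}_\rho T$ are bijective. \textbf{Counits and antipodes.} A left counit is a linear map $\varepsilon_B\colon A\to B$ with $\varepsilon_B(xa)=x\varepsilon_B(a)$, $\varepsilon_B(S_B(x)a)=\varepsilon_B(a)x$, $(\varepsilon_B\otimes\iota)(T_\rho(a\otimes b))=ab$ and $(\iota\otimes\varepsilon_B)(T_\lambda(a\otimes b))=ba$, where $(\varepsilon_B\otimes\iota)(a\otimes b)=S_B(\varepsilon_B(a))b$ and $(\iota\otimes\varepsilon_B)(a\otimes b)=\varepsilon_B(b)a$. A right counit is a linear map $\varepsilon_C\colon A\to C$ with $\varepsilon_C(ay)=\varepsilon_C(a)y$, $\varepsilon_C(aS_C(y))=y\varepsilon_C(a)$,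 $(\varepsilon_C\otimes\iota)({}_\rho T(a\otimes b))=ba$ and $(\iota\otimes\varepsilon_C)({}_\lambda T(a\otimes b))=ab$, where $(\varepsilon_C\otimes\iota)(a\otimes b)=b\varepsilon_C(a)$ and $(\iota\otimes\varepsilon_C)(a\otimes b)=aS_C(\varepsilon_C(b))$. An invertible antipode is a bijective linear anti-homomorphism $S\colon A\to A$ with $S(xyax'y')=S_C(y')S_B(x')S(a)S_C(y)S_B(x)$ for all $x,x'\in B$, $y,y'\in C$, $a\in A$, for which there are a left counit $\varepsilon_B$ and a right counit $\varepsilon_C$ such that, for all $a,b\in A$, \[ m_C(S\otimes\iota)T_\rho(a\otimes b)=S_C(\varepsilon_C(a))\,b,\qquad m_B(\iota\otimes S)\,{}_\lambda T(a\otimes b)=a\,S_B(\varepsilon_B(b)), \] where $m_C\colon A_C\otimes{}_CA\to A$ and $m_B\colon A_B\otimes{}_BA\to A$ are induced by the multiplication. \textbf{Theorem.} Let $\mathcal A$ be a multiplier bialgebroid. Then $\mathcal A$ is a regular multiplier Hopf algebroid if and only if there exists an invertible antipode for $\mathcal A$. In that case, $\mathcal A$ has exactly one invertible antipode $S$, exactly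 one left counit and exactly one right counit, and \[ T_\rho\circ(\iota\otimes S)\circ{}_\rho T=\iota\otimes S\colon{}_BA\otimes A_B\to{}_BA\otimes A^B,\qquad {}_\rho T\circ(\iota\otimes S^{-1})\circ T_\rho=\iota\otimes S^{-1}\colon A_B\otimes{}_BA\to{}^CA\otimes A_C, \] \[ {}_\lambda T\circ(S\otimes\iota)\circ T_\lambda=S\otimes\iota\colon{}_CA\otimes A_C\to{}^CA\otimes A_C,\qquad T_\lambda\circ(S^{-1}\otimes\iota)\circ{}_\lambda T=S^{-1}\otimes\iota\colon A_C\otimes{}_CA\to{}_BA\otimes A^B. \] -/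

import Mathlib

open scoped TensorProduct

noncomputable section

namespace MultHopf

section Multipliers

variable (A : Type*) [NonUnitalRing A] [Module ℂ A] [IsScalarTower ℂ A A] [SMulCommClass ℂ A A]

/-- The multiplier algebra `M(A)` of an algebra `A`, not necessarily unital: pairs `(L, R)` of a left
multiplier `L` (a right `A`-linear endomorphism) and a right multiplier `R` (a left `A`-linear
endomorphism) such that `a L(b) = R(a) b`.  Writing `T a = L(a)` and `a T = R(a)`, the product is
`(T T') a = T (T' a)` and `a (T T') = (a T) T'`.  If `A` is non-degenerate, then `L` determines `R`
and vice versa, and this is the algebra of all left multipliers `L` with `A L ⊆ A`. -/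
def multiplierSubalgebra : Subalgebra ℂ (Module.End ℂ A × (Module.End ℂ A)ᵐᵒᵖ) where
  carrier := {T | (∀ a b : A, T.1 (a * b) = T.1 a * b) ∧
    (∀ a b : A, T.2.unop (a * b) = a * T.2.unop b) ∧
    ∀ a b : A, a * T.1 b = T.2.unop a * b}
  mul_mem' := by
    rintro S T ⟨h1, h2, h3⟩ ⟨k1, k2, k3⟩
    refine ⟨fun a b => ?_, fun a b => ?_, fun a b => ?_⟩
    · simp [k1, h1]
    · simp [k2, h2]
    · simp [h3, k3]
  add_mem' := by
    rintro S T ⟨h1, h2, h3⟩ ⟨k1, k2, k3⟩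
    refine ⟨fun a b => ?_, fun a b => ?_, fun a b => ?_⟩
    · simp [k1, h1, add_mul]
    · simp [k2, h2, mul_add]
    · simp [h3, k3, add_mul, mul_add]
  algebraMap_mem' := by
    intro r
    refine ⟨fun a b => ?_, fun a b => ?_, fun a b => ?_⟩
    · simp [Prod.algebraMap_apply, Module.algebraMap_end_apply, smul_mul_assoc]
    · simp [Prod.algebraMap_apply, Module.algebraMap_end_apply, mul_smul_comm]
    · simp [Prod.algebraMap_apply, Module.algebraMap_end_apply, smul_mul_assoc, mul_smul_comm]

/-- The multiplier algebra `M(A)` as a type. -/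
def MultiplierAlgebra : Type _ := ↥(multiplierSubalgebra A)

instance : Ring (MultiplierAlgebra A) := inferInstanceAs (Ring ↥(multiplierSubalgebra A))

instance : Algebra ℂ (MultiplierAlgebra A) :=
  inferInstanceAs (Algebra ℂ ↥(multiplierSubalgebra A))

variable {A}

/-- `lmul T a = T a`. -/
def lmul (T : MultiplierAlgebra A) : A →ₗ[ℂ] A := T.1.1

/-- `rmul T a = a T`. -/
def rmul (T : MultiplierAlgebra A) : A →ₗ[ℂ] A := T.1.2.unop

theorem lmul_add (S T : MultiplierAlgebra A) : lmul (S + T) = lmul S + lmul T := rfl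

theorem rmul_add (S T : MultiplierAlgebra A) : rmul (S + T) = rmul S + rmul T := rfl

theorem lmul_smul (r : ℂ) (T : MultiplierAlgebra A) : lmul (r • T) = r • lmul T := rfl

theorem rmul_smul (r : ℂ) (T : MultiplierAlgebra A) : rmul (r • T) = r • rmul T := rfl

theorem lmul_mul (S T : MultiplierAlgebra A) (a : A) : lmul (S * T) a = lmul S (lmul T a) := rfl

theorem rmul_mul (S T : MultiplierAlgebra A) (a : A) : rmul (S * T) a = rmul T (rmul S a) := rfl

theorem lmul_apply_mul (T : MultiplierAlgebra A) (a b : A) : lmul T (a * b) = lmul T a * b :=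
  T.2.1 a b

theorem rmul_apply_mul (T : MultiplierAlgebra A) (a b : A) : rmul T (a * b) = a * rmul T b :=
  T.2.2.1 a b

theorem mul_lmul (T : MultiplierAlgebra A) (a b : A) : a * lmul T b = rmul T a * b :=
  T.2.2.2 a b

theorem lmul_comm {S T : MultiplierAlgebra A} (h : S * T = T * S) (a : A) :
    lmul S (lmul T a) = lmul T (lmul S a) := by
  rw [← lmul_mul, h, lmul_mul]

theorem rmul_comm {S T : MultiplierAlgebra A} (h : S * T = T * S) (a : A) :
    rmul S (rmul T a) = rmul T (rmul S a) := by
  rw [← rmul_mul, ← h, rmul_mul]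

end Multipliers

section Balanced

variable {A : Type*} [NonUnitalRing A] [Module ℂ A]
variable {ι ι₁ ι₂ : Type*}

/-- The action `f` of `ι` on `A` is faithful: `f i = 0` only for `i = 0`. -/
def IsFaithfulAction [Zero ι] (f : ι → A →ₗ[ℂ] A) : Prop :=
  ∀ i, (∀ a, f i a = 0) → i = 0

/-- The action `f` of `ι` on `A` is idempotent: the elements `f i a` span `A`. -/
def IsIdempotentAction (f : ι → A →ₗ[ℂ] A) : Prop :=
  Submodule.span ℂ {c : A | ∃ i a, c = f i a} = ⊤

theorem IsIdempotentAction.ext {f : ι → A →ₗ[ℂ] A} (hf : IsIdempotentAction f) {M : Type*}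
    [AddCommGroup M] [Module ℂ M] {φ ψ : A →ₗ[ℂ] M} (h : ∀ i a, φ (f i a) = ψ (f i a)) :
    φ = ψ :=
  LinearMap.ext_on hf (by rintro _ ⟨i, a, rfl⟩; exact h i a)

/-- The span of the elements `f i a ⊗ b - a ⊗ g i b`. -/
def balRel (f g : ι → A →ₗ[ℂ] A) : Submodule ℂ (A ⊗[ℂ] A) :=
  Submodule.span ℂ {t | ∃ i a b, t = f i a ⊗ₜ[ℂ] b - a ⊗ₜ[ℂ] g i b}

/-- The balanced tensor product of `A`, with the action `f`, and `A`, with the action `g`: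
the quotient of `A ⊗ A` by the relations `f i a ⊗ b = a ⊗ g i b`. -/
abbrev Bal (f g : ι → A →ₗ[ℂ] A) : Type _ := (A ⊗[ℂ] A) ⧸ balRel f g

/-- The quotient map from `A ⊗ A` to a balanced tensor product. -/
def Bal.π (f g : ι → A →ₗ[ℂ] A) : A ⊗[ℂ] A →ₗ[ℂ] Bal f g := (balRel f g).mkQ

theorem Bal.π_surjective (f g : ι → A →ₗ[ℂ] A) : Function.Surjective (Bal.π f g) :=
  (balRel f g).mkQ_surjective

/-- Linear maps on a balanced tensor product are determined by their values on elementary tensors. -/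
theorem Bal.ext {f g : ι → A →ₗ[ℂ] A} {M : Type*} [AddCommGroup M] [Module ℂ M]
    {φ ψ : Bal f g →ₗ[ℂ] M}
    (h : ∀ a b, φ (Bal.π f g (a ⊗ₜ b)) = ψ (Bal.π f g (a ⊗ₜ b))) : φ = ψ :=
  Submodule.linearMap_qext _ (TensorProduct.ext' h)

theorem Bal.rel (f g : ι → A →ₗ[ℂ] A) (i : ι) (a b : A) :
    Bal.π f g (f i a ⊗ₜ b) = Bal.π f g (a ⊗ₜ g i b) := by
  rw [← sub_eq_zero, ← map_sub]
  exact (Submodule.Quotient.mk_eq_zero _).2 (Submodule.subset_span ⟨i, a, b, rfl⟩)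

/-- A linear map on `A ⊗ A` that respects the relations descends to the balanced tensor product. -/
def Bal.lift {f g : ι → A →ₗ[ℂ] A} {M : Type*} [AddCommGroup M] [Module ℂ M]
    (Φ : A ⊗[ℂ] A →ₗ[ℂ] M) (h : ∀ i a b, Φ (f i a ⊗ₜ b) = Φ (a ⊗ₜ g i b)) : Bal f g →ₗ[ℂ] M :=
  (balRel f g).liftQ Φ (by
    refine Submodule.span_le.2 ?_
    rintro _ ⟨i, a, b, rfl⟩
    simp [h i a b])

@[simp] theorem Bal.lift_π {f g : ι → A →ₗ[ℂ] A} {M : Type*} [AddCommGroup M] [Module ℂ M]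
    (Φ : A ⊗[ℂ] A →ₗ[ℂ] M) (h : ∀ i a b, Φ (f i a ⊗ₜ b) = Φ (a ⊗ₜ g i b)) (t : A ⊗[ℂ] A) :
    Bal.lift Φ h (Bal.π f g t) = Φ t := rfl

/-- The map `φ ⊗ ψ` between balanced tensor products, provided that it is well defined. -/
def Bal.map {f g : ι₁ → A →ₗ[ℂ] A} {f' g' : ι₂ → A →ₗ[ℂ] A} (φ ψ : A →ₗ[ℂ] A)
    (h : ∀ i a b, Bal.π f' g' (φ (f i a) ⊗ₜ ψ b) = Bal.π f' g' (φ a ⊗ₜ ψ (g i b))) :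
    Bal f g →ₗ[ℂ] Bal f' g' :=
  Bal.lift (Bal.π f' g' ∘ₗ TensorProduct.map φ ψ) (by simpa using h)

@[simp] theorem Bal.map_π {f g : ι₁ → A →ₗ[ℂ] A} {f' g' : ι₂ → A →ₗ[ℂ] A} (φ ψ : A →ₗ[ℂ] A)
    (h : ∀ i a b, Bal.π f' g' (φ (f i a) ⊗ₜ ψ b) = Bal.π f' g' (φ a ⊗ₜ ψ (g i b))) (a b : A) :
    Bal.map (f := f) (g := g) φ ψ h (Bal.π f g (a ⊗ₜ b)) = Bal.π f' g' (φ a ⊗ₜ ψ b) := rfl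

/-- The map `φ ⊗ ψ` on a balanced tensor product, where `φ` commutes with the first action and `ψ`
with the second. -/
def Bal.endo {f g : ι → A →ₗ[ℂ] A} (φ ψ : A →ₗ[ℂ] A) (hφ : ∀ i a, φ (f i a) = f i (φ a))
    (hψ : ∀ i a, ψ (g i a) = g i (ψ a)) : Module.End ℂ (Bal f g) :=
  Bal.map φ ψ (fun i a b => by rw [hφ, hψ, Bal.rel])

@[simp] theorem Bal.endo_π {f g : ι → A →ₗ[ℂ] A} (φ ψ : A →ₗ[ℂ] A)
    (hφ : ∀ i a, φ (f i a) = f i (φ a)) (hψ : ∀ i a, ψ (g i a) = g i (ψ a)) (a b : A) :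
    Bal.endo φ ψ hφ hψ (Bal.π f g (a ⊗ₜ b)) = Bal.π f g (φ a ⊗ₜ ψ b) := rfl

/-- The threefold balanced tensor product: the quotient of `A ⊗ A ⊗ A` by the relations
`f i a ⊗ b ⊗ c = a ⊗ g i b ⊗ c` and `a ⊗ f' j b ⊗ c = a ⊗ b ⊗ g' j c`. -/
abbrev Bal₃ (f g : ι₁ → A →ₗ[ℂ] A) (f' g' : ι₂ → A →ₗ[ℂ] A) : Type _ :=
  (A ⊗[ℂ] (A ⊗[ℂ] A)) ⧸ (Submodule.span ℂ
    ({t | ∃ i a b c, t = f i a ⊗ₜ[ℂ] (b ⊗ₜ[ℂ] c) - a ⊗ₜ[ℂ] (g i b ⊗ₜ[ℂ] c)} ∪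
      {t | ∃ j a b c, t = a ⊗ₜ[ℂ] (f' j b ⊗ₜ[ℂ] c) - a ⊗ₜ[ℂ] (b ⊗ₜ[ℂ] g' j c)}))

/-- The quotient map from `A ⊗ A ⊗ A` to a threefold balanced tensor product. -/
def Bal₃.π (f g : ι₁ → A →ₗ[ℂ] A) (f' g' : ι₂ → A →ₗ[ℂ] A) :
    A ⊗[ℂ] (A ⊗[ℂ] A) →ₗ[ℂ] Bal₃ f g f' g' :=
  Submodule.mkQ _

/-- The natural map `A ⊗ Bal f' g' → Bal₃ f g f' g'`. -/
def Bal₃.ofRight (f g : ι₁ → A →ₗ[ℂ] A) (f' g' : ι₂ → A →ₗ[ℂ] A) :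
    A ⊗[ℂ] Bal f' g' →ₗ[ℂ] Bal₃ f g f' g' :=
  TensorProduct.lift
    { toFun := fun a => Bal.lift (Bal₃.π f g f' g' ∘ₗ TensorProduct.mk ℂ A (A ⊗[ℂ] A) a) (by
        intro j b c
        simp only [LinearMap.comp_apply, TensorProduct.mk_apply]
        rw [← sub_eq_zero, ← map_sub]
        exact (Submodule.Quotient.mk_eq_zero _).2
          (Submodule.subset_span (Or.inr ⟨j, a, b, c, rfl⟩)))
      map_add' := fun a a' => Bal.ext (fun b c => by
        change Bal₃.π f g f' g' _ = Bal₃.π f g f' g' _ + Bal₃.π f g f' g' _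
        rw [← map_add]; exact congrArg _ (TensorProduct.add_tmul _ _ _))
      map_smul' := fun r a => Bal.ext (fun b c => by
        change Bal₃.π f g f' g' _ = r • Bal₃.π f g f' g' _
        rw [← map_smul]; exact congrArg _ (TensorProduct.smul_tmul' _ _ _).symm) }

/-- The natural map `Bal f g ⊗ A → Bal₃ f g f' g'`. -/
def Bal₃.ofLeft (f g : ι₁ → A →ₗ[ℂ] A) (f' g' : ι₂ → A →ₗ[ℂ] A) :
    Bal f g ⊗[ℂ] A →ₗ[ℂ] Bal₃ f g f' g' :=
  TensorProduct.lift (Bal.lift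
    (LinearMap.compr₂ (TensorProduct.mk ℂ (A ⊗[ℂ] A) A)
      (Bal₃.π f g f' g' ∘ₗ (TensorProduct.assoc ℂ A A A).toLinearMap)) (by
        intro i a b
        ext c
        simp only [LinearMap.compr₂_apply, TensorProduct.mk_apply, LinearMap.comp_apply,
          LinearEquiv.coe_coe, TensorProduct.assoc_tmul]
        rw [← sub_eq_zero, ← map_sub]
        exact (Submodule.Quotient.mk_eq_zero _).2
          (Submodule.subset_span (Or.inl ⟨i, a, b, c, rfl⟩))))

theorem Bal₃.ofRight_tmul (f g : ι₁ → A →ₗ[ℂ] A) (f' g' : ι₂ → A →ₗ[ℂ] A) (a b c : A) :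
    Bal₃.ofRight f g f' g' (a ⊗ₜ Bal.π f' g' (b ⊗ₜ c)) = Bal₃.π f g f' g' (a ⊗ₜ (b ⊗ₜ c)) := rfl

theorem Bal₃.ofLeft_tmul (f g : ι₁ → A →ₗ[ℂ] A) (f' g' : ι₂ → A →ₗ[ℂ] A) (a b c : A) :
    Bal₃.ofLeft f g f' g' (Bal.π f g (a ⊗ₜ b) ⊗ₜ c) = Bal₃.π f g f' g' (a ⊗ₜ (b ⊗ₜ c)) := rfl

/-- Commutativity of the square
`(ι ⊗ T') ∘ (T ⊗ ι) = (T ⊗ ι) ∘ (ι ⊗ T') : A ⊗ A ⊗ A → Bal₃ f g f' g'`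
for maps `T : A ⊗ A → Bal f g` and `T' : A ⊗ A → Bal f' g'`.  On the left, `ι ⊗ T'` is applied to
`T (a ⊗ b) ⊗ c` by means of a representative `w ∈ A ⊗ A` of `T (a ⊗ b)`; on the right, `T ⊗ ι` is
applied to `a ⊗ T' (b ⊗ c)` by means of a representative `z` of `T' (b ⊗ c)`.  The maps to which
this is applied below satisfy bimodule relations by which nothing depends on the representatives. -/
def Coassoc {f g : ι₁ → A →ₗ[ℂ] A} {f' g' : ι₂ → A →ₗ[ℂ] A}
    (T : A ⊗[ℂ] A →ₗ[ℂ] Bal f g) (T' : A ⊗[ℂ] A →ₗ[ℂ] Bal f' g') : Prop :=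
  ∀ (a b c : A) (w z : A ⊗[ℂ] A), Bal.π f g w = T (a ⊗ₜ b) → Bal.π f' g' z = T' (b ⊗ₜ c) →
    Bal₃.ofRight f g f' g' (T'.lTensor A (TensorProduct.assoc ℂ A A A (w ⊗ₜ c))) =
      Bal₃.ofLeft f g f' g' (T.rTensor A ((TensorProduct.assoc ℂ A A A).symm (a ⊗ₜ z)))

end Balanced

variable {A : Type*} [NonUnitalRing A] [Module ℂ A] [IsScalarTower ℂ A A] [SMulCommClass ℂ A A]

variable (A) in
/-- A non-degenerate, idempotent algebra `A` with commuting subalgebras `B, C ⊆ M(A)`,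
anti-isomorphisms `S_B : B → C` and `S_C : C → B`, such that the modules `_B A`, `A^B`, `A_C` and
`^C A`, given by `x a`, `S_B(x) a`, `a y` and `a S_C(y)`, are faithful and idempotent. -/
structure BaseData where
  nondegenerate_right : ∀ a : A, (∀ b, a * b = 0) → a = 0
  nondegenerate_left : ∀ a : A, (∀ b, b * a = 0) → a = 0
  idempotent : Submodule.span ℂ {c : A | ∃ a b, c = a * b} = ⊤
  B : NonUnitalSubalgebra ℂ (MultiplierAlgebra A)
  C : NonUnitalSubalgebra ℂ (MultiplierAlgebra A)
  SB : B ≃ₗ[ℂ] C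
  SC : C ≃ₗ[ℂ] B
  SB_mul : ∀ x x' : B, SB (x * x') = SB x' * SB x
  SC_mul : ∀ y y' : C, SC (y * y') = SC y' * SC y
  comm : ∀ (x : B) (y : C), (x : MultiplierAlgebra A) * y = y * x
  faithful_left_B : IsFaithfulAction fun x : B => lmul (A := A) x
  faithful_left_SB : IsFaithfulAction fun x : B => lmul (A := A) (SB x)
  faithful_right_C : IsFaithfulAction fun y : C => rmul (A := A) y
  faithful_right_SC : IsFaithfulAction fun y : C => rmul (A := A) (SC y)
  idempotent_left_B : IsIdempotentAction fun x : B => lmul (A := A) x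
  idempotent_left_SB : IsIdempotentAction fun x : B => lmul (A := A) (SB x)
  idempotent_right_C : IsIdempotentAction fun y : C => rmul (A := A) y
  idempotent_right_SC : IsIdempotentAction fun y : C => rmul (A := A) (SC y)

namespace BaseData

variable (D : BaseData A)

/-- Left multiplication by elements of `B`. -/
abbrev lB (x : D.B) : A →ₗ[ℂ] A := lmul (x : MultiplierAlgebra A)

/-- Right multiplication by elements of `B`. -/
abbrev rB (x : D.B) : A →ₗ[ℂ] A := rmul (x : MultiplierAlgebra A)

/-- Left multiplication by elements of `C`. -/
abbrev lC (y : D.C) : A →ₗ[ℂ] A := lmul (y : MultiplierAlgebra A)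

/-- Right multiplication by elements of `C`. -/
abbrev rC (y : D.C) : A →ₗ[ℂ] A := rmul (y : MultiplierAlgebra A)

/-- The action `x ↦ S_B(x) a` of `B` on `A`. -/
abbrev lSB (x : D.B) : A →ₗ[ℂ] A := D.lC (D.SB x)

/-- The action `y ↦ a S_C(y)` of `C` on `A`. -/
abbrev rSC (y : D.C) : A →ₗ[ℂ] A := D.rB (D.SC y)

/-- `_B A ⊗ A^B`, where `x a ⊗ b = a ⊗ S_B(x) b`: the target of `T_λ` and `T_ρ`. -/
abbrev TargetL : Type _ := Bal D.lB D.lSB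

/-- `^C A ⊗ A_C`, where `a S_C(y) ⊗ b = a ⊗ b y`: the target of `_λ T` and `_ρ T`. -/
abbrev TargetR : Type _ := Bal D.rSC D.rC

/-- `_C A ⊗ A_C`, where `y a ⊗ b = a ⊗ b y`: the domain of `T_λ`. -/
abbrev DomTlam : Type _ := Bal D.lC D.rC

/-- `A_B ⊗ _B A`, where `a x ⊗ b = a ⊗ x b`: the domain of `T_ρ`. -/
abbrev DomTrho : Type _ := Bal D.rB D.lB

/-- `A_C ⊗ _C A`, where `a y ⊗ b = a ⊗ y b`: the domain of `_λ T`. -/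
abbrev DomLamT : Type _ := Bal D.rC D.lC

/-- `_B A ⊗ A_B`, where `x a ⊗ b = a ⊗ b x`: the domain of `_ρ T`. -/
abbrev DomRhoT : Type _ := Bal D.lB D.rB

/-- `w ↦ w (a ⊗ 1)` on `_B A ⊗ A^B`. -/
def mulR₁ (a : A) : Module.End ℂ D.TargetL :=
  Bal.endo (LinearMap.mulRight ℂ a) LinearMap.id
    (fun x b => by simp [lmul_apply_mul]) (fun _ _ => rfl)

/-- `w ↦ w (1 ⊗ a)` on `_B A ⊗ A^B`. -/
def mulR₂ (a : A) : Module.End ℂ D.TargetL :=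
  Bal.endo LinearMap.id (LinearMap.mulRight ℂ a)
    (fun _ _ => rfl) (fun x b => by simp [lmul_apply_mul])

/-- `w ↦ (a ⊗ 1) w` on `^C A ⊗ A_C`. -/
def mulL₁ (a : A) : Module.End ℂ D.TargetR :=
  Bal.endo (LinearMap.mulLeft ℂ a) LinearMap.id
    (fun y b => by simp [rmul_apply_mul]) (fun _ _ => rfl)

/-- `w ↦ (1 ⊗ a) w` on `^C A ⊗ A_C`. -/
def mulL₂ (a : A) : Module.End ℂ D.TargetR :=
  Bal.endo LinearMap.id (LinearMap.mulLeft ℂ a)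
    (fun _ _ => rfl) (fun y b => by simp [rmul_apply_mul])

@[simp] theorem mulR₁_π (a b c : A) :
    D.mulR₁ a (Bal.π _ _ (b ⊗ₜ c)) = Bal.π _ _ ((b * a) ⊗ₜ c) := rfl

@[simp] theorem mulR₂_π (a b c : A) :
    D.mulR₂ a (Bal.π _ _ (b ⊗ₜ c)) = Bal.π _ _ (b ⊗ₜ (c * a)) := rfl

@[simp] theorem mulL₁_π (a b c : A) :
    D.mulL₁ a (Bal.π _ _ (b ⊗ₜ c)) = Bal.π _ _ ((a * b) ⊗ₜ c) := rfl

@[simp] theorem mulL₂_π (a b c : A) :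
    D.mulL₂ a (Bal.π _ _ (b ⊗ₜ c)) = Bal.π _ _ (b ⊗ₜ (a * c)) := rfl

/-- Left multiplication by `y ⊗ x` on `_B A ⊗ A^B`. -/
def legsL (y : D.C) (x : D.B) : Module.End ℂ D.TargetL :=
  Bal.endo (D.lC y) (D.lB x)
    (fun x' a => (lmul_comm (D.comm x' y) a).symm) (fun x' a => lmul_comm (D.comm x (D.SB x')) a)

/-- Right multiplication by `y ⊗ x` on `^C A ⊗ A_C`, as an element of the opposite of the
endomorphism algebra. -/
def legsR (y : D.C) (x : D.B) : (Module.End ℂ D.TargetR)ᵐᵒᵖ :=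
  MulOpposite.op (Bal.endo (D.rC y) (D.rB x)
    (fun y' a => (rmul_comm (D.comm (D.SC y') y) a).symm) (fun y' a => rmul_comm (D.comm x y') a))

/-- The subspace of `End(_B A ⊗ A^B)` in which the left comultiplication takes values: for all
`a, b` there are elements `u = T (a ⊗ 1)` and `v = T (1 ⊗ b)` of `_B A ⊗ A^B` such that
`T (a ⊗ b) = (T (a ⊗ 1)) (1 ⊗ b) = (T (1 ⊗ b)) (a ⊗ 1)`. -/
def InTakeuchiL (T : Module.End ℂ D.TargetL) : Prop :=
  (∀ a : A, ∃ u : D.TargetL, ∀ b : A, T (Bal.π _ _ (a ⊗ₜ b)) = D.mulR₂ b u) ∧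
  (∀ b : A, ∃ v : D.TargetL, ∀ a : A, T (Bal.π _ _ (a ⊗ₜ b)) = D.mulR₁ a v)

/-- The subspace of `End(^C A ⊗ A_C)^op` in which the right comultiplication takes values: for all
`a, b` there are elements `u = (a ⊗ 1) T` and `v = (1 ⊗ b) T` of `^C A ⊗ A_C` such that
`(a ⊗ b) T = (1 ⊗ b) ((a ⊗ 1) T) = (a ⊗ 1) ((1 ⊗ b) T)`. -/
def InTakeuchiR (T : (Module.End ℂ D.TargetR)ᵐᵒᵖ) : Prop :=
  (∀ a : A, ∃ u : D.TargetR, ∀ b : A, T.unop (Bal.π _ _ (a ⊗ₜ b)) = D.mulL₂ b u) ∧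
  (∀ b : A, ∃ v : D.TargetR, ∀ a : A, T.unop (Bal.π _ _ (a ⊗ₜ b)) = D.mulL₁ a v)

/-- `((x y) a) (x' y')`. -/
def sandwich (x : D.B) (y : D.C) (a : A) (x' : D.B) (y' : D.C) : A :=
  D.rC y' (D.rB x' (D.lB x (D.lC y a)))

theorem lmul_rmul (D : BaseData A) (S T : MultiplierAlgebra A) (a : A) :
    lmul S (rmul T a) = rmul T (lmul S a) := by
  rw [← sub_eq_zero]
  refine D.nondegenerate_left _ fun b => ?_
  rw [mul_sub, mul_lmul, ← rmul_apply_mul, ← rmul_apply_mul, mul_lmul, sub_self]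

theorem idem_lC : IsIdempotentAction D.lC := by
  have h := D.idempotent_left_SB
  unfold IsIdempotentAction at h ⊢
  refine top_le_iff.1 (h ▸ Submodule.span_mono ?_)
  rintro _ ⟨x, a, rfl⟩
  exact ⟨D.SB x, a, rfl⟩

theorem idem_rB : IsIdempotentAction D.rB := by
  have h := D.idempotent_right_SC
  unfold IsIdempotentAction at h ⊢
  refine top_le_iff.1 (h ▸ Submodule.span_mono ?_)
  rintro _ ⟨y, a, rfl⟩
  exact ⟨D.SC y, a, rfl⟩

/-- The elements `x y a x' y'` span `A`. -/
theorem sandwich_ext {M : Type*} [AddCommGroup M] [Module ℂ M] {φ ψ : A →ₗ[ℂ] M}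
    (h : ∀ x y a x' y', φ (D.sandwich x y a x' y') = ψ (D.sandwich x y a x' y')) : φ = ψ := by
  refine D.idempotent_right_C.ext fun y' a => ?_
  refine LinearMap.congr_fun (f := φ ∘ₗ D.rC y') (g := ψ ∘ₗ D.rC y') ?_ a
  refine D.idem_rB.ext fun x' a => ?_
  refine LinearMap.congr_fun (f := (φ ∘ₗ D.rC y') ∘ₗ D.rB x') (g := (ψ ∘ₗ D.rC y') ∘ₗ D.rB x') ?_ a
  refine D.idempotent_left_B.ext fun x a => ?_
  refine LinearMap.congr_fun (f := ((φ ∘ₗ D.rC y') ∘ₗ D.rB x') ∘ₗ D.lB x)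
    (g := ((ψ ∘ₗ D.rC y') ∘ₗ D.rB x') ∘ₗ D.lB x) ?_ a
  exact D.idem_lC.ext fun y a => h x y a x' y'

theorem rC_sandwich (x : D.B) (y : D.C) (a : A) (x' : D.B) (y' z : D.C) :
    D.rC z (D.sandwich x y a x' y') = D.sandwich x y a x' (y' * z) := rfl

theorem rB_sandwich (x : D.B) (y : D.C) (a : A) (x' : D.B) (y' : D.C) (z : D.B) :
    D.rB z (D.sandwich x y a x' y') = D.sandwich x y a (x' * z) y' := by
  unfold sandwich
  exact rmul_comm (D.comm z y') _

theorem lB_sandwich (x : D.B) (y : D.C) (a : A) (x' : D.B) (y' : D.C) (z : D.B) :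
    D.lB z (D.sandwich x y a x' y') = D.sandwich (z * x) y a x' y' := by
  unfold sandwich
  rw [D.lmul_rmul, D.lmul_rmul]
  rfl

theorem lC_sandwich (x : D.B) (y : D.C) (a : A) (x' : D.B) (y' z : D.C) :
    D.lC z (D.sandwich x y a x' y') = D.sandwich x (z * y) a x' y' := by
  unfold sandwich
  rw [D.lmul_rmul, D.lmul_rmul, ← lmul_comm (D.comm x z)]
  rfl

/-- The linear map `a ⊗ b ↦ S_B(ω(a)) b`. -/
def preSliceL₁ (ω : A →ₗ[ℂ] D.B) : A ⊗[ℂ] A →ₗ[ℂ] A :=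
  TensorProduct.lift (LinearMap.mk₂ ℂ (fun a b => D.lSB (ω a) b)
    (fun a a' b => by
      rw [map_add, lSB, map_add]; exact LinearMap.congr_fun (lmul_add _ _) _)
    (fun r a b => by
      rw [map_smul, lSB, map_smul]; exact LinearMap.congr_fun (lmul_smul _ _) _)
    (fun a b b' => map_add _ _ _) (fun r a b => map_smul _ _ _))

/-- The linear map `a ⊗ b ↦ ω(b) a`. -/
def preSliceL₂ (ω : A →ₗ[ℂ] D.B) : A ⊗[ℂ] A →ₗ[ℂ] A :=
  TensorProduct.lift (LinearMap.mk₂ ℂ (fun a b => D.lB (ω b) a)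
    (fun a b b' => map_add _ _ _) (fun r a b => map_smul _ _ _)
    (fun a a' b => by
      rw [map_add]; exact LinearMap.congr_fun (lmul_add _ _) _)
    (fun r a b => by
      rw [map_smul]; exact LinearMap.congr_fun (lmul_smul _ _) _))

/-- The linear map `a ⊗ b ↦ b ω(a)`. -/
def preSliceR₁ (ω : A →ₗ[ℂ] D.C) : A ⊗[ℂ] A →ₗ[ℂ] A :=
  TensorProduct.lift (LinearMap.mk₂ ℂ (fun a b => D.rC (ω a) b)
    (fun a a' b => by
      rw [map_add]; exact LinearMap.congr_fun (rmul_add _ _) _)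
    (fun r a b => by
      rw [map_smul]; exact LinearMap.congr_fun (rmul_smul _ _) _)
    (fun a b b' => map_add _ _ _) (fun r a b => map_smul _ _ _))

/-- The linear map `a ⊗ b ↦ a S_C(ω(b))`. -/
def preSliceR₂ (ω : A →ₗ[ℂ] D.C) : A ⊗[ℂ] A →ₗ[ℂ] A :=
  TensorProduct.lift (LinearMap.mk₂ ℂ (fun a b => D.rSC (ω b) a)
    (fun a b b' => map_add _ _ _) (fun r a b => map_smul _ _ _)
    (fun a a' b => by
      rw [map_add, rSC, map_add]; exact LinearMap.congr_fun (rmul_add _ _) _)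
    (fun r a b => by
      rw [map_smul, rSC, map_smul]; exact LinearMap.congr_fun (rmul_smul _ _) _))

end BaseData

variable (A) in
/-- Base data together with a left and a right comultiplication, before co-associativity is
imposed. -/
structure ComultData extends BaseData A where
  /-- `_B A ⊗ A^B` is non-degenerate as a right module over `A ⊗ 1` and over `1 ⊗ A`. -/
  nondegenerate_L₁ : ∀ w : toBaseData.TargetL, (∀ a, toBaseData.mulR₁ a w = 0) → w = 0
  nondegenerate_L₂ : ∀ w : toBaseData.TargetL, (∀ a, toBaseData.mulR₂ a w = 0) → w = 0
  /-- `^C A ⊗ A_C` is non-degenerate as a left module over `A ⊗ 1` and over `1 ⊗ A`. -/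
  nondegenerate_R₁ : ∀ w : toBaseData.TargetR, (∀ a, toBaseData.mulL₁ a w = 0) → w = 0
  nondegenerate_R₂ : ∀ w : toBaseData.TargetR, (∀ a, toBaseData.mulL₂ a w = 0) → w = 0
  /-- The left comultiplication. -/
  ΔB : A →ₙₐ[ℂ] Module.End ℂ toBaseData.TargetL
  ΔB_mem : ∀ a, toBaseData.InTakeuchiL (ΔB a)
  ΔB_bimodule : ∀ x y a x' y', ΔB (toBaseData.sandwich x y a x' y') =
    toBaseData.legsL y x * ΔB a * toBaseData.legsL y' x'
  /-- The right comultiplication. -/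
  ΔC : A →ₙₐ[ℂ] (Module.End ℂ toBaseData.TargetR)ᵐᵒᵖ
  ΔC_mem : ∀ a, toBaseData.InTakeuchiR (ΔC a)
  ΔC_bimodule : ∀ x y a x' y', ΔC (toBaseData.sandwich x y a x' y') =
    toBaseData.legsR y x * ΔC a * toBaseData.legsR y' x'

namespace ComultData

variable (D : ComultData A)

theorem eq_of_mulR₂ {w w' : D.TargetL} (h : ∀ c, D.mulR₂ c w = D.mulR₂ c w') : w = w' :=
  sub_eq_zero.1 (D.nondegenerate_L₂ _ fun c => by rw [map_sub, h, sub_self])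

theorem eq_of_mulR₁ {w w' : D.TargetL} (h : ∀ c, D.mulR₁ c w = D.mulR₁ c w') : w = w' :=
  sub_eq_zero.1 (D.nondegenerate_L₁ _ fun c => by rw [map_sub, h, sub_self])

theorem eq_of_mulL₂ {w w' : D.TargetR} (h : ∀ c, D.mulL₂ c w = D.mulL₂ c w') : w = w' :=
  sub_eq_zero.1 (D.nondegenerate_R₂ _ fun c => by rw [map_sub, h, sub_self])

theorem eq_of_mulL₁ {w w' : D.TargetR} (h : ∀ c, D.mulL₁ c w = D.mulL₁ c w') : w = w' :=
  sub_eq_zero.1 (D.nondegenerate_R₁ _ fun c => by rw [map_sub, h, sub_self])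

/-- The element `Δ_B(b) (a ⊗ 1)`. -/
def tlam (a b : A) : D.TargetL := ((D.ΔB_mem b).1 a).choose

/-- The element `Δ_B(a) (1 ⊗ b)`. -/
def trho (a b : A) : D.TargetL := ((D.ΔB_mem a).2 b).choose

/-- The element `(a ⊗ 1) Δ_C(b)`. -/
def lamt (a b : A) : D.TargetR := ((D.ΔC_mem b).1 a).choose

/-- The element `(1 ⊗ b) Δ_C(a)`. -/
def rhot (a b : A) : D.TargetR := ((D.ΔC_mem a).2 b).choose

theorem mulR₂_tlam (a b c : A) : D.mulR₂ c (D.tlam a b) = D.ΔB b (Bal.π _ _ (a ⊗ₜ c)) :=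
  (((D.ΔB_mem b).1 a).choose_spec c).symm

theorem mulR₁_trho (a b c : A) : D.mulR₁ c (D.trho a b) = D.ΔB a (Bal.π _ _ (c ⊗ₜ b)) :=
  (((D.ΔB_mem a).2 b).choose_spec c).symm

theorem mulL₂_lamt (a b c : A) :
    D.mulL₂ c (D.lamt a b) = (D.ΔC b).unop (Bal.π _ _ (a ⊗ₜ c)) :=
  (((D.ΔC_mem b).1 a).choose_spec c).symm

theorem mulL₁_rhot (a b c : A) :
    D.mulL₁ c (D.rhot a b) = (D.ΔC a).unop (Bal.π _ _ (c ⊗ₜ b)) :=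
  (((D.ΔC_mem a).2 b).choose_spec c).symm

/-- `a ⊗ b ↦ Δ_B(b) (a ⊗ 1)` on `A ⊗ A`. -/
def preTlam : A ⊗[ℂ] A →ₗ[ℂ] D.TargetL :=
  TensorProduct.lift (LinearMap.mk₂ ℂ D.tlam
    (fun a a' b => D.eq_of_mulR₂ fun c => by
      simp only [map_add, mulR₂_tlam, TensorProduct.add_tmul])
    (fun r a b => D.eq_of_mulR₂ fun c => by
      simp only [map_smul, mulR₂_tlam, ← TensorProduct.smul_tmul'])
    (fun a b b' => D.eq_of_mulR₂ fun c => by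
      simp only [map_add, mulR₂_tlam, LinearMap.add_apply])
    (fun r a b => D.eq_of_mulR₂ fun c => by
      simp only [map_smul, mulR₂_tlam, LinearMap.smul_apply]))

/-- `a ⊗ b ↦ Δ_B(a) (1 ⊗ b)` on `A ⊗ A`. -/
def preTrho : A ⊗[ℂ] A →ₗ[ℂ] D.TargetL :=
  TensorProduct.lift (LinearMap.mk₂ ℂ D.trho
    (fun a a' b => D.eq_of_mulR₁ fun c => by
      simp only [map_add, mulR₁_trho, LinearMap.add_apply])
    (fun r a b => D.eq_of_mulR₁ fun c => by
      simp only [map_smul, mulR₁_trho, LinearMap.smul_apply])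
    (fun a b b' => D.eq_of_mulR₁ fun c => by
      simp only [map_add, mulR₁_trho, TensorProduct.tmul_add])
    (fun r a b => D.eq_of_mulR₁ fun c => by
      simp only [map_smul, mulR₁_trho, TensorProduct.tmul_smul]))

/-- `a ⊗ b ↦ (a ⊗ 1) Δ_C(b)` on `A ⊗ A`. -/
def preLamT : A ⊗[ℂ] A →ₗ[ℂ] D.TargetR :=
  TensorProduct.lift (LinearMap.mk₂ ℂ D.lamt
    (fun a a' b => D.eq_of_mulL₂ fun c => by
      simp only [map_add, mulL₂_lamt, TensorProduct.add_tmul])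
    (fun r a b => D.eq_of_mulL₂ fun c => by
      simp only [map_smul, mulL₂_lamt, ← TensorProduct.smul_tmul'])
    (fun a b b' => D.eq_of_mulL₂ fun c => by
      simp only [map_add, mulL₂_lamt, LinearMap.add_apply, MulOpposite.unop_add])
    (fun r a b => D.eq_of_mulL₂ fun c => by
      simp only [map_smul, mulL₂_lamt, LinearMap.smul_apply, MulOpposite.unop_smul]))

/-- `a ⊗ b ↦ (1 ⊗ b) Δ_C(a)` on `A ⊗ A`. -/
def preRhoT : A ⊗[ℂ] A →ₗ[ℂ] D.TargetR :=
  TensorProduct.lift (LinearMap.mk₂ ℂ D.rhot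
    (fun a a' b => D.eq_of_mulL₁ fun c => by
      simp only [map_add, mulL₁_rhot, LinearMap.add_apply, MulOpposite.unop_add])
    (fun r a b => D.eq_of_mulL₁ fun c => by
      simp only [map_smul, mulL₁_rhot, LinearMap.smul_apply, MulOpposite.unop_smul])
    (fun a b b' => D.eq_of_mulL₁ fun c => by
      simp only [map_add, mulL₁_rhot, TensorProduct.tmul_add])
    (fun r a b => D.eq_of_mulL₁ fun c => by
      simp only [map_smul, mulL₁_rhot, TensorProduct.tmul_smul]))

theorem mulR₂_preTlam (a b c : A) :
    D.mulR₂ c (D.preTlam (a ⊗ₜ b)) = D.ΔB b (Bal.π _ _ (a ⊗ₜ c)) := D.mulR₂_tlam a b c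

theorem mulR₁_preTrho (a b c : A) :
    D.mulR₁ c (D.preTrho (a ⊗ₜ b)) = D.ΔB a (Bal.π _ _ (c ⊗ₜ b)) := D.mulR₁_trho a b c

theorem mulL₂_preLamT (a b c : A) :
    D.mulL₂ c (D.preLamT (a ⊗ₜ b)) = (D.ΔC b).unop (Bal.π _ _ (a ⊗ₜ c)) := D.mulL₂_lamt a b c

theorem mulL₁_preRhoT (a b c : A) :
    D.mulL₁ c (D.preRhoT (a ⊗ₜ b)) = (D.ΔC a).unop (Bal.π _ _ (c ⊗ₜ b)) := D.mulL₁_rhot a b c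

theorem ΔB_rC (a : A) (y : D.C) (c d : A) :
    D.ΔB (D.rC y a) (Bal.π _ _ (c ⊗ₜ d)) = D.ΔB a (Bal.π _ _ (D.lC y c ⊗ₜ d)) := by
  let ev (w : D.TargetL) : A →ₗ[ℂ] D.TargetL :=
    (LinearMap.applyₗ w) ∘ₗ (D.ΔB : A →ₗ[ℂ] Module.End ℂ D.TargetL)
  refine LinearMap.congr_fun (f := ev (Bal.π _ _ (c ⊗ₜ d)) ∘ₗ D.rC y)
    (g := ev (Bal.π _ _ (D.lC y c ⊗ₜ d))) (D.sandwich_ext fun x z b x' z' => ?_) a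
  change D.ΔB (D.rC y (D.sandwich x z b x' z')) _ = D.ΔB (D.sandwich x z b x' z') _
  rw [D.rC_sandwich, D.ΔB_bimodule, D.ΔB_bimodule]
  rfl

theorem ΔB_rB (a : A) (x : D.B) (c d : A) :
    D.ΔB (D.rB x a) (Bal.π _ _ (c ⊗ₜ d)) = D.ΔB a (Bal.π _ _ (c ⊗ₜ D.lB x d)) := by
  let ev (w : D.TargetL) : A →ₗ[ℂ] D.TargetL :=
    (LinearMap.applyₗ w) ∘ₗ (D.ΔB : A →ₗ[ℂ] Module.End ℂ D.TargetL)
  refine LinearMap.congr_fun (f := ev (Bal.π _ _ (c ⊗ₜ d)) ∘ₗ D.rB x)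
    (g := ev (Bal.π _ _ (c ⊗ₜ D.lB x d))) (D.sandwich_ext fun x₁ z b x' z' => ?_) a
  change D.ΔB (D.rB x (D.sandwich x₁ z b x' z')) _ = D.ΔB (D.sandwich x₁ z b x' z') _
  rw [D.rB_sandwich, D.ΔB_bimodule, D.ΔB_bimodule]
  rfl

theorem ΔC_lC (a : A) (y : D.C) (c d : A) :
    (D.ΔC (D.lC y a)).unop (Bal.π _ _ (c ⊗ₜ d)) =
      (D.ΔC a).unop (Bal.π _ _ (D.rC y c ⊗ₜ d)) := by
  let ev (w : D.TargetR) : A →ₗ[ℂ] D.TargetR :=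
    (LinearMap.applyₗ w) ∘ₗ (MulOpposite.opLinearEquiv ℂ).symm.toLinearMap ∘ₗ
      (D.ΔC : A →ₗ[ℂ] (Module.End ℂ D.TargetR)ᵐᵒᵖ)
  refine LinearMap.congr_fun (f := ev (Bal.π _ _ (c ⊗ₜ d)) ∘ₗ D.lC y)
    (g := ev (Bal.π _ _ (D.rC y c ⊗ₜ d))) (D.sandwich_ext fun x z b x' z' => ?_) a
  change (D.ΔC (D.lC y (D.sandwich x z b x' z'))).unop _ =
    (D.ΔC (D.sandwich x z b x' z')).unop _
  rw [D.lC_sandwich, D.ΔC_bimodule, D.ΔC_bimodule]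
  rfl

theorem ΔC_lB (a : A) (x : D.B) (c d : A) :
    (D.ΔC (D.lB x a)).unop (Bal.π _ _ (c ⊗ₜ d)) =
      (D.ΔC a).unop (Bal.π _ _ (c ⊗ₜ D.rB x d)) := by
  let ev (w : D.TargetR) : A →ₗ[ℂ] D.TargetR :=
    (LinearMap.applyₗ w) ∘ₗ (MulOpposite.opLinearEquiv ℂ).symm.toLinearMap ∘ₗ
      (D.ΔC : A →ₗ[ℂ] (Module.End ℂ D.TargetR)ᵐᵒᵖ)
  refine LinearMap.congr_fun (f := ev (Bal.π _ _ (c ⊗ₜ d)) ∘ₗ D.lB x)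
    (g := ev (Bal.π _ _ (c ⊗ₜ D.rB x d))) (D.sandwich_ext fun x₁ z b x' z' => ?_) a
  change (D.ΔC (D.lB x (D.sandwich x₁ z b x' z'))).unop _ =
    (D.ΔC (D.sandwich x₁ z b x' z')).unop _
  rw [D.lB_sandwich, D.ΔC_bimodule, D.ΔC_bimodule]
  rfl

/-- The canonical map `T_λ : _C A ⊗ A_C → _B A ⊗ A^B`, `a ⊗ b ↦ Δ_B(b) (a ⊗ 1)`. -/
def Tlam : D.DomTlam →ₗ[ℂ] D.TargetL :=
  Bal.lift D.preTlam fun y a b => D.eq_of_mulR₂ fun c => by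
    rw [mulR₂_preTlam, mulR₂_preTlam, ΔB_rC]

/-- The canonical map `T_ρ : A_B ⊗ _B A → _B A ⊗ A^B`, `a ⊗ b ↦ Δ_B(a) (1 ⊗ b)`. -/
def Trho : D.DomTrho →ₗ[ℂ] D.TargetL :=
  Bal.lift D.preTrho fun x a b => D.eq_of_mulR₁ fun c => by
    rw [mulR₁_preTrho, mulR₁_preTrho, ΔB_rB]

/-- The canonical map `_λ T : A_C ⊗ _C A → ^C A ⊗ A_C`, `a ⊗ b ↦ (a ⊗ 1) Δ_C(b)`. -/
def lamT : D.DomLamT →ₗ[ℂ] D.TargetR :=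
  Bal.lift D.preLamT fun y a b => D.eq_of_mulL₂ fun c => by
    rw [mulL₂_preLamT, mulL₂_preLamT, ΔC_lC]

/-- The canonical map `_ρ T : _B A ⊗ A_B → ^C A ⊗ A_C`, `a ⊗ b ↦ (1 ⊗ b) Δ_C(a)`. -/
def rhoT : D.DomRhoT →ₗ[ℂ] D.TargetR :=
  Bal.lift D.preRhoT fun x a b => D.eq_of_mulL₁ fun c => by
    rw [mulL₁_preRhoT, mulL₁_preRhoT, ΔC_lB]

end ComultData

variable (A) in
/-- A multiplier bialgebroid `(A, B, C, S_B, S_C, Δ_B, Δ_C)`: the left and the right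
comultiplication are co-associative, and they satisfy the mixed co-associativity conditions. -/
structure MultiplierBialgebroid extends ComultData A where
  coassoc_left : Coassoc toComultData.preTlam toComultData.preTrho
  coassoc_right : Coassoc toComultData.preLamT toComultData.preRhoT
  coassoc_mixed₁ : Coassoc toComultData.preTlam toComultData.preRhoT
  coassoc_mixed₂ : Coassoc toComultData.preLamT toComultData.preTrho

namespace MultiplierBialgebroid

variable (𝒜 : MultiplierBialgebroid A)

/-- `ω ∈ Hom(_B A, _B B)`. -/
def IsHomLeftB (ω : A →ₗ[ℂ] 𝒜.B) : Prop := ∀ x a, ω (𝒜.lB x a) = x * ω a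

/-- `ω ∈ Hom(A^B, B_B)`. -/
def IsHomRightB (ω : A →ₗ[ℂ] 𝒜.B) : Prop := ∀ x a, ω (𝒜.lSB x a) = ω a * x

/-- `ω ∈ Hom(A_C, C_C)`. -/
def IsHomRightC (ω : A →ₗ[ℂ] 𝒜.C) : Prop := ∀ y a, ω (𝒜.rC y a) = ω a * y

/-- `ω ∈ Hom(^C A, _C C)`. -/
def IsHomLeftC (ω : A →ₗ[ℂ] 𝒜.C) : Prop := ∀ y a, ω (𝒜.rSC y a) = y * ω a

/-- The span of the images of all `ω ∈ Hom(_B A, _B B)`. -/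
def idealLeftB : Submodule ℂ 𝒜.B := Submodule.span ℂ {x | ∃ ω a, 𝒜.IsHomLeftB ω ∧ x = ω a}

/-- The span of the images of all `ω ∈ Hom(A^B, B_B)`. -/
def idealRightB : Submodule ℂ 𝒜.B := Submodule.span ℂ {x | ∃ ω a, 𝒜.IsHomRightB ω ∧ x = ω a}

/-- The span of the images of all `ω ∈ Hom(A_C, C_C)`. -/
def idealRightC : Submodule ℂ 𝒜.C := Submodule.span ℂ {y | ∃ ω a, 𝒜.IsHomRightC ω ∧ y = ω a}

/-- The span of the images of all `ω ∈ Hom(^C A, _C C)`. -/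
def idealLeftC : Submodule ℂ 𝒜.C := Submodule.span ℂ {y | ∃ ω a, 𝒜.IsHomLeftC ω ∧ y = ω a}

/-- A multiplier bialgebroid is a regular multiplier Hopf algebroid if `S_B(_B I) A = A`,
`I^B A = A`, `A S_C(I_C) = A`, `A (^C I) = A`, where `_B I`, `I^B`, `I_C`, `^C I` are the four spans
defined above, and the four canonical maps are bijective. -/
structure IsRegularMultiplierHopfAlgebroid : Prop where
  full_left_SB : IsIdempotentAction fun x : 𝒜.idealLeftB => 𝒜.lSB (x : 𝒜.B)
  full_left_B : IsIdempotentAction fun x : 𝒜.idealRightB => 𝒜.lB (x : 𝒜.B)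
  full_right_SC : IsIdempotentAction fun y : 𝒜.idealRightC => 𝒜.rSC (y : 𝒜.C)
  full_right_C : IsIdempotentAction fun y : 𝒜.idealLeftC => 𝒜.rC (y : 𝒜.C)
  bijective_Tlam : Function.Bijective 𝒜.Tlam
  bijective_Trho : Function.Bijective 𝒜.Trho
  bijective_lamT : Function.Bijective 𝒜.lamT
  bijective_rhoT : Function.Bijective 𝒜.rhoT

/-- The slice map `ω ⊗ ι : _B A ⊗ A^B → A`, `a ⊗ b ↦ S_B(ω(a)) b`. -/
def sliceL₁ (ω : A →ₗ[ℂ] 𝒜.B) (h : 𝒜.IsHomLeftB ω) : 𝒜.TargetL →ₗ[ℂ] A :=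
  Bal.lift (𝒜.preSliceL₁ ω) fun x a b => by
    change 𝒜.lSB (ω (𝒜.lB x a)) b = 𝒜.lSB (ω a) (𝒜.lSB x b)
    rw [h, BaseData.lSB, 𝒜.SB_mul]; rfl

/-- The slice map `ι ⊗ ω : _B A ⊗ A^B → A`, `a ⊗ b ↦ ω(b) a`. -/
def sliceL₂ (ω : A →ₗ[ℂ] 𝒜.B) (h : 𝒜.IsHomRightB ω) : 𝒜.TargetL →ₗ[ℂ] A :=
  Bal.lift (𝒜.preSliceL₂ ω) fun x a b => by
    change 𝒜.lB (ω b) (𝒜.lB x a) = 𝒜.lB (ω (𝒜.lSB x b)) a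
    rw [h]; rfl

/-- The slice map `ω ⊗ ι : ^C A ⊗ A_C → A`, `a ⊗ b ↦ b ω(a)`. -/
def sliceR₁ (ω : A →ₗ[ℂ] 𝒜.C) (h : 𝒜.IsHomLeftC ω) : 𝒜.TargetR →ₗ[ℂ] A :=
  Bal.lift (𝒜.preSliceR₁ ω) fun y a b => by
    change 𝒜.rC (ω (𝒜.rSC y a)) b = 𝒜.rC (ω a) (𝒜.rC y b)
    rw [h]; rfl

/-- The slice map `ι ⊗ ω : ^C A ⊗ A_C → A`, `a ⊗ b ↦ a S_C(ω(b))`. -/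
def sliceR₂ (ω : A →ₗ[ℂ] 𝒜.C) (h : 𝒜.IsHomRightC ω) : 𝒜.TargetR →ₗ[ℂ] A :=
  Bal.lift (𝒜.preSliceR₂ ω) fun y a b => by
    change 𝒜.rSC (ω b) (𝒜.rSC y a) = 𝒜.rSC (ω (𝒜.rC y b)) a
    rw [h, BaseData.rSC, BaseData.rSC, BaseData.rSC, 𝒜.SC_mul]; rfl

/-- A left counit: `ε(x a) = x ε(a)`, `ε(S_B(x) a) = ε(a) x`, `(ε ⊗ ι)(T_ρ(a ⊗ b)) = a b` and
`(ι ⊗ ε)(T_λ(a ⊗ b)) = b a`. -/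
structure IsLeftCounit (ε : A →ₗ[ℂ] 𝒜.B) : Prop where
  hom_left : 𝒜.IsHomLeftB ε
  hom_right : 𝒜.IsHomRightB ε
  counit_Trho : ∀ a b : A, 𝒜.sliceL₁ ε hom_left (𝒜.Trho (Bal.π _ _ (a ⊗ₜ b))) = a * b
  counit_Tlam : ∀ a b : A, 𝒜.sliceL₂ ε hom_right (𝒜.Tlam (Bal.π _ _ (a ⊗ₜ b))) = b * a

/-- A right counit: `ε(a y) = ε(a) y`, `ε(a S_C(y)) = y ε(a)`, `(ε ⊗ ι)(_ρ T(a ⊗ b)) = b a` and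
`(ι ⊗ ε)(_λ T(a ⊗ b)) = a b`. -/
structure IsRightCounit (ε : A →ₗ[ℂ] 𝒜.C) : Prop where
  hom_right : 𝒜.IsHomRightC ε
  hom_left : 𝒜.IsHomLeftC ε
  counit_rhoT : ∀ a b : A, 𝒜.sliceR₁ ε hom_left (𝒜.rhoT (Bal.π _ _ (a ⊗ₜ b))) = b * a
  counit_lamT : ∀ a b : A, 𝒜.sliceR₂ ε hom_right (𝒜.lamT (Bal.π _ _ (a ⊗ₜ b))) = a * b

/-- `S` is an anti-automorphism of `A` with
`S(x y a x' y') = S_C(y') S_B(x') S(a) S_C(y) S_B(x)`. -/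
structure IsCompatibleAntiAut (S : A ≃ₗ[ℂ] A) : Prop where
  anti_mul : ∀ a b, S (a * b) = S b * S a
  bimodule : ∀ x y a x' y', S (𝒜.sandwich x y a x' y') =
    𝒜.lB (𝒜.SC y') (𝒜.lC (𝒜.SB x') (𝒜.rC (𝒜.SB x) (𝒜.rB (𝒜.SC y) (S a))))

namespace IsCompatibleAntiAut

variable {𝒜} {S : A ≃ₗ[ℂ] A}

theorem map_rC (hS : 𝒜.IsCompatibleAntiAut S) (y : 𝒜.C) (a : A) :
    S (𝒜.rC y a) = 𝒜.lB (𝒜.SC y) (S a) := by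
  refine LinearMap.congr_fun (f := S.toLinearMap ∘ₗ 𝒜.rC y)
    (g := 𝒜.lB (𝒜.SC y) ∘ₗ S.toLinearMap) (𝒜.sandwich_ext fun x z b x' z' => ?_) a
  change S (𝒜.rC y (𝒜.sandwich x z b x' z')) = 𝒜.lB (𝒜.SC y) (S (𝒜.sandwich x z b x' z'))
  rw [𝒜.rC_sandwich, hS.bimodule, hS.bimodule, 𝒜.SC_mul]
  rfl

theorem map_rB (hS : 𝒜.IsCompatibleAntiAut S) (x : 𝒜.B) (a : A) :
    S (𝒜.rB x a) = 𝒜.lC (𝒜.SB x) (S a) := by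
  refine LinearMap.congr_fun (f := S.toLinearMap ∘ₗ 𝒜.rB x)
    (g := 𝒜.lC (𝒜.SB x) ∘ₗ S.toLinearMap) (𝒜.sandwich_ext fun x₁ z b x' z' => ?_) a
  change S (𝒜.rB x (𝒜.sandwich x₁ z b x' z')) = 𝒜.lC (𝒜.SB x) (S (𝒜.sandwich x₁ z b x' z'))
  rw [𝒜.rB_sandwich, hS.bimodule, hS.bimodule, 𝒜.SB_mul,
    ← lmul_comm (𝒜.comm (𝒜.SC z') (𝒜.SB x))]
  rfl

theorem map_lB (hS : 𝒜.IsCompatibleAntiAut S) (x : 𝒜.B) (a : A) :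
    S (𝒜.lB x a) = 𝒜.rC (𝒜.SB x) (S a) := by
  refine LinearMap.congr_fun (f := S.toLinearMap ∘ₗ 𝒜.lB x)
    (g := 𝒜.rC (𝒜.SB x) ∘ₗ S.toLinearMap) (𝒜.sandwich_ext fun x₁ z b x' z' => ?_) a
  change S (𝒜.lB x (𝒜.sandwich x₁ z b x' z')) = 𝒜.rC (𝒜.SB x) (S (𝒜.sandwich x₁ z b x' z'))
  rw [𝒜.lB_sandwich, hS.bimodule, hS.bimodule, 𝒜.SB_mul, ← 𝒜.lmul_rmul, ← 𝒜.lmul_rmul]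
  rfl

theorem map_lC (hS : 𝒜.IsCompatibleAntiAut S) (y : 𝒜.C) (a : A) :
    S (𝒜.lC y a) = 𝒜.rB (𝒜.SC y) (S a) := by
  refine LinearMap.congr_fun (f := S.toLinearMap ∘ₗ 𝒜.lC y)
    (g := 𝒜.rB (𝒜.SC y) ∘ₗ S.toLinearMap) (𝒜.sandwich_ext fun x₁ z b x' z' => ?_) a
  change S (𝒜.lC y (𝒜.sandwich x₁ z b x' z')) = 𝒜.rB (𝒜.SC y) (S (𝒜.sandwich x₁ z b x' z'))
  rw [𝒜.lC_sandwich, hS.bimodule, hS.bimodule, 𝒜.SC_mul, ← 𝒜.lmul_rmul, ← 𝒜.lmul_rmul,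
    rmul_comm (𝒜.comm (𝒜.SC y) (𝒜.SB x₁))]
  rfl

theorem symm_rC (hS : 𝒜.IsCompatibleAntiAut S) (x : 𝒜.B) (a : A) :
    S.symm (𝒜.rC (𝒜.SB x) a) = 𝒜.lB x (S.symm a) := by
  rw [LinearEquiv.symm_apply_eq, hS.map_lB, LinearEquiv.apply_symm_apply]

theorem symm_rB (hS : 𝒜.IsCompatibleAntiAut S) (y : 𝒜.C) (a : A) :
    S.symm (𝒜.rB (𝒜.SC y) a) = 𝒜.lC y (S.symm a) := by
  rw [LinearEquiv.symm_apply_eq, hS.map_lC, LinearEquiv.apply_symm_apply]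

theorem symm_lB (hS : 𝒜.IsCompatibleAntiAut S) (y : 𝒜.C) (a : A) :
    S.symm (𝒜.lB (𝒜.SC y) a) = 𝒜.rC y (S.symm a) := by
  rw [LinearEquiv.symm_apply_eq, hS.map_rC, LinearEquiv.apply_symm_apply]

theorem symm_lC (hS : 𝒜.IsCompatibleAntiAut S) (x : 𝒜.B) (a : A) :
    S.symm (𝒜.lC (𝒜.SB x) a) = 𝒜.rB x (S.symm a) := by
  rw [LinearEquiv.symm_apply_eq, hS.map_rB, LinearEquiv.apply_symm_apply]

/-- `S ⊗ ι : _B A ⊗ A^B → A_C ⊗ _C A`, with inverse `S⁻¹ ⊗ ι`. -/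
def targetLToDomLamT (hS : 𝒜.IsCompatibleAntiAut S) : 𝒜.TargetL ≃ₗ[ℂ] 𝒜.DomLamT :=
  LinearEquiv.ofLinearMap
    (Bal.map S.toLinearMap LinearMap.id fun x a b => by
      change Bal.π _ _ (S (𝒜.lB x a) ⊗ₜ b) = Bal.π _ _ (S a ⊗ₜ 𝒜.lC (𝒜.SB x) b)
      rw [hS.map_lB, Bal.rel])
    (Bal.map S.symm.toLinearMap LinearMap.id fun y a b => by
      obtain ⟨x, rfl⟩ := 𝒜.SB.surjective y
      change Bal.π _ _ (S.symm (𝒜.rC (𝒜.SB x) a) ⊗ₜ b) = Bal.π _ _ (S.symm a ⊗ₜ 𝒜.lSB x b)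
      rw [hS.symm_rC, Bal.rel])
    (Bal.ext (fun a b => by
      change Bal.π _ _ (S (S.symm a) ⊗ₜ b) = Bal.π _ _ (a ⊗ₜ b)
      rw [LinearEquiv.apply_symm_apply]))
    (Bal.ext (fun a b => by
      change Bal.π _ _ (S.symm (S a) ⊗ₜ b) = Bal.π _ _ (a ⊗ₜ b)
      rw [LinearEquiv.symm_apply_apply]))

/-- `S ⊗ ι : _C A ⊗ A_C → ^C A ⊗ A_C`, with inverse `S⁻¹ ⊗ ι`. -/
def domTlamToTargetR (hS : 𝒜.IsCompatibleAntiAut S) : 𝒜.DomTlam ≃ₗ[ℂ] 𝒜.TargetR :=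
  LinearEquiv.ofLinearMap
    (Bal.map S.toLinearMap LinearMap.id fun y a b => by
      change Bal.π _ _ (S (𝒜.lC y a) ⊗ₜ b) = Bal.π _ _ (S a ⊗ₜ 𝒜.rC y b)
      rw [hS.map_lC, ← Bal.rel 𝒜.rSC 𝒜.rC])
    (Bal.map S.symm.toLinearMap LinearMap.id fun y a b => by
      change Bal.π _ _ (S.symm (𝒜.rB (𝒜.SC y) a) ⊗ₜ b) = Bal.π _ _ (S.symm a ⊗ₜ 𝒜.rC y b)
      rw [hS.symm_rB, Bal.rel])
    (Bal.ext (fun a b => by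
      change Bal.π _ _ (S (S.symm a) ⊗ₜ b) = Bal.π _ _ (a ⊗ₜ b)
      rw [LinearEquiv.apply_symm_apply]))
    (Bal.ext (fun a b => by
      change Bal.π _ _ (S.symm (S a) ⊗ₜ b) = Bal.π _ _ (a ⊗ₜ b)
      rw [LinearEquiv.symm_apply_apply]))

/-- `ι ⊗ S : ^C A ⊗ A_C → A_B ⊗ _B A`, with inverse `ι ⊗ S⁻¹`. -/
def targetRToDomTrho (hS : 𝒜.IsCompatibleAntiAut S) : 𝒜.TargetR ≃ₗ[ℂ] 𝒜.DomTrho :=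
  LinearEquiv.ofLinearMap
    (Bal.map LinearMap.id S.toLinearMap fun y a b => by
      change Bal.π _ _ (𝒜.rB (𝒜.SC y) a ⊗ₜ S b) = Bal.π _ _ (a ⊗ₜ S (𝒜.rC y b))
      rw [hS.map_rC, Bal.rel])
    (Bal.map LinearMap.id S.symm.toLinearMap fun x a b => by
      obtain ⟨y, rfl⟩ := 𝒜.SC.surjective x
      change Bal.π _ _ (𝒜.rSC y a ⊗ₜ S.symm b) = Bal.π _ _ (a ⊗ₜ S.symm (𝒜.lB (𝒜.SC y) b))
      rw [hS.symm_lB, Bal.rel])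
    (Bal.ext (fun a b => by
      change Bal.π _ _ (a ⊗ₜ S (S.symm b)) = Bal.π _ _ (a ⊗ₜ b)
      rw [LinearEquiv.apply_symm_apply]))
    (Bal.ext (fun a b => by
      change Bal.π _ _ (a ⊗ₜ S.symm (S b)) = Bal.π _ _ (a ⊗ₜ b)
      rw [LinearEquiv.symm_apply_apply]))

/-- `ι ⊗ S : _B A ⊗ A_B → _B A ⊗ A^B`, with inverse `ι ⊗ S⁻¹`. -/
def domRhoTToTargetL (hS : 𝒜.IsCompatibleAntiAut S) : 𝒜.DomRhoT ≃ₗ[ℂ] 𝒜.TargetL :=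
  LinearEquiv.ofLinearMap
    (Bal.map LinearMap.id S.toLinearMap fun x a b => by
      change Bal.π _ _ (𝒜.lB x a ⊗ₜ S b) = Bal.π _ _ (a ⊗ₜ S (𝒜.rB x b))
      rw [hS.map_rB, Bal.rel])
    (Bal.map LinearMap.id S.symm.toLinearMap fun x a b => by
      change Bal.π _ _ (𝒜.lB x a ⊗ₜ S.symm b) = Bal.π _ _ (a ⊗ₜ S.symm (𝒜.lC (𝒜.SB x) b))
      rw [hS.symm_lC, Bal.rel])
    (Bal.ext (fun a b => by
      change Bal.π _ _ (a ⊗ₜ S (S.symm b)) = Bal.π _ _ (a ⊗ₜ b)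
      rw [LinearEquiv.apply_symm_apply]))
    (Bal.ext (fun a b => by
      change Bal.π _ _ (a ⊗ₜ S.symm (S b)) = Bal.π _ _ (a ⊗ₜ b)
      rw [LinearEquiv.symm_apply_apply]))

end IsCompatibleAntiAut

/-- The multiplication `m_B : A_B ⊗ _B A → A`. -/
def multB : 𝒜.DomTrho →ₗ[ℂ] A :=
  Bal.lift (LinearMap.mul' ℂ A) fun x a b => by simp [mul_lmul]

/-- The multiplication `m_C : A_C ⊗ _C A → A`. -/
def multC : 𝒜.DomLamT →ₗ[ℂ] A :=
  Bal.lift (LinearMap.mul' ℂ A) fun y a b => by simp [mul_lmul]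

/-- An invertible antipode: an anti-automorphism `S` of `A` with
`S(x y a x' y') = S_C(y') S_B(x') S(a) S_C(y) S_B(x)` such that, for some left counit `ε_B` and some
right counit `ε_C`, `m_C ∘ (S ⊗ ι) ∘ T_ρ = S_C ε_C ⊗ ι` and `m_B ∘ (ι ⊗ S) ∘ _λ T = ι ⊗ S_B ε_B`. -/
structure IsInvertibleAntipode (S : A ≃ₗ[ℂ] A) : Prop extends 𝒜.IsCompatibleAntiAut S where
  antipode : ∃ (εB : A →ₗ[ℂ] 𝒜.B) (εC : A →ₗ[ℂ] 𝒜.C), 𝒜.IsLeftCounit εB ∧ 𝒜.IsRightCounit εC ∧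
    (∀ a b : A, 𝒜.multC (toIsCompatibleAntiAut.targetLToDomLamT (𝒜.Trho (Bal.π _ _ (a ⊗ₜ b)))) =
      𝒜.lB (𝒜.SC (εC a)) b) ∧
    (∀ a b : A, 𝒜.multB (toIsCompatibleAntiAut.targetRToDomTrho (𝒜.lamT (Bal.π _ _ (a ⊗ₜ b)))) =
      𝒜.rC (𝒜.SB (εB b)) a)

end MultiplierBialgebroid

end MultHopf

end

/-! The data are symmetric under passing to the opposite algebra, which exchanges `B` with `C`, left
with right, and `S` with `S⁻¹`. They are therefore recast in a self-dual form
(`SymmetricBialgebroid`), so that every statement about one side also gives the one about the other.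

From bijectivity to the counit: bijectivity of `T_ρ` and `T_λ` gives maps `E`, `F` on `_B A ⊗ A^B`
with `E T_ρ(a ⊗ b) = ab` and `F T_λ(a ⊗ b) = ba`. Co-associativity yields `ι ⊗ E = F ⊗ ι`. Slicing
this identity with the functionals supplied by fullness shows that `E` and `F` come from a single
map `ε_B` (`Regular.exists_counit`).

From the counits to the antipode: inverting `T_ρ` and `_λ T` again gives `P` with `P T_ρ(a ⊗ b) =
S_C(ε_C(a)) b` and `Q` with `Q _λ T(a ⊗ b) = a S_B(ε_B(b))`. Mixed co-associativity gives `a P(b ⊗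
c) = Q(a ⊗ b) c` (`Regular.antipodal_pairing`), so that `b` defines a two-sided multiplier `S(b)`.
It is anti-multiplicative in `b` because `ε_B(ab) = ε_B(a S_B(ε_B(b)))`. That `S(b)` lies in `A`,
and that `S` is onto, follows from the relation `S(S⁻¹(b) a) = S(a) b`, where `S⁻¹(b) a` is read as
the map `Q'` of the opposite (`Regular.leftAntipodal_rightAntipodal`), together with `ε_C(A) A = A =
S_C(ε_C(A)) A`. The opposite produces the inverse (`Regular.exists_isAntipode`).

From the antipode to bijectivity: the antipode identities and mixed co-associativity give the
inversion formulas (`IsAntipode.Tr_rT`, `IsAntipode.lT_Tl` and their opposites), which make all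
canonical maps bijective. The counits themselves witness fullness. Uniqueness holds because the
defining identities prescribe the slices of a counit, and then `P`, on the range of a surjective
canonical map. -/

noncomputable section

namespace MultHopf

/-! ### Evaluating co-associativity on linear maps out of threefold tensor products -/

section Coassoc

variable {A : Type*} [NonUnitalRing A] [Module ℂ A] {ι₁ ι₂ : Type*}
  {f g : ι₁ → A →ₗ[ℂ] A} {f' g' : ι₂ → A →ₗ[ℂ] A}
  {M : Type*} [AddCommGroup M] [Module ℂ M]

theorem Bal.congr {φ ψ : Bal f g →ₗ[ℂ] M}
    (h : ∀ a b, φ (Bal.π f g (a ⊗ₜ b)) = ψ (Bal.π f g (a ⊗ₜ b))) (w : Bal f g) : φ w = ψ w :=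
  LinearMap.congr_fun (Bal.ext h) w

/-- Linear maps on the codomain of a surjective map `T` on `A ⊗ A` are determined by their values
on the elements `T (a ⊗ b)`. -/
theorem congr_of_surjective {N : Type*} [AddCommGroup N] [Module ℂ N] {T : A ⊗[ℂ] A →ₗ[ℂ] N}
    (hT : Function.Surjective T) {φ ψ : N →ₗ[ℂ] M}
    (h : ∀ a b, φ (T (a ⊗ₜ b)) = ψ (T (a ⊗ₜ b))) (w : N) : φ w = ψ w := by
  obtain ⟨t, rfl⟩ := hT w
  exact LinearMap.congr_fun (f := φ ∘ₗ T) (g := ψ ∘ₗ T) (TensorProduct.ext' h) t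

/-- Two compatible families of linear maps on `A ⊗ Bal f' g'` and on `Bal f g ⊗ A` come from a
linear map on the threefold balanced tensor product. -/
theorem Bal₃.exists_lift (Φ₁₂ : A → Bal f g →ₗ[ℂ] M) (Φ₂₃ : A → Bal f' g' →ₗ[ℂ] M)
    (h : ∀ a b c, Φ₁₂ c (Bal.π f g (a ⊗ₜ b)) = Φ₂₃ a (Bal.π f' g' (b ⊗ₜ c))) :
    ∃ Ψ : Bal₃ f g f' g' →ₗ[ℂ] M, ∀ a b c,
      Ψ (Bal₃.π f g f' g' (a ⊗ₜ (b ⊗ₜ c))) = Φ₂₃ a (Bal.π f' g' (b ⊗ₜ c)) := by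
  -- `Φ₂₃ a` is not assumed linear in `a`. Linearity is inherited from `Φ₁₂ c`, which sees `a` as a
  -- tensor factor.
  let Φ : A →ₗ[ℂ] A ⊗[ℂ] A →ₗ[ℂ] M :=
    { toFun := fun a => Φ₂₃ a ∘ₗ Bal.π f' g'
      map_add' := fun a a' => TensorProduct.ext' fun b c => by
        simp only [LinearMap.comp_apply, LinearMap.add_apply, ← h, TensorProduct.add_tmul, map_add]
      map_smul' := fun r a => TensorProduct.ext' fun b c => by
        simp only [LinearMap.comp_apply, LinearMap.smul_apply, ← h, ← TensorProduct.smul_tmul',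
          map_smul, RingHom.id_apply] }
  have hΦ : ∀ a b c, TensorProduct.lift Φ (a ⊗ₜ (b ⊗ₜ c)) = Φ₂₃ a (Bal.π f' g' (b ⊗ₜ c)) :=
    fun a b c => by rw [TensorProduct.lift.tmul]; rfl
  refine ⟨Submodule.liftQ _ (TensorProduct.lift Φ) (Submodule.span_le.2 ?_), fun a b c => hΦ a b c⟩
  rintro _ (⟨i, a, b, c, rfl⟩ | ⟨j, a, b, c, rfl⟩)
  · rw [SetLike.mem_coe, LinearMap.mem_ker, map_sub, hΦ, hΦ, ← h, ← h, Bal.rel, sub_self]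
  · rw [SetLike.mem_coe, LinearMap.mem_ker, map_sub, hΦ, hΦ, Bal.rel, sub_self]

/-- `Φ₁₂` and `Φ₂₃` are the two partial forms of one map `Ψ` on the threefold tensor product, and
`G`, `H` are `Ψ ∘ (ι ⊗ T')` with the last variable fixed and `Ψ ∘ (T ⊗ ι)` with the first one fixed.
Applying `Ψ` to both sides of co-associativity removes the representatives from all later arguments.
-/
theorem Coassoc.apply {T : A ⊗[ℂ] A →ₗ[ℂ] Bal f g} {T' : A ⊗[ℂ] A →ₗ[ℂ] Bal f' g'}
    (hT : Coassoc T T') (Φ₁₂ : A → Bal f g →ₗ[ℂ] M) (Φ₂₃ : A → Bal f' g' →ₗ[ℂ] M)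
    (h : ∀ a b c, Φ₁₂ c (Bal.π f g (a ⊗ₜ b)) = Φ₂₃ a (Bal.π f' g' (b ⊗ₜ c))) (a b c : A)
    (G : Bal f g →ₗ[ℂ] M) (hG : ∀ p q, G (Bal.π f g (p ⊗ₜ q)) = Φ₂₃ p (T' (q ⊗ₜ c)))
    (H : Bal f' g' →ₗ[ℂ] M) (hH : ∀ p q, H (Bal.π f' g' (p ⊗ₜ q)) = Φ₁₂ q (T (a ⊗ₜ p))) :
    G (T (a ⊗ₜ b)) = H (T' (b ⊗ₜ c)) := by
  obtain ⟨Ψ, hΨ⟩ := Bal₃.exists_lift Φ₁₂ Φ₂₃ h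
  obtain ⟨w, hw⟩ := Bal.π_surjective f g (T (a ⊗ₜ b))
  obtain ⟨z, hz⟩ := Bal.π_surjective f' g' (T' (b ⊗ₜ c))
  have right : ∀ a v, Ψ (Bal₃.ofRight f g f' g' (a ⊗ₜ v)) = Φ₂₃ a v := fun a v =>
    Bal.congr (φ := Ψ ∘ₗ Bal₃.ofRight f g f' g' ∘ₗ TensorProduct.mk ℂ A _ a)
      (ψ := Φ₂₃ a) (fun b c => hΨ a b c) v
  have left : ∀ v c, Ψ (Bal₃.ofLeft f g f' g' (v ⊗ₜ c)) = Φ₁₂ c v := fun v c =>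
    Bal.congr (φ := Ψ ∘ₗ Bal₃.ofLeft f g f' g' ∘ₗ (TensorProduct.mk ℂ _ A).flip c)
      (ψ := Φ₁₂ c) (fun a b => (hΨ a b c).trans (h a b c).symm) v
  rw [← hw, ← hz]
  have hG' : G (Bal.π f g w) =
      Ψ (Bal₃.ofRight f g f' g' (T'.lTensor A (TensorProduct.assoc ℂ A A A (w ⊗ₜ c)))) :=
    LinearMap.congr_fun (f := G ∘ₗ Bal.π f g)
      (g := Ψ ∘ₗ Bal₃.ofRight f g f' g' ∘ₗ T'.lTensor A ∘ₗ
        (TensorProduct.assoc ℂ A A A).toLinearMap ∘ₗ (TensorProduct.mk ℂ _ A).flip c)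
      (TensorProduct.ext' fun p q => by
        change G (Bal.π f g (p ⊗ₜ q)) = Ψ (Bal₃.ofRight f g f' g' (p ⊗ₜ T' (q ⊗ₜ c)))
        rw [hG, right]) w
  have hH' : H (Bal.π f' g' z) =
      Ψ (Bal₃.ofLeft f g f' g' (T.rTensor A ((TensorProduct.assoc ℂ A A A).symm (a ⊗ₜ z)))) :=
    LinearMap.congr_fun (f := H ∘ₗ Bal.π f' g')
      (g := Ψ ∘ₗ Bal₃.ofLeft f g f' g' ∘ₗ T.rTensor A ∘ₗ
        (TensorProduct.assoc ℂ A A A).symm.toLinearMap ∘ₗ TensorProduct.mk ℂ A _ a)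
      (TensorProduct.ext' fun p q => by
        change H (Bal.π f' g' (p ⊗ₜ q)) = Ψ (Bal₃.ofLeft f g f' g' (T (a ⊗ₜ p) ⊗ₜ q))
        rw [hH, left]) z
  rw [hG', hH', hT a b c w z hw hz]

/-- Consequence of co-associativity `(ι ⊗ T') (T ⊗ ι) = (T ⊗ ι) (ι ⊗ T')` for surjective `T'`. -/
theorem Coassoc.apply_of_surjective {T : A ⊗[ℂ] A →ₗ[ℂ] Bal f g}
    {T' : A ⊗[ℂ] A →ₗ[ℂ] Bal f' g'} (hT : Coassoc T T') (hT' : Function.Surjective T')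
    (hfg : ∀ j i a, f' j (g i a) = g i (f' j a))
    (hf' : ∀ j a p, T (a ⊗ₜ f' j p) =
      Bal.endo (f := f) LinearMap.id (f' j) (fun _ _ => rfl) (hfg j) (T (a ⊗ₜ p)))
    (Φ₁₂ : A → Bal f g →ₗ[ℂ] M) (Φ₂₃ : A → Bal f' g' →ₗ[ℂ] M)
    (h : ∀ a b c, Φ₁₂ c (Bal.π f g (a ⊗ₜ b)) = Φ₂₃ a (Bal.π f' g' (b ⊗ₜ c)))
    (G : A → Bal f g →ₗ[ℂ] M)
    (hG : ∀ p q c, G c (Bal.π f g (p ⊗ₜ q)) = Φ₂₃ p (T' (q ⊗ₜ c)))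
    (K : A → Bal f' g' →ₗ[ℂ] M) (hK : ∀ a b c, G c (T (a ⊗ₜ b)) = K a (T' (b ⊗ₜ c)))
    (a p q : A) : Φ₁₂ q (T (a ⊗ₜ p)) = K a (Bal.π f' g' (p ⊗ₜ q)) := by
  -- Linearity and balancedness of `Φ₁₂` in its index are read off from `Φ₂₃`, for which that index
  -- is a tensor factor.
  have hadd : ∀ q q' w, Φ₁₂ (q + q') w = Φ₁₂ q w + Φ₁₂ q' w := fun q q' w =>
    Bal.congr (φ := Φ₁₂ (q + q')) (ψ := Φ₁₂ q + Φ₁₂ q') (fun r s => by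
      simp only [LinearMap.add_apply, h, TensorProduct.tmul_add, map_add]) w
  have hsmul : ∀ (r : ℂ) q w, Φ₁₂ (r • q) w = r • Φ₁₂ q w := fun r q w =>
    Bal.congr (φ := Φ₁₂ (r • q)) (ψ := r • Φ₁₂ q) (fun r s => by
      simp only [LinearMap.smul_apply, h, TensorProduct.tmul_smul, map_smul]) w
  have hbal : ∀ j q w, Φ₁₂ (g' j q) w =
      Φ₁₂ q (Bal.endo (f := f) LinearMap.id (f' j) (fun _ _ => rfl) (hfg j) w) := fun j q w =>
    Bal.congr (φ := Φ₁₂ (g' j q))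
      (ψ := Φ₁₂ q ∘ₗ Bal.endo (f := f) LinearMap.id (f' j) (fun _ _ => rfl) (hfg j)) (fun r s => by
      rw [LinearMap.comp_apply, Bal.endo_π, h, h, Bal.rel]; rfl) w
  -- With `a` fixed, `p ⊗ q ↦ Φ₁₂ q (T (a ⊗ p))` descends to the balanced tensor product because `T`
  -- intertwines the actions `f'`. Co-associativity shows that it agrees with `K a` on the range of
  -- `T'`, hence everywhere.
  let H : Bal f' g' →ₗ[ℂ] M := Bal.lift
    (TensorProduct.lift (LinearMap.mk₂ ℂ (fun p q => Φ₁₂ q (T (a ⊗ₜ p)))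
      (fun p p' q => by rw [TensorProduct.tmul_add, map_add, map_add])
      (fun r p q => by rw [TensorProduct.tmul_smul, map_smul, map_smul])
      (fun p q q' => hadd _ _ _) (fun r p q => hsmul _ _ _)))
    (fun j p q => by
      simp only [TensorProduct.lift.tmul, LinearMap.mk₂_apply]
      rw [hf', hbal])
  have hH : ∀ p q, H (Bal.π f' g' (p ⊗ₜ q)) = Φ₁₂ q (T (a ⊗ₜ p)) := fun p q => rfl
  rw [← hH]
  exact congr_of_surjective hT' (fun b c => by
    rw [← hT.apply Φ₁₂ Φ₂₃ h a b c (G c) (fun p q => hG p q c) H hH, hK]) _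

end Coassoc

/-! ### A self-dual form of multiplier bialgebroids and the module relations of the canonical maps
-/

section Symmetric

variable (A X Y : Type*) [NonUnitalRing A] [Module ℂ A] [NonUnitalRing X] [Module ℂ X]
  [NonUnitalRing Y] [Module ℂ Y]

/-- The base data of a multiplier bialgebroid in a form that is symmetric under passing to the
opposite algebra: `ml a b = mr b a` is the product of `a` and `b`; for `x ∈ X = B`, the maps `lB x`
and `lC x` are the left multiplications by `x` and `S_B(x)`; for `y ∈ Y = C`, the maps `rB y` and
`rC y` are the right multiplications by `S_C(y)` and `y`; finally, `pB = S_C⁻¹` and `pC = S_B`. -/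
structure SymmetricBase where
  ml : A →ₗ[ℂ] A →ₗ[ℂ] A
  mr : A →ₗ[ℂ] A →ₗ[ℂ] A
  mr_eq : ∀ a b, mr a b = ml b a
  ml_ml : ∀ a b c, ml (ml a b) c = ml a (ml b c)
  nondegenerate_right : ∀ a, (∀ b, ml a b = 0) → a = 0
  nondegenerate_left : ∀ a, (∀ b, mr a b = 0) → a = 0
  idempotent : Submodule.span ℂ {c : A | ∃ a b, c = ml a b} = ⊤
  lB : X →ₗ[ℂ] A →ₗ[ℂ] A
  lC : X →ₗ[ℂ] A →ₗ[ℂ] A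
  rB : Y →ₗ[ℂ] A →ₗ[ℂ] A
  rC : Y →ₗ[ℂ] A →ₗ[ℂ] A
  pB : X ≃ₗ[ℂ] Y
  pC : X ≃ₗ[ℂ] Y
  lB_injective : Function.Injective lB
  lC_injective : Function.Injective lC
  rB_injective : Function.Injective rB
  rC_injective : Function.Injective rC
  lB_mul : ∀ x x' a, lB (x * x') a = lB x (lB x' a)
  lC_mul : ∀ x x' a, lC (x * x') a = lC x' (lC x a)
  rB_mul : ∀ y y' a, rB (y * y') a = rB y (rB y' a)
  rC_mul : ∀ y y' a, rC (y * y') a = rC y' (rC y a)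
  pB_mul : ∀ x x', pB (x * x') = pB x' * pB x
  pC_mul : ∀ x x', pC (x * x') = pC x' * pC x
  lB_lC : ∀ x x' a, lB x (lC x' a) = lC x' (lB x a)
  rB_rC : ∀ y y' a, rB y (rC y' a) = rC y' (rB y a)
  lB_rB : ∀ x y a, lB x (rB y a) = rB y (lB x a)
  lB_rC : ∀ x y a, lB x (rC y a) = rC y (lB x a)
  lC_rB : ∀ x y a, lC x (rB y a) = rB y (lC x a)
  lC_rC : ∀ x y a, lC x (rC y a) = rC y (lC x a)
  lB_ml : ∀ x a b, lB x (ml a b) = ml (lB x a) b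
  lC_ml : ∀ x a b, lC x (ml a b) = ml (lC x a) b
  rB_mr : ∀ y a b, rB y (mr a b) = mr (rB y a) b
  rC_mr : ∀ y a b, rC y (mr a b) = mr (rC y a) b
  ml_lB : ∀ x a b, ml a (lB x b) = ml (rB (pB x) a) b
  ml_lC : ∀ x a b, ml a (lC x b) = ml (rC (pC x) a) b

namespace SymmetricBase

variable {A X Y}

/-- The base data of the opposite multiplier bialgebroid. -/
@[reducible] def op (D : SymmetricBase A X Y) : SymmetricBase A Y X where
  ml := D.mr
  mr := D.ml
  mr_eq a b := (D.mr_eq b a).symm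
  ml_ml a b c := by simp only [D.mr_eq, D.ml_ml]
  nondegenerate_right := D.nondegenerate_left
  nondegenerate_left := D.nondegenerate_right
  idempotent := by
    rw [← D.idempotent]
    congr 1
    ext c
    constructor
    · rintro ⟨a, b, rfl⟩; exact ⟨b, a, D.mr_eq a b⟩
    · rintro ⟨a, b, rfl⟩; exact ⟨b, a, (D.mr_eq b a).symm⟩
  lB := D.rB
  lC := D.rC
  rB := D.lB
  rC := D.lC
  pB := D.pB.symm
  pC := D.pC.symm
  lB_injective := D.rB_injective
  lC_injective := D.rC_injective
  rB_injective := D.lB_injective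
  rC_injective := D.lC_injective
  lB_mul := D.rB_mul
  lC_mul := D.rC_mul
  rB_mul := D.lB_mul
  rC_mul := D.lC_mul
  pB_mul y y' := by rw [LinearEquiv.symm_apply_eq, D.pB_mul]; simp
  pC_mul y y' := by rw [LinearEquiv.symm_apply_eq, D.pC_mul]; simp
  lB_lC := D.rB_rC
  rB_rC := D.lB_lC
  lB_rB x y a := (D.lB_rB y x a).symm
  lB_rC x y a := (D.lC_rB y x a).symm
  lC_rB x y a := (D.lB_rC y x a).symm
  lC_rC x y a := (D.lC_rC y x a).symm
  lB_ml := D.rB_mr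
  lC_ml := D.rC_mr
  rB_mr := D.lB_ml
  rC_mr := D.lC_ml
  ml_lB y a b := by rw [D.mr_eq, D.mr_eq, D.ml_lB, LinearEquiv.apply_symm_apply]
  ml_lC y a b := by rw [D.mr_eq, D.mr_eq, D.ml_lC, LinearEquiv.apply_symm_apply]

variable (D : SymmetricBase A X Y)

theorem eq_of_ml {a a' : A} (h : ∀ b, D.ml a b = D.ml a' b) : a = a' :=
  sub_eq_zero.1 (D.nondegenerate_right _ fun b => by
    rw [map_sub, LinearMap.sub_apply, h, sub_self])

theorem eq_of_mr {a a' : A} (h : ∀ b, D.ml b a = D.ml b a') : a = a' :=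
  sub_eq_zero.1 (D.nondegenerate_left _ fun b => by
    rw [D.mr_eq, map_sub, h, sub_self])

theorem ml_rB (y : Y) (a b : A) : D.ml (D.rB y a) b = D.ml a (D.lB (D.pB.symm y) b) := by
  rw [D.ml_lB, LinearEquiv.apply_symm_apply]

theorem ml_rC (y : Y) (a b : A) : D.ml (D.rC y a) b = D.ml a (D.lC (D.pC.symm y) b) := by
  rw [D.ml_lC, LinearEquiv.apply_symm_apply]

/-- The space `_B A ⊗ A^B`. -/
abbrev L : Type _ := Bal D.lB D.lC

/-- The space `^C A ⊗ A_C`. -/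
abbrev R : Type _ := Bal D.rB D.rC

/-- The quotient map `A ⊗ A → _B A ⊗ A^B` as a bilinear map. -/
def mkL : A →ₗ[ℂ] A →ₗ[ℂ] D.L := (TensorProduct.mk ℂ A A).compr₂ (Bal.π D.lB D.lC)

/-- The quotient map `A ⊗ A → ^C A ⊗ A_C` as a bilinear map. -/
def mkR : A →ₗ[ℂ] A →ₗ[ℂ] D.R := (TensorProduct.mk ℂ A A).compr₂ (Bal.π D.rB D.rC)

theorem mkL_lB (x : X) (a b : A) : D.mkL (D.lB x a) b = D.mkL a (D.lC x b) := Bal.rel _ _ x a b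

theorem mkR_rB (y : Y) (a b : A) : D.mkR (D.rB y a) b = D.mkR a (D.rC y b) := Bal.rel _ _ y a b

variable {M : Type*} [AddCommGroup M] [Module ℂ M]

theorem congrL {φ ψ : D.L →ₗ[ℂ] M} (h : ∀ a b, φ (D.mkL a b) = ψ (D.mkL a b)) (w : D.L) :
    φ w = ψ w := Bal.congr h w

theorem congrR {φ ψ : D.R →ₗ[ℂ] M} (h : ∀ a b, φ (D.mkR a b) = ψ (D.mkR a b)) (w : D.R) :
    φ w = ψ w := Bal.congr h w

/-- The map `φ ⊗ ι` on `_B A ⊗ A^B`. -/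
def L₁ (φ : A →ₗ[ℂ] A) (h : ∀ x a, φ (D.lB x a) = D.lB x (φ a)) : D.L →ₗ[ℂ] D.L :=
  Bal.endo (g := D.lC) φ LinearMap.id h (fun _ _ => rfl)

/-- The map `ι ⊗ φ` on `_B A ⊗ A^B`. -/
def L₂ (φ : A →ₗ[ℂ] A) (h : ∀ x a, φ (D.lC x a) = D.lC x (φ a)) : D.L →ₗ[ℂ] D.L :=
  Bal.endo (f := D.lB) LinearMap.id φ (fun _ _ => rfl) h

/-- The map `φ ⊗ ι` on `^C A ⊗ A_C`. -/
def R₁ (φ : A →ₗ[ℂ] A) (h : ∀ y a, φ (D.rB y a) = D.rB y (φ a)) : D.R →ₗ[ℂ] D.R :=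
  Bal.endo (g := D.rC) φ LinearMap.id h (fun _ _ => rfl)

/-- The map `ι ⊗ φ` on `^C A ⊗ A_C`. -/
def R₂ (φ : A →ₗ[ℂ] A) (h : ∀ y a, φ (D.rC y a) = D.rC y (φ a)) : D.R →ₗ[ℂ] D.R :=
  Bal.endo (f := D.rB) LinearMap.id φ (fun _ _ => rfl) h

theorem L₁_mkL (φ : A →ₗ[ℂ] A) (h) (a b : A) : D.L₁ φ h (D.mkL a b) = D.mkL (φ a) b := rfl

theorem L₂_mkL (φ : A →ₗ[ℂ] A) (h) (a b : A) : D.L₂ φ h (D.mkL a b) = D.mkL a (φ b) := rfl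

theorem mr_lB (a : A) (x : X) (b : A) : D.mr a (D.lB x b) = D.lB x (D.mr a b) := by
  rw [D.mr_eq, D.mr_eq, D.lB_ml]

theorem mr_lC (a : A) (x : X) (b : A) : D.mr a (D.lC x b) = D.lC x (D.mr a b) := by
  rw [D.mr_eq, D.mr_eq, D.lC_ml]

theorem ml_rB_comm (a : A) (y : Y) (b : A) : D.ml a (D.rB y b) = D.rB y (D.ml a b) :=
  D.op.mr_lB a y b

theorem ml_rC_comm (a : A) (y : Y) (b : A) : D.ml a (D.rC y b) = D.rC y (D.ml a b) :=
  D.op.mr_lC a y b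

/-- The map `w ↦ w (a ⊗ 1)` on `_B A ⊗ A^B`. -/
def mrL₁ (a : A) : D.L →ₗ[ℂ] D.L := D.L₁ (D.mr a) (D.mr_lB a)

/-- The map `w ↦ w (1 ⊗ a)` on `_B A ⊗ A^B`. -/
def mrL₂ (a : A) : D.L →ₗ[ℂ] D.L := D.L₂ (D.mr a) (D.mr_lC a)

/-- The map `w ↦ (a ⊗ 1) w` on `^C A ⊗ A_C`. -/
def mlR₁ (a : A) : D.R →ₗ[ℂ] D.R := D.R₁ (D.ml a) (D.ml_rB_comm a)

/-- The map `w ↦ (1 ⊗ a) w` on `^C A ⊗ A_C`. -/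
def mlR₂ (a : A) : D.R →ₗ[ℂ] D.R := D.R₂ (D.ml a) (D.ml_rC_comm a)

theorem mrL₁_mkL (a b c : A) : D.mrL₁ a (D.mkL b c) = D.mkL (D.ml b a) c := by
  rw [← D.mr_eq]; rfl

theorem mrL₂_mkL (a b c : A) : D.mrL₂ a (D.mkL b c) = D.mkL b (D.ml c a) := by
  rw [← D.mr_eq]; rfl

theorem mlR₁_mkR (a b c : A) : D.mlR₁ a (D.mkR b c) = D.mkR (D.ml a b) c := rfl

theorem mlR₂_mkR (a b c : A) : D.mlR₂ a (D.mkR b c) = D.mkR b (D.ml a c) := rfl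

theorem L₁_L₂ (φ ψ : A →ₗ[ℂ] A) (h k) (w : D.L) :
    D.L₁ φ h (D.L₂ ψ k w) = D.L₂ ψ k (D.L₁ φ h w) :=
  D.congrL (φ := D.L₁ φ h ∘ₗ D.L₂ ψ k) (ψ := D.L₂ ψ k ∘ₗ D.L₁ φ h) (fun _ _ => rfl) w

end SymmetricBase

/-- A multiplier bialgebroid in a form that is symmetric under passing to the opposite algebra. -/
structure SymmetricBialgebroid extends SymmetricBase A X Y where
  Tl : A ⊗[ℂ] A →ₗ[ℂ] toSymmetricBase.L
  Tr : A ⊗[ℂ] A →ₗ[ℂ] toSymmetricBase.L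
  lT : A ⊗[ℂ] A →ₗ[ℂ] toSymmetricBase.R
  rT : A ⊗[ℂ] A →ₗ[ℂ] toSymmetricBase.R
  ΔL : A → toSymmetricBase.L →ₗ[ℂ] toSymmetricBase.L
  ΔR : A → toSymmetricBase.R →ₗ[ℂ] toSymmetricBase.R
  ΔL_ml : ∀ a b w, ΔL (ml a b) w = ΔL a (ΔL b w)
  ΔR_mr : ∀ a b w, ΔR (mr a b) w = ΔR a (ΔR b w)
  mrL₂_Tl : ∀ a b c, toSymmetricBase.mrL₂ c (Tl (a ⊗ₜ b)) = ΔL b (toSymmetricBase.mkL a c)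
  mrL₁_Tr : ∀ a b c, toSymmetricBase.mrL₁ a (Tr (b ⊗ₜ c)) = ΔL b (toSymmetricBase.mkL a c)
  mlR₂_lT : ∀ a b c, toSymmetricBase.mlR₂ c (lT (a ⊗ₜ b)) = ΔR b (toSymmetricBase.mkR a c)
  mlR₁_rT : ∀ a b c, toSymmetricBase.mlR₁ a (rT (b ⊗ₜ c)) = ΔR b (toSymmetricBase.mkR a c)
  nondegenerate_L₁ : ∀ w, (∀ a, toSymmetricBase.mrL₁ a w = 0) → w = 0
  nondegenerate_L₂ : ∀ w, (∀ a, toSymmetricBase.mrL₂ a w = 0) → w = 0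
  nondegenerate_R₁ : ∀ w, (∀ a, toSymmetricBase.mlR₁ a w = 0) → w = 0
  nondegenerate_R₂ : ∀ w, (∀ a, toSymmetricBase.mlR₂ a w = 0) → w = 0
  ΔL_lB : ∀ x b w, ΔL (lB x b) w = toSymmetricBase.L₂ (lB x) (lB_lC x) (ΔL b w)
  ΔL_lC : ∀ x b w, ΔL (lC x b) w =
    toSymmetricBase.L₁ (lC x) (fun x' a => (lB_lC x' x a).symm) (ΔL b w)
  ΔL_rB : ∀ y a b c, ΔL (rB y b) (toSymmetricBase.mkL a c) =
    ΔL b (toSymmetricBase.mkL a (lB (pB.symm y) c))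
  ΔL_rC : ∀ y a b c, ΔL (rC y b) (toSymmetricBase.mkL a c) =
    ΔL b (toSymmetricBase.mkL (lC (pC.symm y) a) c)
  ΔR_rB : ∀ y b w, ΔR (rB y b) w = toSymmetricBase.R₂ (rB y) (rB_rC y) (ΔR b w)
  ΔR_rC : ∀ y b w, ΔR (rC y b) w =
    toSymmetricBase.R₁ (rC y) (fun y' a => (rB_rC y' y a).symm) (ΔR b w)
  ΔR_lB : ∀ x a b c, ΔR (lB x b) (toSymmetricBase.mkR a c) =
    ΔR b (toSymmetricBase.mkR a (rB (pB x) c))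
  ΔR_lC : ∀ x a b c, ΔR (lC x b) (toSymmetricBase.mkR a c) =
    ΔR b (toSymmetricBase.mkR (rC (pC x) a) c)
  coassoc_left : Coassoc Tl Tr
  coassoc_right : Coassoc lT rT
  coassoc_mixed₁ : Coassoc Tl rT
  coassoc_mixed₂ : Coassoc lT Tr

namespace SymmetricBialgebroid

variable {A X Y}

/-- The opposite multiplier bialgebroid. -/
@[reducible] def op (D : SymmetricBialgebroid A X Y) : SymmetricBialgebroid A Y X where
  toSymmetricBase := D.toSymmetricBase.op
  Tl := D.lT
  Tr := D.rT
  lT := D.Tl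
  rT := D.Tr
  ΔL := D.ΔR
  ΔR := D.ΔL
  ΔL_ml := D.ΔR_mr
  ΔR_mr := D.ΔL_ml
  mrL₂_Tl := D.mlR₂_lT
  mrL₁_Tr := D.mlR₁_rT
  mlR₂_lT := D.mrL₂_Tl
  mlR₁_rT := D.mrL₁_Tr
  nondegenerate_L₁ := D.nondegenerate_R₁
  nondegenerate_L₂ := D.nondegenerate_R₂
  nondegenerate_R₁ := D.nondegenerate_L₁
  nondegenerate_R₂ := D.nondegenerate_L₂
  ΔL_lB := D.ΔR_rB
  ΔL_lC := D.ΔR_rC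
  ΔL_rB := D.ΔR_lB
  ΔL_rC := D.ΔR_lC
  ΔR_rB := D.ΔL_lB
  ΔR_rC := D.ΔL_lC
  ΔR_lB := D.ΔL_rB
  ΔR_lC := D.ΔL_rC
  coassoc_left := D.coassoc_right
  coassoc_right := D.coassoc_left
  coassoc_mixed₁ := D.coassoc_mixed₂
  coassoc_mixed₂ := D.coassoc_mixed₁

variable (D : SymmetricBialgebroid A X Y)

theorem eq_of_mrL₁ {w w' : D.L} (h : ∀ a, D.mrL₁ a w = D.mrL₁ a w') : w = w' :=
  sub_eq_zero.1 (D.nondegenerate_L₁ _ fun a => by rw [map_sub, h, sub_self])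

theorem eq_of_mrL₂ {w w' : D.L} (h : ∀ a, D.mrL₂ a w = D.mrL₂ a w') : w = w' :=
  sub_eq_zero.1 (D.nondegenerate_L₂ _ fun a => by rw [map_sub, h, sub_self])

theorem mrL₂_Tl_eq (a b c : A) : D.mrL₂ c (D.Tl (a ⊗ₜ b)) = D.mrL₁ a (D.Tr (b ⊗ₜ c)) := by
  rw [D.mrL₂_Tl, D.mrL₁_Tr]

theorem mlR₂_lT_eq (a b c : A) : D.mlR₂ c (D.lT (a ⊗ₜ b)) = D.mlR₁ a (D.rT (b ⊗ₜ c)) :=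
  D.op.mrL₂_Tl_eq a b c

/-- This and the next six relations are tested after multiplying by `1 ⊗ c` for `T_λ`, or by `c ⊗ 1`
for `T_ρ`. Non-degeneracy makes this harmless, and it turns the canonical map into `Δ_B` applied to
an elementary tensor, where the bimodule properties of `Δ_B` or the balancing relation apply. -/
theorem Tl_lB (x : X) (a b : A) :
    D.Tl (a ⊗ₜ D.lB x b) = D.L₂ (D.lB x) (D.lB_lC x) (D.Tl (a ⊗ₜ b)) :=
  D.eq_of_mrL₂ fun c => by
    rw [D.mrL₂_Tl, D.ΔL_lB, ← D.mrL₂_Tl]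
    exact D.congrL (φ := D.L₂ (D.lB x) (D.lB_lC x) ∘ₗ D.mrL₂ c)
      (ψ := D.mrL₂ c ∘ₗ D.L₂ (D.lB x) (D.lB_lC x))
      (fun r s => by simp only [LinearMap.comp_apply, D.mrL₂_mkL, D.L₂_mkL, D.lB_ml]) _

theorem Tl_lC (x : X) (a b : A) : D.Tl (a ⊗ₜ D.lC x b) =
    D.L₁ (D.lC x) (fun x' a => (D.lB_lC x' x a).symm) (D.Tl (a ⊗ₜ b)) :=
  D.eq_of_mrL₂ fun c => by
    rw [D.mrL₂_Tl, D.ΔL_lC, ← D.mrL₂_Tl]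
    exact D.L₁_L₂ _ _ _ _ _

theorem Tl_rB (y : Y) (a b : A) : D.Tl (a ⊗ₜ D.rB y b) =
    D.L₂ (D.rB y) (fun x a => (D.lC_rB x y a).symm) (D.Tl (a ⊗ₜ b)) :=
  D.eq_of_mrL₂ fun c => by
    rw [D.mrL₂_Tl, D.ΔL_rB, ← D.mrL₂_Tl]
    exact D.congrL (φ := D.mrL₂ (D.lB (D.pB.symm y) c)) (ψ := D.mrL₂ c ∘ₗ D.L₂ (D.rB y) _)
      (fun r s => by simp only [LinearMap.comp_apply, D.mrL₂_mkL, D.L₂_mkL, D.ml_rB]) _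

theorem Tl_lB_left (x : X) (a b : A) : D.Tl (D.lB x a ⊗ₜ b) =
    D.L₂ (D.rC (D.pC x)) (fun x' a => (D.lC_rC x' _ a).symm) (D.Tl (a ⊗ₜ b)) :=
  D.eq_of_mrL₂ fun c => by
    -- Here `Δ_B` plays no role: `x a ⊗ c = a ⊗ S_B(x) c` moves the factor onto `c`, and from there
    -- it becomes right multiplication by `S_B(x)` on the second leg.
    rw [D.mrL₂_Tl, D.mkL_lB, ← D.mrL₂_Tl]
    exact D.congrL (φ := D.mrL₂ (D.lC x c)) (ψ := D.mrL₂ c ∘ₗ D.L₂ (D.rC (D.pC x)) _)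
      (fun r s => by simp only [LinearMap.comp_apply, D.mrL₂_mkL, D.L₂_mkL, D.ml_lC]) _

theorem Tr_lC (x : X) (a b : A) : D.Tr (D.lC x a ⊗ₜ b) =
    D.L₁ (D.lC x) (fun x' a => (D.lB_lC x' x a).symm) (D.Tr (a ⊗ₜ b)) :=
  D.eq_of_mrL₁ fun c => by
    rw [D.mrL₁_Tr, D.ΔL_lC, ← D.mrL₁_Tr]
    exact D.congrL (φ := D.L₁ (D.lC x) (fun x' a => (D.lB_lC x' x a).symm) ∘ₗ D.mrL₁ c)
      (ψ := D.mrL₁ c ∘ₗ D.L₁ (D.lC x) (fun x' a => (D.lB_lC x' x a).symm))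
      (fun r s => by simp only [LinearMap.comp_apply, D.mrL₁_mkL, D.L₁_mkL, D.lC_ml]) _

theorem Tr_rC (y : Y) (a b : A) : D.Tr (D.rC y a ⊗ₜ b) =
    D.L₁ (D.rC y) (fun x a => (D.lB_rC x y a).symm) (D.Tr (a ⊗ₜ b)) :=
  D.eq_of_mrL₁ fun c => by
    rw [D.mrL₁_Tr, D.ΔL_rC, ← D.mrL₁_Tr]
    exact D.congrL (φ := D.mrL₁ (D.lC (D.pC.symm y) c)) (ψ := D.mrL₁ c ∘ₗ D.L₁ (D.rC y) _)
      (fun r s => by simp only [LinearMap.comp_apply, D.mrL₁_mkL, D.L₁_mkL, D.ml_rC]) _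

theorem Tr_lC_right (x : X) (a b : A) : D.Tr (a ⊗ₜ D.lC x b) =
    D.L₁ (D.rB (D.pB x)) (fun x' a => (D.lB_rB x' _ a).symm) (D.Tr (a ⊗ₜ b)) :=
  D.eq_of_mrL₁ fun c => by
    rw [D.mrL₁_Tr, ← D.mkL_lB, ← D.mrL₁_Tr]
    exact D.congrL (φ := D.mrL₁ (D.lB x c)) (ψ := D.mrL₁ c ∘ₗ D.L₁ (D.rB (D.pB x)) _)
      (fun r s => by simp only [LinearMap.comp_apply, D.mrL₁_mkL, D.L₁_mkL, D.ml_lB]) _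

theorem mrL₁_ml (a b : A) (w : D.L) : D.mrL₁ (D.ml a b) w = D.mrL₁ b (D.mrL₁ a w) :=
  D.congrL (φ := D.mrL₁ (D.ml a b)) (ψ := D.mrL₁ b ∘ₗ D.mrL₁ a)
    (fun r s => by simp only [LinearMap.comp_apply, D.mrL₁_mkL, D.ml_ml]) w

theorem mrL₂_ml (a b : A) (w : D.L) : D.mrL₂ (D.ml a b) w = D.mrL₂ b (D.mrL₂ a w) :=
  D.congrL (φ := D.mrL₂ (D.ml a b)) (ψ := D.mrL₂ b ∘ₗ D.mrL₂ a)
    (fun r s => by simp only [LinearMap.comp_apply, D.mrL₂_mkL, D.ml_ml]) w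

/-- `Δ_B(v)` is a left multiplier: on elementary tensors, `Δ_B(v)(r ⊗ s) = (Δ_B(v)(1 ⊗ s))(r ⊗ 1)`,
and this form visibly commutes with right multiplication on the first leg. -/
theorem ΔL_mrL₁ (v a : A) (w : D.L) : D.ΔL v (D.mrL₁ a w) = D.mrL₁ a (D.ΔL v w) :=
  D.congrL (φ := D.ΔL v ∘ₗ D.mrL₁ a) (ψ := D.mrL₁ a ∘ₗ D.ΔL v)
    (fun r s => by
      simp only [LinearMap.comp_apply, D.mrL₁_mkL, ← D.mrL₁_Tr, D.mrL₁_ml]) w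

theorem ΔL_mrL₂ (v a : A) (w : D.L) : D.ΔL v (D.mrL₂ a w) = D.mrL₂ a (D.ΔL v w) :=
  D.congrL (φ := D.ΔL v ∘ₗ D.mrL₂ a) (ψ := D.mrL₂ a ∘ₗ D.ΔL v)
    (fun r s => by
      simp only [LinearMap.comp_apply, D.mrL₂_mkL, ← D.mrL₂_Tl, D.mrL₂_ml]) w

theorem Tr_ml (v a b : A) : D.Tr (D.ml v a ⊗ₜ b) = D.ΔL v (D.Tr (a ⊗ₜ b)) :=
  D.eq_of_mrL₁ fun c => by rw [D.mrL₁_Tr, D.ΔL_ml, ← D.mrL₁_Tr, D.ΔL_mrL₁]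

theorem Tl_ml (v a b : A) : D.Tl (a ⊗ₜ D.ml v b) = D.ΔL v (D.Tl (a ⊗ₜ b)) :=
  D.eq_of_mrL₂ fun c => by rw [D.mrL₂_Tl, D.ΔL_ml, ← D.mrL₂_Tl, D.ΔL_mrL₂]

theorem Tr_ml_right (a b c : A) : D.Tr (a ⊗ₜ D.ml b c) = D.mrL₂ c (D.Tr (a ⊗ₜ b)) :=
  D.eq_of_mrL₁ fun d => by
    rw [D.mrL₁_Tr, ← D.mrL₂_mkL, D.ΔL_mrL₂, ← D.mrL₁_Tr]
    exact (D.L₁_L₂ _ _ _ _ _).symm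

end SymmetricBialgebroid

end Symmetric

/-! ### Slice maps, regularity, and existence and uniqueness of counits -/

section Antipode

variable {A X Y : Type*} [NonUnitalRing A] [Module ℂ A] [NonUnitalRing X] [Module ℂ X]
  [NonUnitalRing Y] [Module ℂ Y]

/-- A linear map `θ` that takes values in the range of an injective linear map `j` on a spanning set
factors through `j`. -/
theorem exists_factor {V W N : Type*} [AddCommGroup V] [Module ℂ V] [AddCommGroup W] [Module ℂ W]
    [AddCommGroup N] [Module ℂ N] (θ : V →ₗ[ℂ] N) (j : W →ₗ[ℂ] N) (hj : Function.Injective j)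
    {s : Set V} (hs : Submodule.span ℂ s = ⊤) (h : ∀ v ∈ s, ∃ w, θ v = j w) :
    ∃ ε : V →ₗ[ℂ] W, ∀ v, θ v = j (ε v) := by
  have hle : ∀ v, θ v ∈ LinearMap.range j := by
    have : Submodule.span ℂ s ≤ (LinearMap.range j).comap θ := Submodule.span_le.2 fun v hv => by
      obtain ⟨w, hw⟩ := h v hv
      exact ⟨w, hw.symm⟩
    exact fun v => this (hs ▸ Submodule.mem_top)
  refine ⟨(LinearEquiv.ofInjective j hj).symm.toLinearMap ∘ₗ θ.codRestrict _ hle, fun v => ?_⟩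
  have := congrArg Subtype.val
    ((LinearEquiv.ofInjective j hj).apply_symm_apply (θ.codRestrict _ hle v))
  exact this.symm

namespace SymmetricBialgebroid

variable (D : SymmetricBialgebroid A X Y)

/-- `ω ∈ Hom(_B A, _B B)`. -/
def HomLeft (ω : A →ₗ[ℂ] X) : Prop := ∀ x a, ω (D.lB x a) = x * ω a

/-- `ω ∈ Hom(A^B, B_B)`. -/
def HomRight (ω : A →ₗ[ℂ] X) : Prop := ∀ x a, ω (D.lC x a) = ω a * x

/-- The slice map `a ⊗ b ↦ S_B(ω(a)) b`. -/
def slice₁ (ω : A →ₗ[ℂ] X) (h : D.HomLeft ω) : D.L →ₗ[ℂ] A :=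
  Bal.lift (TensorProduct.lift (D.lC ∘ₗ ω)) fun x a b => by
    simp only [TensorProduct.lift.tmul, LinearMap.comp_apply]
    rw [h, D.lC_mul]

/-- The slice map `a ⊗ b ↦ ω(b) a`. -/
def slice₂ (ω : A →ₗ[ℂ] X) (h : D.HomRight ω) : D.L →ₗ[ℂ] A :=
  Bal.lift (TensorProduct.lift (D.lB ∘ₗ ω).flip) fun x a b => by
    simp only [TensorProduct.lift.tmul, LinearMap.comp_apply, LinearMap.flip_apply]
    rw [h, D.lB_mul]

theorem slice₁_mkL (ω : A →ₗ[ℂ] X) (h : D.HomLeft ω) (a b : A) :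
    D.slice₁ ω h (D.mkL a b) = D.lC (ω a) b := rfl

theorem slice₂_mkL (ω : A →ₗ[ℂ] X) (h : D.HomRight ω) (a b : A) :
    D.slice₂ ω h (D.mkL a b) = D.lB (ω b) a := rfl

/-- Left counits; the right counits are the left counits of the opposite. -/
structure IsCounit (ε : A →ₗ[ℂ] X) : Prop where
  hom_left : D.HomLeft ε
  hom_right : D.HomRight ε
  slice_Tr : ∀ a b, D.slice₁ ε hom_left (D.Tr (a ⊗ₜ b)) = D.ml a b
  slice_Tl : ∀ a b, D.slice₂ ε hom_right (D.Tl (a ⊗ₜ b)) = D.ml b a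

/-- The conditions on a regular multiplier Hopf algebroid: surjectivity of the canonical maps,
their injectivity on the balanced tensor products, in the form of a lifting property, and the
fullness conditions. -/
structure Regular : Prop where
  Tl_surjective : Function.Surjective D.Tl
  Tr_surjective : Function.Surjective D.Tr
  lT_surjective : Function.Surjective D.lT
  rT_surjective : Function.Surjective D.rT
  Tl_lift : ∀ Φ : A →ₗ[ℂ] A →ₗ[ℂ] A, (∀ x a b, Φ (D.lC x a) b = Φ a (D.rC (D.pC x) b)) →
    ∃ φ : D.L →ₗ[ℂ] A, ∀ a b, φ (D.Tl (a ⊗ₜ b)) = Φ a b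
  Tr_lift : ∀ Φ : A →ₗ[ℂ] A →ₗ[ℂ] A, (∀ x a b, Φ (D.rB (D.pB x) a) b = Φ a (D.lB x b)) →
    ∃ φ : D.L →ₗ[ℂ] A, ∀ a b, φ (D.Tr (a ⊗ₜ b)) = Φ a b
  lT_lift : ∀ Φ : A →ₗ[ℂ] A →ₗ[ℂ] A, (∀ x a b, Φ (D.rC (D.pC x) a) b = Φ a (D.lC x b)) →
    ∃ φ : D.R →ₗ[ℂ] A, ∀ a b, φ (D.lT (a ⊗ₜ b)) = Φ a b
  rT_lift : ∀ Φ : A →ₗ[ℂ] A →ₗ[ℂ] A, (∀ x a b, Φ (D.lB x a) b = Φ a (D.rB (D.pB x) b)) →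
    ∃ φ : D.R →ₗ[ℂ] A, ∀ a b, φ (D.rT (a ⊗ₜ b)) = Φ a b
  full_L₁ : Submodule.span ℂ {c | ∃ ω a b, D.HomLeft ω ∧ c = D.lC (ω a) b} = ⊤
  full_L₂ : Submodule.span ℂ {c | ∃ ω a b, D.HomRight ω ∧ c = D.lB (ω a) b} = ⊤
  full_R₁ : Submodule.span ℂ {c | ∃ ω a b, D.op.HomLeft ω ∧ c = D.rC (ω a) b} = ⊤
  full_R₂ : Submodule.span ℂ {c | ∃ ω a b, D.op.HomRight ω ∧ c = D.rB (ω a) b} = ⊤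

variable {D}

theorem Regular.op (h : D.Regular) : D.op.Regular where
  Tl_surjective := h.lT_surjective
  Tr_surjective := h.rT_surjective
  lT_surjective := h.Tl_surjective
  rT_surjective := h.Tr_surjective
  Tl_lift Φ hΦ := h.lT_lift Φ fun x a b => by
    rw [hΦ]; exact congrArg (fun z => Φ a (D.lC z b)) (D.pC.symm_apply_apply x)
  Tr_lift Φ hΦ := h.rT_lift Φ fun x a b => by
    rw [← hΦ]; exact congrArg (fun z => Φ (D.lB z a) b) (D.pB.symm_apply_apply x).symm
  lT_lift Φ hΦ := h.Tl_lift Φ fun x a b => by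
    rw [← hΦ]; exact congrArg (fun z => Φ (D.lC z a) b) (D.pC.symm_apply_apply x).symm
  rT_lift Φ hΦ := h.Tr_lift Φ fun x a b => by
    rw [hΦ]; exact congrArg (fun z => Φ a (D.lB z b)) (D.pB.symm_apply_apply x)
  full_L₁ := h.full_R₁
  full_L₂ := h.full_R₂
  full_R₁ := h.full_L₁
  full_R₂ := h.full_L₂

/-- The counit identity prescribes `ε ⊗ ι` on the range of `T_ρ`, which is everything, and the
faithful action of `S_B(ε(a))` recovers `ε(a)`. -/
theorem IsCounit.unique {ε η : A →ₗ[ℂ] X} (hε : D.IsCounit ε) (hη : D.IsCounit η)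
    (hTr : Function.Surjective D.Tr) : ε = η := by
  refine LinearMap.ext fun a => D.lC_injective (LinearMap.ext fun b => ?_)
  exact congr_of_surjective hTr (φ := D.slice₁ ε hε.hom_left) (ψ := D.slice₁ η hη.hom_left)
    (fun a b => by rw [hε.slice_Tr, hη.slice_Tr]) (D.mkL a b)

/-- The candidates for `ε ⊗ ι` and `ι ⊗ ε` are the multiplication maps transported along `T_ρ` and
`T_λ`. Fullness is what shows that they are slices of a map with values in `B`. -/
theorem Regular.exists_counit (h : D.Regular) : ∃ ε : A →ₗ[ℂ] X, D.IsCounit ε := by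
  obtain ⟨E, hE⟩ := h.Tr_lift D.ml fun x a b => (D.ml_lB x a b).symm
  obtain ⟨F, hF⟩ := h.Tl_lift D.mr fun x a b => by rw [D.mr_eq, D.mr_eq, D.ml_lC]
  have hElC : ∀ x a b, E (D.mkL (D.lC x a) b) = D.lC x (E (D.mkL a b)) := fun x a b =>
    congr_of_surjective h.Tr_surjective
      (φ := E ∘ₗ D.L₁ (D.lC x) (fun x' a => (D.lB_lC x' x a).symm)) (ψ := D.lC x ∘ₗ E)
      (fun a b => by rw [LinearMap.comp_apply, LinearMap.comp_apply, ← D.Tr_lC, hE, hE, D.lC_ml])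
      (D.mkL a b)
  have hFlB : ∀ x a b, F (D.mkL a (D.lB x b)) = D.lB x (F (D.mkL a b)) := fun x a b =>
    congr_of_surjective h.Tl_surjective
      (φ := F ∘ₗ D.L₂ (D.lB x) (D.lB_lC x)) (ψ := D.lB x ∘ₗ F)
      (fun a b => by rw [LinearMap.comp_apply, LinearMap.comp_apply, ← D.Tl_lB, hF, hF, D.mr_lB])
      (D.mkL a b)
  -- This is `ι ⊗ E = F ⊗ ι`. For `r ⊗ s` replaced by `T_λ(a ⊗ p)`, both sides become `p a ⊗ q`: the
  -- right one by the choice of `F`, the left one by co-associativity, since `E T_ρ` is the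
  -- multiplication.
  have star : ∀ r s q, D.mkL r (E (D.mkL s q)) = D.mkL (F (D.mkL r s)) q := fun r s q =>
    congr_of_surjective h.Tl_surjective
      (φ := D.L₂ (E ∘ₗ D.mkL.flip q) (fun x a => hElC x a q)) (ψ := D.mkL.flip q ∘ₗ F)
      (fun a p => by
        rw [LinearMap.comp_apply, LinearMap.flip_apply, hF, D.mr_eq, ← D.mrL₁_mkL]
        exact D.coassoc_left.apply_of_surjective h.Tr_surjective D.lB_lC D.Tl_lB
          (fun c => D.L₂ (E ∘ₗ D.mkL.flip c) (fun x a => hElC x a c)) (fun a => D.mkL a ∘ₗ E)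
          (fun _ _ _ => rfl) D.mrL₂
          (fun p q c => by rw [LinearMap.comp_apply, hE]; exact D.mrL₂_mkL c p q)
          D.mrL₁ D.mrL₂_Tl_eq a p q) (D.mkL r s)
  -- On the spanning elements `S_B(ω(r)) s`, applying `ω ⊗ ι` to `star` gives `E(S_B(ω(r)) s ⊗ q) =
  -- S_B(ω(F(r ⊗ s))) q`, so that `E` acts there through an element of `B`.
  obtain ⟨ε, hε⟩ := exists_factor (D.mkL.compr₂ E) D.lC D.lC_injective h.full_L₁ (by
    rintro _ ⟨ω, r, s, hω, rfl⟩
    refine ⟨ω (F (D.mkL r s)), LinearMap.ext fun q => ?_⟩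
    rw [LinearMap.compr₂_apply, hElC, ← D.slice₁_mkL ω hω, star, D.slice₁_mkL])
  obtain ⟨η, hη⟩ := exists_factor (D.mkL.compr₂ F).flip D.lB D.lB_injective h.full_L₂ (by
    rintro _ ⟨ω, q, s, hω, rfl⟩
    refine ⟨ω (E (D.mkL s q)), LinearMap.ext fun r => ?_⟩
    rw [LinearMap.flip_apply, LinearMap.compr₂_apply, hFlB, ← D.slice₂_mkL ω hω, ← star,
      D.slice₂_mkL])
  replace hε : ∀ a b, E (D.mkL a b) = D.lC (ε a) b := fun a b => LinearMap.congr_fun (hε a) b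
  replace hη : ∀ a b, F (D.mkL a b) = D.lB (η b) a := fun a b => LinearMap.congr_fun (hη b) a
  have hεl : D.HomLeft ε := fun x a => D.lC_injective <| LinearMap.ext fun b => by
    rw [D.lC_mul, ← hε, ← hε, D.mkL_lB]
  have hεr : D.HomRight ε := fun x a => D.lC_injective <| LinearMap.ext fun b => by
    rw [D.lC_mul, ← hε, ← hε, hElC]
  have hηl : D.HomLeft η := fun x a => D.lB_injective <| LinearMap.ext fun b => by
    rw [D.lB_mul, ← hη, ← hη, hFlB]
  -- Slicing `star` on the second leg gives `ω(q) ε(s) = ω(q) η(s)`, which says that `ε` and `η`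
  -- agree on the elements `ω(q) s`. These span `A` by fullness.
  have hεη : ε = η := by
    rw [← sub_eq_zero]
    refine LinearMap.ext_on h.full_L₂ ?_
    rintro _ ⟨ω, q, s, hω, rfl⟩
    refine D.lB_injective (LinearMap.ext fun r => ?_)
    have := congrArg (D.slice₂ ω hω) (star r s q)
    rw [hε, hη, ← D.mkL_lB, D.slice₂_mkL, D.slice₂_mkL] at this
    rw [LinearMap.sub_apply, hεl, hηl, map_sub, LinearMap.sub_apply, D.lB_mul, D.lB_mul, this,
      sub_self, LinearMap.zero_apply, map_zero, LinearMap.zero_apply]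
  subst hεη
  have hE' : ∀ w, D.slice₁ ε hεl w = E w := D.congrL fun a b => (hε a b).symm
  have hF' : ∀ w, D.slice₂ ε hεr w = F w := D.congrL fun a b => (hη a b).symm
  exact ⟨ε, hεl, hεr, fun a b => by rw [hE', hE], fun a b => by rw [hF', hF, D.mr_eq]⟩

end SymmetricBialgebroid

/-! ### The maps `P` and `Q`, and the multiplier relations of the future antipode -/

namespace SymmetricBialgebroid

variable {D : SymmetricBialgebroid A X Y} {ε : A →ₗ[ℂ] X} {ε' : A →ₗ[ℂ] Y}

/-- `ε(a S_B(x)) = ε(a x)`. -/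
theorem IsCounit.apply_rC (hε : D.IsCounit ε) (hTr : Function.Surjective D.Tr) (x : X) (a : A) :
    ε (D.rC (D.pC x) a) = ε (D.rB (D.pB x) a) :=
  -- On `T_ρ(a ⊗ b)`, multiplying the first leg on the right by `S_B(x)` amounts to replacing `a` by
  -- `a S_B(x)`, and by `x` to replacing `b` by `S_B(x) b`. The counit sends both to `a S_B(x) b`.
  D.lC_injective <| LinearMap.ext fun b => congr_of_surjective hTr
    (φ := D.slice₁ ε hε.hom_left ∘ₗ D.L₁ (D.rC (D.pC x)) (fun x' a => (D.lB_rC x' _ a).symm))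
    (ψ := D.slice₁ ε hε.hom_left ∘ₗ D.L₁ (D.rB (D.pB x)) (fun x' a => (D.lB_rB x' _ a).symm))
    (fun a b => by
      rw [LinearMap.comp_apply, LinearMap.comp_apply, ← D.Tr_rC, ← D.Tr_lC_right, hε.slice_Tr,
        hε.slice_Tr, D.ml_lC]) (D.mkL a b)

/-- `ε(a S_B(ε(b))) = ε(a b)`. -/
theorem IsCounit.apply_rC_counit (hε : D.IsCounit ε) (hTr : Function.Surjective D.Tr) (a b : A) :
    ε (D.rC (D.pC (ε b)) a) = ε (D.ml a b) := by
  have hΔ : ∀ v w, D.slice₁ ε hε.hom_left (D.ΔL v w) = D.ml v (D.slice₁ ε hε.hom_left w) :=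
    fun v w => congr_of_surjective hTr (φ := D.slice₁ ε hε.hom_left ∘ₗ D.ΔL v)
      (ψ := D.ml v ∘ₗ D.slice₁ ε hε.hom_left)
      (fun a b => by
        rw [LinearMap.comp_apply, LinearMap.comp_apply, ← D.Tr_ml, hε.slice_Tr, hε.slice_Tr,
          D.ml_ml]) w
  refine D.lC_injective <| LinearMap.ext fun c => ?_
  -- Evaluated on `T_ρ(a ⊗ c)`: since `T_ρ(a ⊗ c)(b ⊗ 1) = Δ_B(a)(b ⊗ c)`, the slice is `a S_B(ε(b))
  -- c`, which is also the product of `a S_B(ε(b))` and `c`.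
  have := congr_of_surjective hTr
    (φ := D.slice₁ ε hε.hom_left ∘ₗ
      D.L₁ (D.rC (D.pC (ε b))) (fun x' a => (D.lB_rC x' _ a).symm))
    (ψ := D.slice₁ ε hε.hom_left ∘ₗ D.mrL₁ b)
    (fun a c => by
      rw [LinearMap.comp_apply, LinearMap.comp_apply, ← D.Tr_rC, hε.slice_Tr, D.mrL₁_Tr, hΔ,
        D.slice₁_mkL, D.ml_lC]) (D.mkL a c)
  rwa [LinearMap.comp_apply, LinearMap.comp_apply, D.mrL₁_mkL, D.L₁_mkL, D.slice₁_mkL,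
    D.slice₁_mkL] at this

variable (D) in
/-- The map `P : _B A ⊗ A^B → A` with `P (T_ρ (a ⊗ b)) = S_C(ε'(a)) b`, which will turn out to be
`a ⊗ b ↦ S(a) b`. -/
def IsLeftAntipodal (ε' : A →ₗ[ℂ] Y) (P : D.L →ₗ[ℂ] A) : Prop :=
  ∀ a b, P (D.Tr (a ⊗ₜ b)) = D.lB (D.pB.symm (ε' a)) b

variable (D) in
/-- The map `Q : ^C A ⊗ A_C → A` with `Q (_λ T (a ⊗ b)) = a S_B(ε(b))`, which will turn out to be
`a ⊗ b ↦ a S(b)`. -/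
def IsRightAntipodal (ε : A →ₗ[ℂ] X) (Q : D.R →ₗ[ℂ] A) : Prop :=
  ∀ a b, Q (D.lT (a ⊗ₜ b)) = D.rC (D.pC (ε b)) a

/-- The map `a ⊗ b ↦ S_C(ε_C(a)) b` is balanced over `B`, because `ε_C(a S_C(y)) = y ε_C(a)` and
`S_C` reverses products. It can therefore be transported along `T_ρ`. -/
theorem Regular.exists_isLeftAntipodal (h : D.Regular) (hε' : D.op.IsCounit ε') :
    ∃ P, D.IsLeftAntipodal ε' P :=
  h.Tr_lift (D.lB ∘ₗ D.pB.symm.toLinearMap ∘ₗ ε') fun x a b => by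
    have h1 : ε' (D.rB (D.pB x) a) = D.pB x * ε' a := hε'.hom_left _ _
    have h2 : D.pB.symm (D.pB x * ε' a) = D.pB.symm (ε' a) * x := by
      rw [LinearEquiv.symm_apply_eq, D.pB_mul, LinearEquiv.apply_symm_apply]
    simp only [LinearMap.comp_apply, LinearEquiv.coe_coe]
    rw [h1, h2, D.lB_mul]

theorem Regular.exists_isRightAntipodal (h : D.Regular) (hε : D.IsCounit ε) :
    ∃ Q, D.IsRightAntipodal ε Q :=
  h.lT_lift (D.rC ∘ₗ D.pC.toLinearMap ∘ₗ ε).flip fun x a b => by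
    simp only [LinearMap.comp_apply, LinearEquiv.coe_coe, LinearMap.flip_apply]
    rw [hε.hom_right, D.pC_mul, D.rC_mul]

/-- `S(b₍₁₎ y) b₍₂₎ = S_C(y) S(b₍₁₎) b₍₂₎`. -/
theorem IsLeftAntipodal.apply_mkL_rC {P : D.L →ₗ[ℂ] A} (hP : D.IsLeftAntipodal ε' P)
    (hTr : Function.Surjective D.Tr) (hε' : D.op.IsCounit ε') (y : Y) (a b : A) :
    P (D.mkL (D.rC y a) b) = D.lB (D.pB.symm y) (P (D.mkL a b)) :=
  congr_of_surjective hTr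
    (φ := P ∘ₗ D.L₁ (D.rC y) (fun x a => (D.lB_rC x y a).symm)) (ψ := D.lB (D.pB.symm y) ∘ₗ P)
    (fun a b => by
      have h1 : ε' (D.rC y a) = ε' a * y := hε'.hom_right _ _
      have h2 : D.pB.symm (ε' a * y) = D.pB.symm y * D.pB.symm (ε' a) := D.op.pB_mul _ _
      rw [LinearMap.comp_apply, LinearMap.comp_apply, ← D.Tr_rC, hP, hP, h1, h2, D.lB_mul])
    (D.mkL a b)

theorem IsLeftAntipodal.apply_mrL₂ {P : D.L →ₗ[ℂ] A} (hP : D.IsLeftAntipodal ε' P)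
    (hTr : Function.Surjective D.Tr) (c : A) (w : D.L) :
    P (D.mrL₂ c w) = D.ml (P w) c :=
  congr_of_surjective hTr (φ := P ∘ₗ D.mrL₂ c) (ψ := D.ml.flip c ∘ₗ P)
    (fun a b => by
      rw [LinearMap.comp_apply, LinearMap.comp_apply, ← D.Tr_ml_right, hP, hP,
        LinearMap.flip_apply, D.lB_ml]) w

/-- `a (S(b) c) = (a S(b)) c`. -/
theorem Regular.antipodal_pairing (h : D.Regular) (hε : D.IsCounit ε) (hε' : D.op.IsCounit ε')
    {P : D.L →ₗ[ℂ] A} (hP : D.IsLeftAntipodal ε' P) {Q : D.R →ₗ[ℂ] A}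
    (hQ : D.IsRightAntipodal ε Q) (a b c : A) :
    D.ml a (P (D.mkL b c)) = D.ml (Q (D.mkR a b)) c := by
  -- The map `a ⊗ b ↦ a P(b ⊗ c)` is balanced over `C` because `P` turns right multiplication by `y`
  -- on the first leg into left multiplication by `S_C(y)`.
  let Φ₁₂ : A → D.R →ₗ[ℂ] A := fun c =>
    Bal.lift (TensorProduct.lift ((D.ml.compl₂ (P ∘ₗ D.mkL.flip c)))) fun y a b => by
      simp only [TensorProduct.lift.tmul, LinearMap.compl₂_apply, LinearMap.comp_apply,
        LinearMap.flip_apply]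
      rw [hP.apply_mkL_rC h.Tr_surjective hε', D.ml_rB]
  -- Mixed co-associativity is tested on `r ⊗ s ⊗ t ↦ r P(s ⊗ t)`. The two counit identities make
  -- both `G c (_λ T(a ⊗ b))` and `K a (T_ρ(b ⊗ c))` equal to `a b c`.
  have key : ∀ a p q, Φ₁₂ q (D.lT (a ⊗ₜ p)) = D.ml a (D.slice₁ ε hε.hom_left (D.mkL p q)) :=
    D.coassoc_mixed₂.apply_of_surjective h.Tr_surjective
      (fun x y a => D.lB_rC x y a) (fun x => D.op.Tl_rB x)
      Φ₁₂ (fun a => D.ml a ∘ₗ P) (fun _ _ _ => rfl)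
      (fun c => D.ml.flip c ∘ₗ D.op.slice₂ ε' hε'.hom_right)
      (fun p q c => by
        rw [LinearMap.comp_apply, LinearMap.comp_apply, hP, D.ml_lB, LinearEquiv.apply_symm_apply]
        rfl)
      (fun a => D.ml a ∘ₗ D.slice₁ ε hε.hom_left)
      (fun a b c => by
        have h1 : D.op.slice₂ ε' hε'.hom_right (D.lT (a ⊗ₜ b)) = D.mr b a := hε'.slice_Tl a b
        rw [LinearMap.comp_apply, LinearMap.comp_apply, h1, hε.slice_Tr, LinearMap.flip_apply,
          D.mr_eq, D.ml_ml])
  exact congr_of_surjective h.lT_surjective (φ := Φ₁₂ c) (ψ := D.ml.flip c ∘ₗ Q)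
    (fun a p => by
      rw [key, D.slice₁_mkL, LinearMap.comp_apply, LinearMap.flip_apply, hQ, D.ml_lC])
    (D.mkR a b)

/-- `c S(r b) = (c S(b)) S(r)`. -/
theorem Regular.rightAntipodal_ml (h : D.Regular) (hε : D.IsCounit ε)
    {Q : D.R →ₗ[ℂ] A} (hQ : D.IsRightAntipodal ε Q) (c r b : A) :
    Q (D.mkR c (D.ml r b)) = Q (D.mkR (Q (D.mkR c b)) r) := by
  -- On `w = _λ T(a ⊗ b)` the two sides are `a S_B(ε(b q))` and `a S_B(ε(b S_B(ε(q))))`, so that the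
  -- claim is the identity for `ε` of a product.
  have hΔ : ∀ q w, Q (D.ΔR q w) =
      Q (D.R₁ (D.rC (D.pC (ε q))) (fun y' a => (D.rB_rC y' _ a).symm) w) := fun q w =>
    congr_of_surjective h.lT_surjective (φ := Q ∘ₗ D.ΔR q)
      (ψ := Q ∘ₗ D.R₁ (D.rC (D.pC (ε q))) (fun y' a => (D.rB_rC y' _ a).symm))
      (fun a b => by
        have h1 : D.lT (a ⊗ₜ D.mr q b) = D.ΔR q (D.lT (a ⊗ₜ b)) := D.op.Tl_ml q a b
        have h2 : D.lT (a ⊗ₜ D.rC (D.pC (ε q)) b) = D.R₁ (D.rC (D.pC (ε q)))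
          (fun y' a => (D.rB_rC y' _ a).symm) (D.lT (a ⊗ₜ b)) := D.op.Tl_lC _ a b
        rw [LinearMap.comp_apply, LinearMap.comp_apply, ← h1, ← h2, hQ, hQ, D.mr_eq,
          hε.apply_rC_counit h.Tr_surjective]) w
  exact congr_of_surjective h.lT_surjective (φ := Q ∘ₗ D.mlR₂ r) (ψ := Q ∘ₗ D.mkR.flip r ∘ₗ Q)
    (fun p q => by
      rw [LinearMap.comp_apply, D.mlR₂_lT, hΔ, LinearMap.comp_apply, LinearMap.comp_apply, hQ]
      rfl) (D.mkR c b)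

/-- `S(r b) d = S(b) (S(r) d)`. -/
theorem Regular.leftAntipodal_ml (h : D.Regular) (hε : D.IsCounit ε) (hε' : D.op.IsCounit ε')
    {P : D.L →ₗ[ℂ] A} (hP : D.IsLeftAntipodal ε' P) (r b d : A) :
    P (D.mkL (D.ml r b) d) = P (D.mkL b (P (D.mkL r d))) := by
  obtain ⟨Q, hQ⟩ := h.exists_isRightAntipodal hε
  -- After left multiplication by `c`, the pairing moves the claim from `P` to `Q`, where the
  -- corresponding relation is known.
  refine D.eq_of_mr fun c => ?_
  rw [h.antipodal_pairing hε hε' hP hQ, h.antipodal_pairing hε hε' hP hQ,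
    h.rightAntipodal_ml hε hQ, h.antipodal_pairing hε hε' hP hQ]

/-- `S(y a) = S(a) S_C(y)` for `y = S_B(x)`, in the form `c S(y a) = (c S(a)) S_C(y)`. -/
theorem Regular.rightAntipodal_lC (h : D.Regular) {Q : D.R →ₗ[ℂ] A}
    (hQ : D.IsRightAntipodal ε Q) (x : X) (c a : A) :
    Q (D.mkR c (D.lC x a)) = D.rB (D.pC x) (Q (D.mkR c a)) :=
  congr_of_surjective h.lT_surjective
    (φ := Q ∘ₗ D.R₂ (D.lC x) (fun y a => D.lC_rC x y a)) (ψ := D.rB (D.pC x) ∘ₗ Q)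
    (fun a b => by
      have h1 : D.lT (D.rB (D.pC x) a ⊗ₜ b) =
          D.R₂ (D.lC x) (fun y a => D.lC_rC x y a) (D.lT (a ⊗ₜ b)) := by
        have := D.op.Tl_lB_left (D.pC x) a b
        simp only [LinearEquiv.symm_apply_apply] at this
        exact this
      rw [LinearMap.comp_apply, LinearMap.comp_apply, ← h1, hQ, hQ, D.rB_rC])
    (D.mkR c a)

/-- `S(y a) b = S(a) (S_C(y) b)` for `y = S_B(x)`. -/
theorem Regular.leftAntipodal_lC (h : D.Regular) (hε : D.IsCounit ε) (hε' : D.op.IsCounit ε')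
    {P : D.L →ₗ[ℂ] A} (hP : D.IsLeftAntipodal ε' P) (x : X) (a b : A) :
    P (D.mkL (D.lC x a) b) = P (D.mkL a (D.lB (D.pB.symm (D.pC x)) b)) := by
  obtain ⟨Q, hQ⟩ := h.exists_isRightAntipodal hε
  refine D.eq_of_mr fun c => ?_
  rw [h.antipodal_pairing hε hε' hP hQ, h.antipodal_pairing hε hε' hP hQ,
    h.rightAntipodal_lC hQ, D.ml_rB]

/-- `S(S⁻¹(b) a) = S(a) b`, in terms of the map `Q'` that will turn out to be
`a ⊗ b ↦ S⁻¹(b) a`. -/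
theorem Regular.leftAntipodal_rightAntipodal (h : D.Regular) (hε : D.IsCounit ε)
    (hε' : D.op.IsCounit ε') {P : D.L →ₗ[ℂ] A} (hP : D.IsLeftAntipodal ε' P)
    {Q' : D.L →ₗ[ℂ] A} (hQ' : D.op.IsRightAntipodal ε' Q') (w : D.L) (s : A) :
    P (D.mkL (Q' w) s) = D.ml (P w) s := by
  -- For `w = T_λ(p ⊗ q)`, this turns `P(w) s = P(T_ρ(q ⊗ s)(p ⊗ 1))` into `P(p ⊗ S_C(ε_C(q)) s)`,
  -- while `Q'(w) = ε_C(q) p` by definition.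
  have hmul : ∀ p w, P (D.mrL₁ p w) = P (D.mkL p (P w)) := fun p w =>
    D.congrL (φ := P ∘ₗ D.mrL₁ p) (ψ := P ∘ₗ D.mkL p ∘ₗ P)
      (fun r d => by
        rw [LinearMap.comp_apply, D.mrL₁_mkL, h.leftAntipodal_ml hε hε' hP]; rfl) w
  exact congr_of_surjective h.Tl_surjective (φ := P ∘ₗ D.mkL.flip s ∘ₗ Q')
    (ψ := D.ml.flip s ∘ₗ P)
    (fun p q => by
      have h1 : Q' (D.Tl (p ⊗ₜ q)) = D.lC (D.pC.symm (ε' q)) p := hQ' p q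
      rw [LinearMap.comp_apply, LinearMap.comp_apply, h1, LinearMap.flip_apply,
        h.leftAntipodal_lC hε hε' hP, LinearEquiv.apply_symm_apply, LinearMap.comp_apply,
        LinearMap.flip_apply, ← hP.apply_mrL₂ h.Tr_surjective, D.mrL₂_Tl_eq, hmul, hP]) w

end SymmetricBialgebroid

/-! ### Construction of the antipode, passage to the opposite, and inversion formulas -/

namespace SymmetricBialgebroid

variable {D : SymmetricBialgebroid A X Y} {ε : A →ₗ[ℂ] X} {ε' : A →ₗ[ℂ] Y}

variable (D) in
theorem eq_top_of_ml_mem {N : Submodule ℂ A} (h : ∀ a b, D.ml a b ∈ N) : N = ⊤ := by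
  rw [← top_le_iff, ← D.idempotent, Submodule.span_le]
  rintro _ ⟨a, b, rfl⟩
  exact h a b

theorem apply_mem_of_surjective {N : Submodule ℂ A} {M : Type*} [AddCommGroup M] [Module ℂ M]
    {T : A ⊗[ℂ] A →ₗ[ℂ] M} (hT : Function.Surjective T) {φ : M →ₗ[ℂ] A}
    (h : ∀ a b, φ (T (a ⊗ₜ b)) ∈ N) (w : M) : φ w ∈ N := by
  have := congr_of_surjective hT (φ := N.mkQ ∘ₗ φ) (ψ := 0)
    (fun a b => by simpa using h a b) w
  simpa using this

/-- Every product `a b` is the slice of `T_ρ(a ⊗ b)`, hence a sum of elements `S_B(ε(c)) d`, and `A`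
is idempotent. In the converse direction this also yields one of the fullness conditions. -/
theorem IsCounit.span_lC (hε : D.IsCounit ε) :
    Submodule.span ℂ {c | ∃ a b, c = D.lC (ε a) b} = ⊤ :=
  D.eq_top_of_ml_mem fun a b => by
    rw [← hε.slice_Tr]
    exact apply_mem_of_surjective (N := Submodule.span ℂ {c | ∃ a b, c = D.lC (ε a) b})
      (Bal.π_surjective D.lB D.lC) (φ := D.slice₁ ε hε.hom_left)
      (fun a b => Submodule.subset_span ⟨a, b, rfl⟩) _

theorem IsCounit.span_lB (hε : D.IsCounit ε) :
    Submodule.span ℂ {c | ∃ a b, c = D.lB (ε a) b} = ⊤ :=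
  D.eq_top_of_ml_mem fun a b => by
    rw [← hε.slice_Tl]
    exact apply_mem_of_surjective (N := Submodule.span ℂ {c | ∃ a b, c = D.lB (ε a) b})
      (Bal.π_surjective D.lB D.lC) (φ := D.slice₂ ε hε.hom_right)
      (fun a b => Submodule.subset_span ⟨b, a, rfl⟩) _

/-- `ε_C(A) A = A`. -/
theorem Regular.span_lC_counit (h : D.Regular) (hε' : D.op.IsCounit ε') :
    Submodule.span ℂ {c | ∃ a b, c = D.lC (D.pC.symm (ε' a)) b} = ⊤ := by
  have key : ∀ w, D.op.slice₁ ε' hε'.hom_left w ∈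
      Submodule.span ℂ {c | ∃ a b, c = D.lC (D.pC.symm (ε' a)) b} := by
    refine apply_mem_of_surjective
      (N := Submodule.span ℂ {c | ∃ a b, c = D.lC (D.pC.symm (ε' a)) b}) h.lT_surjective
      (φ := D.op.slice₁ ε' hε'.hom_left) fun a b => ?_
    -- Since `A S_C(ε_C(A)) = A`, the first argument of `_λ T` may be taken of the form `a
    -- S_C(ε_C(d))`. The map `_λ T` turns this factor into left multiplication by `ε_C(d)` on the
    -- second leg, and this survives the slice.
    have hle : Submodule.span ℂ {c | ∃ a b, c = D.rB (ε' a) b} ≤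
        (Submodule.span ℂ {c | ∃ a b, c = D.lC (D.pC.symm (ε' a)) b}).comap
          (D.op.slice₁ ε' hε'.hom_left ∘ₗ D.lT ∘ₗ (TensorProduct.mk ℂ A A).flip b) := by
      refine Submodule.span_le.2 ?_
      rintro _ ⟨d, a, rfl⟩
      change D.op.slice₁ ε' hε'.hom_left (D.lT (D.rB (ε' d) a ⊗ₜ b)) ∈
        Submodule.span ℂ {c | ∃ a b, c = D.lC (D.pC.symm (ε' a)) b}
      have h1 : D.lT (D.rB (ε' d) a ⊗ₜ b) = D.R₂ (D.lC (D.pC.symm (ε' d)))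
        (fun y a => D.lC_rC _ y a) (D.lT (a ⊗ₜ b)) := D.op.Tl_lB_left (ε' d) a b
      have h2 : D.op.slice₁ ε' hε'.hom_left (D.lT (D.rB (ε' d) a ⊗ₜ b)) =
          D.lC (D.pC.symm (ε' d)) (D.op.slice₁ ε' hε'.hom_left (D.lT (a ⊗ₜ b))) := by
        rw [h1]
        exact D.congrR (φ := D.op.slice₁ ε' hε'.hom_left ∘ₗ
            D.R₂ (D.lC (D.pC.symm (ε' d))) (fun y a => D.lC_rC _ y a))
          (ψ := D.lC (D.pC.symm (ε' d)) ∘ₗ D.op.slice₁ ε' hε'.hom_left)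
          (fun r s => (D.lC_rC _ _ s).symm) _
      rw [h2]
      exact Submodule.subset_span ⟨d, _, rfl⟩
    have hB : Submodule.span ℂ {c | ∃ a b, c = D.rB (ε' a) b} = ⊤ := hε'.span_lB
    exact hle (hB ▸ Submodule.mem_top)
  exact D.op.eq_top_of_ml_mem fun a b => by
    rw [← hε'.slice_Tr]
    exact key _

/-- `S_C(ε_C(A)) A = A`. -/
theorem Regular.span_lB_counit (h : D.Regular) (hε' : D.op.IsCounit ε') :
    Submodule.span ℂ {c | ∃ a b, c = D.lB (D.pB.symm (ε' a)) b} = ⊤ := by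
  have key : ∀ w, D.op.slice₂ ε' hε'.hom_right w ∈
      Submodule.span ℂ {c | ∃ a b, c = D.lB (D.pB.symm (ε' a)) b} := by
    refine apply_mem_of_surjective
      (N := Submodule.span ℂ {c | ∃ a b, c = D.lB (D.pB.symm (ε' a)) b}) h.rT_surjective
      (φ := D.op.slice₂ ε' hε'.hom_right) fun a b => ?_
    -- Since `A ε_C(A) = A`, the second argument of `_ρ T` may be taken of the form `b ε_C(d)`. The
    -- map `_ρ T` turns this factor into left multiplication by `S_C(ε_C(d))` on the first leg.
    have hle : Submodule.span ℂ {c | ∃ a b, c = D.rC (ε' a) b} ≤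
        (Submodule.span ℂ {c | ∃ a b, c = D.lB (D.pB.symm (ε' a)) b}).comap
          (D.op.slice₂ ε' hε'.hom_right ∘ₗ D.rT ∘ₗ TensorProduct.mk ℂ A A a) := by
      refine Submodule.span_le.2 ?_
      rintro _ ⟨d, b, rfl⟩
      change D.op.slice₂ ε' hε'.hom_right (D.rT (a ⊗ₜ D.rC (ε' d) b)) ∈
        Submodule.span ℂ {c | ∃ a b, c = D.lB (D.pB.symm (ε' a)) b}
      have h1 : D.rT (a ⊗ₜ D.rC (ε' d) b) = D.R₁ (D.lB (D.pB.symm (ε' d)))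
        (fun y a => D.lB_rB _ y a) (D.rT (a ⊗ₜ b)) := D.op.Tr_lC_right (ε' d) a b
      have h2 : D.op.slice₂ ε' hε'.hom_right (D.rT (a ⊗ₜ D.rC (ε' d) b)) =
          D.lB (D.pB.symm (ε' d)) (D.op.slice₂ ε' hε'.hom_right (D.rT (a ⊗ₜ b))) := by
        rw [h1]
        exact D.congrR (φ := D.op.slice₂ ε' hε'.hom_right ∘ₗ
            D.R₁ (D.lB (D.pB.symm (ε' d))) (fun y a => D.lB_rB _ y a))
          (ψ := D.lB (D.pB.symm (ε' d)) ∘ₗ D.op.slice₂ ε' hε'.hom_right)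
          (fun r s => (D.lB_rB _ _ r).symm) _
      rw [h2]
      exact Submodule.subset_span ⟨d, _, rfl⟩
    have hC : Submodule.span ℂ {c | ∃ a b, c = D.rC (ε' a) b} = ⊤ := hε'.span_lC
    exact hle (hC ▸ Submodule.mem_top)
  exact D.op.eq_top_of_ml_mem fun a b => by
    rw [← hε'.slice_Tl]
    exact key _

/-- The antipode of a regular multiplier Hopf algebroid as a surjective anti-homomorphism. -/
theorem Regular.exists_antihom (h : D.Regular) (hε : D.IsCounit ε) (hε' : D.op.IsCounit ε')
    {P : D.L →ₗ[ℂ] A} (hP : D.IsLeftAntipodal ε' P) {Q : D.R →ₗ[ℂ] A}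
    (hQ : D.IsRightAntipodal ε Q) {Q' : D.L →ₗ[ℂ] A} (hQ' : D.op.IsRightAntipodal ε' Q') :
    ∃ S : A →ₗ[ℂ] A, (∀ a b, P (D.mkL a b) = D.ml (S a) b) ∧
      (∀ a b, Q (D.mkR a b) = D.ml a (S b)) ∧ (∀ a b, S (D.ml a b) = D.ml (S b) (S a)) ∧
      Function.Surjective S ∧ ∀ w, S (Q' w) = P w := by
  -- The multiplier `P(a ⊗ ·)` must come from an element of `A`. On the spanning elements `ε_C(b) a
  -- = Q'(T_λ(a ⊗ b))`, this element is `P(T_λ(a ⊗ b))`.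
  obtain ⟨S, hS⟩ := exists_factor (D.mkL.compr₂ P) D.ml
    (fun a a' haa' => D.eq_of_ml fun b => by rw [haa']) (h.span_lC_counit hε') (by
      rintro _ ⟨b, a, rfl⟩
      refine ⟨P (D.Tl (a ⊗ₜ b)), LinearMap.ext fun s => ?_⟩
      have h1 : Q' (D.Tl (a ⊗ₜ b)) = D.lC (D.pC.symm (ε' b)) a := hQ' a b
      rw [LinearMap.compr₂_apply, ← h1, h.leftAntipodal_rightAntipodal hε hε' hP hQ'])
  replace hS : ∀ a b, P (D.mkL a b) = D.ml (S a) b := fun a b => LinearMap.congr_fun (hS a) b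
  have hSQ : ∀ w, S (Q' w) = P w := fun w => D.eq_of_ml fun s => by
    rw [← hS, h.leftAntipodal_rightAntipodal hε hε' hP hQ']
  refine ⟨S, hS, fun a b => D.eq_of_ml fun c => ?_, fun a b => D.eq_of_ml fun c => ?_, ?_, hSQ⟩
  · rw [← h.antipodal_pairing hε hε' hP hQ, hS, D.ml_ml]
  · rw [← hS, h.leftAntipodal_ml hε hε' hP, hS, hS, D.ml_ml]
  -- Because `S Q' = P`, the range of `S` contains every `P(T_ρ(a ⊗ b)) = S_C(ε_C(a)) b`.
  · rw [← LinearMap.range_eq_top, ← top_le_iff, ← h.span_lB_counit hε', Submodule.span_le]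
    rintro _ ⟨a, b, rfl⟩
    exact ⟨Q' (D.Tr (a ⊗ₜ b)), by rw [hSQ, hP]⟩

/-- The hypothesis reads `S(a) S(S'(b)) = S(a) b`. As `S(a)` runs through `A`, non-degeneracy
cancels it. -/
theorem comp_eq_id_of_apply_ml {S S' : A →ₗ[ℂ] A} (hS : Function.Surjective S)
    (hmul : ∀ a b, S (D.ml a b) = D.ml (S b) (S a))
    (h : ∀ a b, S (D.ml (S' b) a) = D.ml (S a) b) (b : A) : S (S' b) = b :=
  D.eq_of_mr fun c => by
    obtain ⟨a, rfl⟩ := hS c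
    exact (hmul _ _).symm.trans (h a b)

variable (D) in
/-- Invertible antipodes. -/
structure IsAntipode (S : A ≃ₗ[ℂ] A) (ε : A →ₗ[ℂ] X) (ε' : A →ₗ[ℂ] Y) : Prop where
  map_ml : ∀ a b, S (D.ml a b) = D.ml (S b) (S a)
  map_lB : ∀ x a, S (D.lB x a) = D.rC (D.pC x) (S a)
  map_lC : ∀ x a, S (D.lC x a) = D.rB (D.pC x) (S a)
  map_rB : ∀ x a, S (D.rB (D.pB x) a) = D.lC x (S a)
  map_rC : ∀ x a, S (D.rC (D.pB x) a) = D.lB x (S a)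
  exists_left : ∃ P, D.IsLeftAntipodal ε' P ∧ ∀ a b, P (D.mkL a b) = D.ml (S a) b
  exists_right : ∃ Q, D.IsRightAntipodal ε Q ∧ ∀ a b, Q (D.mkR a b) = D.ml a (S b)

/-- The construction applied to the opposite yields a second anti-homomorphism `S'`, with `Q'(a ⊗ b)
= S'(b) a`. The relations `S Q' = P` and `S' Q = P'` then make `S` and `S'` mutually inverse. -/
theorem Regular.exists_isAntipode (h : D.Regular) (hε : D.IsCounit ε)
    (hε' : D.op.IsCounit ε') : ∃ S, D.IsAntipode S ε ε' := by
  obtain ⟨P, hP⟩ := h.exists_isLeftAntipodal hε'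
  obtain ⟨Q, hQ⟩ := h.exists_isRightAntipodal hε
  obtain ⟨P', hP'⟩ := h.op.exists_isLeftAntipodal (ε' := ε) hε
  obtain ⟨Q', hQ'⟩ := h.op.exists_isRightAntipodal hε'
  obtain ⟨S, hSP, hSQ, hSmul, hSsurj, hSS⟩ := h.exists_antihom hε hε' hP hQ hQ'
  obtain ⟨S', hSP', hSQ', hSmul', hSsurj', hSS'⟩ :=
    h.op.exists_antihom (ε' := ε) hε' hε hP' hQ' (Q' := Q) hQ
  have h1 : ∀ b, S (S' b) = b := comp_eq_id_of_apply_ml (D := D) hSsurj hSmul fun a b => by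
    have : Q' (D.mkL a b) = D.mr a (S' b) := hSQ' a b
    rw [← D.mr_eq, ← this, hSS, hSP]
  have h2 : ∀ b, S' (S b) = b :=
    comp_eq_id_of_apply_ml (D := D.op) hSsurj' hSmul' fun a b => by
      have h3 : S' (Q (D.mkR a b)) = P' (D.mkR a b) := hSS' _
      rw [D.mr_eq, ← hSQ, h3]
      exact hSP' a b
  refine ⟨LinearEquiv.ofLinearMap S S' (LinearMap.ext h1) (LinearMap.ext h2), ⟨hSmul,
    fun x a => D.eq_of_ml fun b => ?_, fun x a => D.eq_of_ml fun b => ?_,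
    fun x a => D.eq_of_mr fun c => ?_, fun x a => D.eq_of_mr fun c => ?_,
    ⟨P, hP, hSP⟩, ⟨Q, hQ, hSQ⟩⟩⟩
  · change D.ml (S (D.lB x a)) b = D.ml (D.rC (D.pC x) (S a)) b
    rw [← hSP, D.mkL_lB, hSP, D.ml_lC]
  · change D.ml (S (D.lC x a)) b = D.ml (D.rB (D.pC x) (S a)) b
    rw [← hSP, h.leftAntipodal_lC hε hε' hP, hSP, D.ml_rB]
  · change D.ml c (S (D.rB (D.pB x) a)) = D.ml c (D.lC x (S a))
    -- For `S(a x) = S_B(x) S(a)`: multiplying the second leg of `_λ T(b ⊗ c)` by `x`, or the first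
    -- leg by `S_B(x)`, replaces `c` by `c x` or by `c S_B(x)`. The map `Q` does not distinguish
    -- them, because `ε(c x) = ε(c S_B(x))`.
    have h3 : ∀ y b c, D.lT (b ⊗ₜ D.rB y c) =
      D.R₂ (D.rB y) (D.rB_rC y) (D.lT (b ⊗ₜ c)) := D.op.Tl_lB
    have h4 : ∀ y b c, D.lT (b ⊗ₜ D.rC y c) =
      D.R₁ (D.rC y) (fun y' a => (D.rB_rC y' y a).symm) (D.lT (b ⊗ₜ c)) := D.op.Tl_lC
    rw [← hSQ, D.ml_lC, ← hSQ]
    exact congr_of_surjective h.lT_surjective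
      (φ := Q ∘ₗ D.R₂ (D.rB (D.pB x)) (D.rB_rC (D.pB x)))
      (ψ := Q ∘ₗ D.R₁ (D.rC (D.pC x)) (fun y' a => (D.rB_rC y' _ a).symm))
      (fun a b => by
        rw [LinearMap.comp_apply, LinearMap.comp_apply, ← h3, ← h4, hQ, hQ,
          hε.apply_rC h.Tr_surjective]) (D.mkR c a)
  · change D.ml c (S (D.rC (D.pB x) a)) = D.ml c (D.lB x (S a))
    rw [← hSQ, ← D.mkR_rB, hSQ, D.ml_lB]

/-- `S(b₍₁₎ a) b₍₂₎ = S(a) S_C(ε_C(b))`. -/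
theorem IsAntipode.left_Tl {S : A ≃ₗ[ℂ] A} (hS : D.IsAntipode S ε ε') {P : D.L →ₗ[ℂ] A}
    (hP : D.IsLeftAntipodal ε' P) (hPS : ∀ a b, P (D.mkL a b) = D.ml (S a) b) (a b : A) :
    P (D.Tl (a ⊗ₜ b)) = D.rB (ε' b) (S a) := by
  have h₁ : ∀ w, P (D.mrL₁ a w) = D.ml (S a) (P w) :=
    D.congrL (φ := P ∘ₗ D.mrL₁ a) (ψ := D.ml (S a) ∘ₗ P) fun r s => by
      rw [LinearMap.comp_apply, LinearMap.comp_apply, D.mrL₁_mkL, hPS, hPS, hS.map_ml, D.ml_ml]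
  have h₂ : ∀ s w, P (D.mrL₂ s w) = D.ml (P w) s := fun s =>
    D.congrL (φ := P ∘ₗ D.mrL₂ s) (ψ := D.ml.flip s ∘ₗ P) fun r t => by
      rw [LinearMap.comp_apply, LinearMap.comp_apply, D.mrL₂_mkL, hPS, hPS, LinearMap.flip_apply,
        D.ml_ml]
  -- Multiplication by `s` gives `T_λ(a ⊗ b)(1 ⊗ s) = T_ρ(b ⊗ s)(a ⊗ 1)`, which reduces the claim to
  -- the defining identity of `P` on `T_ρ`.
  exact D.eq_of_ml fun s => by rw [← h₂, D.mrL₂_Tl_eq, h₁, hP, D.ml_rB]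

/-- `a₍₁₎ S(b a₍₂₎) = S_B(ε_B(a)) S(b)`. -/
theorem IsAntipode.right_rT {S : A ≃ₗ[ℂ] A} (hS : D.IsAntipode S ε ε') {Q : D.R →ₗ[ℂ] A}
    (hQ : D.IsRightAntipodal ε Q) (hQS : ∀ a b, Q (D.mkR a b) = D.ml a (S b)) (a b : A) :
    Q (D.rT (a ⊗ₜ b)) = D.lC (ε a) (S b) := by
  have h₁ : ∀ d w, Q (D.mlR₁ d w) = D.ml d (Q w) := fun d =>
    D.congrR (φ := Q ∘ₗ D.mlR₁ d) (ψ := D.ml d ∘ₗ Q) fun r s => by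
      rw [LinearMap.comp_apply, LinearMap.comp_apply, D.mlR₁_mkR, hQS, hQS, D.ml_ml]
  have h₂ : ∀ w, Q (D.mlR₂ b w) = D.ml (Q w) (S b) :=
    D.congrR (φ := Q ∘ₗ D.mlR₂ b) (ψ := D.ml.flip (S b) ∘ₗ Q) fun r t => by
      rw [LinearMap.comp_apply, LinearMap.comp_apply, D.mlR₂_mkR, hQS, hQS, LinearMap.flip_apply,
        hS.map_ml, D.ml_ml]
  exact D.eq_of_mr fun d => by rw [← h₁, ← D.mlR₂_lT_eq, h₂, hQ, D.ml_lC]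

/-- The antipode identities of `S⁻¹` in the opposite arise by applying `S⁻¹` to `right_rT` and
`left_Tl`. Consequently, each inversion formula for `S` has a companion for `S⁻¹`. -/
theorem IsAntipode.op {S : A ≃ₗ[ℂ] A} (hS : D.IsAntipode S ε ε') :
    D.op.IsAntipode S.symm ε' ε where
  map_ml a b := by
    rw [LinearEquiv.symm_apply_eq, D.mr_eq, D.mr_eq, hS.map_ml, LinearEquiv.apply_symm_apply,
      LinearEquiv.apply_symm_apply]
  map_lB y a := by
    rw [LinearEquiv.symm_apply_eq, hS.map_lC, LinearEquiv.apply_symm_apply,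
      LinearEquiv.apply_symm_apply]
  map_lC y a := by
    rw [LinearEquiv.symm_apply_eq, hS.map_lB, LinearEquiv.apply_symm_apply,
      LinearEquiv.apply_symm_apply]
  map_rB y a := by
    obtain ⟨x, rfl⟩ := D.pB.surjective y
    rw [LinearEquiv.symm_apply_eq, hS.map_rC, LinearEquiv.apply_symm_apply,
      LinearEquiv.symm_apply_apply]
  map_rC y a := by
    obtain ⟨x, rfl⟩ := D.pB.surjective y
    rw [LinearEquiv.symm_apply_eq, hS.map_rB, LinearEquiv.apply_symm_apply,
      LinearEquiv.symm_apply_apply]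
  exists_left := by
    obtain ⟨Q, hQ, hQS⟩ := hS.exists_right
    refine ⟨S.symm.toLinearMap ∘ₗ Q, fun a b => ?_, fun a b => ?_⟩
    · change S.symm (Q (D.rT (a ⊗ₜ b))) = D.rB (D.pB (ε a)) b
      rw [LinearEquiv.symm_apply_eq, hS.map_rB, hS.right_rT hQ hQS]
    · change S.symm (Q (D.mkR a b)) = D.mr (S.symm a) b
      rw [LinearEquiv.symm_apply_eq, hQS, D.mr_eq, hS.map_ml, LinearEquiv.apply_symm_apply]
  exists_right := by
    obtain ⟨P, hP, hPS⟩ := hS.exists_left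
    refine ⟨S.symm.toLinearMap ∘ₗ P, fun a b => ?_, fun a b => ?_⟩
    · change S.symm (P (D.Tl (a ⊗ₜ b))) = D.lC (D.pC.symm (ε' b)) a
      rw [LinearEquiv.symm_apply_eq, hS.map_lC, LinearEquiv.apply_symm_apply, hS.left_Tl hP hPS]
    · change S.symm (P (D.mkL a b)) = D.mr a (S.symm b)
      rw [LinearEquiv.symm_apply_eq, hPS, D.mr_eq, hS.map_ml, LinearEquiv.apply_symm_apply]

/-- `T_ρ ∘ (ι ⊗ S) ∘ _ρ T = ι ⊗ S`. -/
theorem IsAntipode.Tr_rT {S : A ≃ₗ[ℂ] A} (hS : D.IsAntipode S ε ε') (hε : D.IsCounit ε)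
    (θ : D.R →ₗ[ℂ] D.L) (hθ : ∀ a b, θ (D.mkR a b) = D.Tr (a ⊗ₜ S b)) (b c : A) :
    θ (D.rT (b ⊗ₜ c)) = D.mkL b (S c) := by
  obtain ⟨Q, hQ, hQS⟩ := hS.exists_right
  refine D.eq_of_mrL₁ fun d => ?_
  -- Mixed co-associativity is tested on `r ⊗ s ⊗ t ↦ r ⊗ s S(t)`. One side collapses to `b d ⊗
  -- S(c)` by `right_rT` and the counit identity; the other is `θ(_ρ T(b ⊗ c))(d ⊗ 1)`.
  have := D.coassoc_mixed₁.apply (fun t => D.mrL₂ (S t)) (fun r => D.mkL r ∘ₗ Q)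
    (fun a b c => by
      rw [LinearMap.comp_apply]
      exact (D.mrL₂_mkL (S c) a b).trans (congrArg (D.mkL a) (hQS b c).symm))
    d b c (D.mkL.flip (S c) ∘ₗ D.slice₂ ε hε.hom_right)
    (fun p q => by
      rw [LinearMap.comp_apply, LinearMap.comp_apply, hS.right_rT hQ hQS, ← D.mkL_lB]; rfl)
    (D.mrL₁ d ∘ₗ θ)
    (fun p q => by
      rw [D.mrL₂_Tl_eq, ← hθ]; rfl)
  rw [LinearMap.comp_apply, LinearMap.comp_apply, hε.slice_Tl] at this
  rw [← this, D.mrL₁_mkL, LinearMap.flip_apply]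

/-- `_λ T ∘ (S ⊗ ι) ∘ T_λ = S ⊗ ι`. -/
theorem IsAntipode.lT_Tl {S : A ≃ₗ[ℂ] A} (hS : D.IsAntipode S ε ε') (hε' : D.op.IsCounit ε')
    (θ : D.L →ₗ[ℂ] D.R) (hθ : ∀ a b, θ (D.mkL a b) = D.lT (S a ⊗ₜ b)) (a b : A) :
    θ (D.Tl (a ⊗ₜ b)) = D.mkR (S a) b := by
  obtain ⟨P, hP, hPS⟩ := hS.exists_left
  refine D.op.eq_of_mrL₂ fun c => ?_
  -- Here the test map is `r ⊗ s ⊗ t ↦ S(r) s ⊗ t`. The sides become `(1 ⊗ c) θ(T_λ(a ⊗ b))` and, by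
  -- `left_Tl` and the right counit identity, `S(a) ⊗ c b`.
  have := D.coassoc_mixed₁.apply (fun t => D.mkR.flip t ∘ₗ P) (fun r => D.mlR₁ (S r))
    (fun a b c => by
      rw [LinearMap.comp_apply]
      exact congrArg (D.mkR.flip c) (hPS a b))
    a b c (D.mlR₂ c ∘ₗ θ)
    (fun p q => by
      rw [← D.mlR₂_lT_eq, ← hθ]; rfl)
    (D.mkR (S a) ∘ₗ D.op.slice₁ ε' hε'.hom_left)
    (fun p q => by
      rw [LinearMap.comp_apply, LinearMap.comp_apply, hS.left_Tl hP hPS, LinearMap.flip_apply,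
        D.mkR_rB]; rfl)
  have h1 : D.op.slice₁ ε' hε'.hom_left (D.rT (b ⊗ₜ c)) = D.mr b c := hε'.slice_Tr b c
  rw [LinearMap.comp_apply, LinearMap.comp_apply, h1, D.mr_eq] at this
  exact this

end SymmetricBialgebroid

end Antipode

/-! ### Translation of the original data into the self-dual form -/

section Main

variable {A : Type*} [NonUnitalRing A] [Module ℂ A] [IsScalarTower ℂ A A] [SMulCommClass ℂ A A]

/-- The base data of a multiplier bialgebroid in symmetric form. -/
def BaseData.symmetric (D : BaseData A) : SymmetricBase A D.B D.C where
  ml := LinearMap.mul ℂ A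
  mr := (LinearMap.mul ℂ A).flip
  mr_eq _ _ := rfl
  ml_ml := mul_assoc
  nondegenerate_right := D.nondegenerate_right
  nondegenerate_left := D.nondegenerate_left
  idempotent := D.idempotent
  lB :=
    { toFun := D.lB
      map_add' := fun _ _ => rfl
      map_smul' := fun _ _ => rfl }
  lC :=
    { toFun := D.lSB
      map_add' := fun x x' => by rw [BaseData.lSB, map_add]; rfl
      map_smul' := fun r x => by rw [BaseData.lSB, map_smul]; rfl }
  rB :=
    { toFun := D.rSC
      map_add' := fun y y' => by rw [BaseData.rSC, map_add]; rfl
      map_smul' := fun r y => by rw [BaseData.rSC, map_smul]; rfl }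
  rC :=
    { toFun := D.rC
      map_add' := fun _ _ => rfl
      map_smul' := fun _ _ => rfl }
  pB := D.SC.symm
  pC := D.SB
  lB_injective := (injective_iff_map_eq_zero _).2 fun x hx =>
    D.faithful_left_B x (LinearMap.congr_fun hx)
  lC_injective := (injective_iff_map_eq_zero _).2 fun x hx =>
    D.faithful_left_SB x (LinearMap.congr_fun hx)
  rB_injective := (injective_iff_map_eq_zero _).2 fun y hy =>
    D.faithful_right_SC y (LinearMap.congr_fun hy)
  rC_injective := (injective_iff_map_eq_zero _).2 fun y hy =>
    D.faithful_right_C y (LinearMap.congr_fun hy)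
  lB_mul _ _ _ := rfl
  lC_mul x x' a := by
    change D.lC (D.SB (x * x')) a = D.lC (D.SB x') (D.lC (D.SB x) a)
    rw [D.SB_mul]; rfl
  rB_mul y y' a := by
    change D.rB (D.SC (y * y')) a = D.rB (D.SC y) (D.rB (D.SC y') a)
    rw [D.SC_mul]; rfl
  rC_mul _ _ _ := rfl
  pB_mul x x' := by rw [LinearEquiv.symm_apply_eq, D.SC_mul]; simp
  pC_mul := D.SB_mul
  lB_lC x x' a := lmul_comm (D.comm x (D.SB x')) a
  rB_rC y y' a := rmul_comm (D.comm (D.SC y) y') a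
  lB_rB x y a := D.lmul_rmul _ _ a
  lB_rC x y a := D.lmul_rmul _ _ a
  lC_rB x y a := D.lmul_rmul _ _ a
  lC_rC x y a := D.lmul_rmul _ _ a
  lB_ml x a b := lmul_apply_mul _ a b
  lC_ml x a b := lmul_apply_mul _ a b
  rB_mr y a b := rmul_apply_mul _ b a
  rC_mr y a b := rmul_apply_mul _ b a
  ml_lB x a b := by
    change a * D.lB x b = D.rB (D.SC (D.SC.symm x)) a * b
    rw [LinearEquiv.apply_symm_apply]
    exact mul_lmul _ a b
  ml_lC x a b := mul_lmul _ a b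

namespace ComultData

variable (D : ComultData A)

/-- The bimodule axiom speaks only of elements `x y a x' y'`. As these span `A`, one-sided relations
of `Δ_B` can be checked on them, where the extra factor is absorbed into `x`, `y`, `x'` or `y'`. -/
theorem ΔB_sandwich_ext {φ ψ : Module.End ℂ D.TargetL →ₗ[ℂ] D.TargetL} {f : A →ₗ[ℂ] A}
    (h : ∀ x y a x' y', φ (D.ΔB (f (D.sandwich x y a x' y'))) =
      ψ (D.ΔB (D.sandwich x y a x' y'))) (a : A) : φ (D.ΔB (f a)) = ψ (D.ΔB a) :=
  LinearMap.congr_fun (f := φ ∘ₗ (D.ΔB : A →ₗ[ℂ] Module.End ℂ D.TargetL) ∘ₗ f)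
    (g := ψ ∘ₗ (D.ΔB : A →ₗ[ℂ] Module.End ℂ D.TargetL)) (D.sandwich_ext h) a

theorem ΔC_sandwich_ext {φ ψ : Module.End ℂ D.TargetR →ₗ[ℂ] D.TargetR} {f : A →ₗ[ℂ] A}
    (h : ∀ x y a x' y', φ (D.ΔC (f (D.sandwich x y a x' y'))).unop =
      ψ (D.ΔC (D.sandwich x y a x' y')).unop) (a : A) :
    φ (D.ΔC (f a)).unop = ψ (D.ΔC a).unop :=
  let Δ : A →ₗ[ℂ] Module.End ℂ D.TargetR := (MulOpposite.opLinearEquiv ℂ).symm.toLinearMap ∘ₗ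
    (D.ΔC : A →ₗ[ℂ] (Module.End ℂ D.TargetR)ᵐᵒᵖ)
  LinearMap.congr_fun (f := φ ∘ₗ Δ ∘ₗ f) (g := ψ ∘ₗ Δ) (D.sandwich_ext h) a

theorem ΔB_lB (x : D.B) (b : A) (w : D.TargetL) :
    D.ΔB (D.lB x b) w = D.symmetric.L₂ (D.lB x) (D.symmetric.lB_lC x) (D.ΔB b w) :=
  D.ΔB_sandwich_ext (φ := LinearMap.applyₗ w)
    (ψ := D.symmetric.L₂ (D.lB x) (D.symmetric.lB_lC x) ∘ₗ LinearMap.applyₗ w) (f := D.lB x)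
    (fun x₁ y₁ a x' y' => by
      rw [D.lB_sandwich, D.ΔB_bimodule, D.ΔB_bimodule]
      exact Bal.congr (φ := D.legsL y₁ (x * x₁))
        (ψ := D.symmetric.L₂ (D.lB x) (D.symmetric.lB_lC x) ∘ₗ D.legsL y₁ x₁)
        (fun _ _ => rfl) _) b

theorem ΔB_lSB (x : D.B) (b : A) (w : D.TargetL) :
    D.ΔB (D.lSB x b) w = D.symmetric.L₁ (D.lSB x)
      (fun x' a => (D.symmetric.lB_lC x' x a).symm) (D.ΔB b w) :=
  D.ΔB_sandwich_ext (φ := LinearMap.applyₗ w)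
    (ψ := D.symmetric.L₁ (D.lSB x) (fun x' a => (D.symmetric.lB_lC x' x a).symm) ∘ₗ
      LinearMap.applyₗ w) (f := D.lSB x)
    (fun x₁ y₁ a x' y' => by
      rw [D.lC_sandwich, D.ΔB_bimodule, D.ΔB_bimodule]
      exact Bal.congr (φ := D.legsL (D.SB x * y₁) x₁)
        (ψ := D.symmetric.L₁ (D.lSB x) (fun x' a => (D.symmetric.lB_lC x' x a).symm) ∘ₗ
          D.legsL y₁ x₁)
        (fun _ _ => rfl) _) b

theorem ΔC_rC (y : D.C) (b : A) (w : D.TargetR) :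
    (D.ΔC (D.rC y b)).unop w = D.symmetric.R₁ (D.rC y)
      (fun y' a => (D.symmetric.rB_rC y' y a).symm) ((D.ΔC b).unop w) :=
  D.ΔC_sandwich_ext (φ := LinearMap.applyₗ w)
    (ψ := D.symmetric.R₁ (D.rC y) (fun y' a => (D.symmetric.rB_rC y' y a).symm) ∘ₗ
      LinearMap.applyₗ w) (f := D.rC y)
    (fun x₁ y₁ a x' y' => by
      rw [D.rC_sandwich, D.ΔC_bimodule, D.ΔC_bimodule]
      exact Bal.congr (φ := (D.legsR (y' * y) x').unop)
        (ψ := D.symmetric.R₁ (D.rC y) (fun y' a => (D.symmetric.rB_rC y' y a).symm) ∘ₗ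
          (D.legsR y' x').unop)
        (fun _ _ => rfl) _) b

theorem ΔC_rSC (y : D.C) (b : A) (w : D.TargetR) :
    (D.ΔC (D.rSC y b)).unop w =
      D.symmetric.R₂ (D.rSC y) (D.symmetric.rB_rC y) ((D.ΔC b).unop w) :=
  D.ΔC_sandwich_ext (φ := LinearMap.applyₗ w)
    (ψ := D.symmetric.R₂ (D.rSC y) (D.symmetric.rB_rC y) ∘ₗ
      LinearMap.applyₗ w) (f := D.rSC y)
    (fun x₁ y₁ a x' y' => by
      rw [D.rB_sandwich, D.ΔC_bimodule, D.ΔC_bimodule]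
      exact Bal.congr (φ := (D.legsR y' (x' * D.SC y)).unop)
        (ψ := D.symmetric.R₂ (D.rSC y) (D.symmetric.rB_rC y) ∘ₗ (D.legsR y' x').unop)
        (fun _ _ => rfl) _) b

end ComultData

namespace MultiplierBialgebroid

variable (𝒜 : MultiplierBialgebroid A)

/-- A multiplier bialgebroid in symmetric form. -/
def symmetric : SymmetricBialgebroid A 𝒜.B 𝒜.C where
  toSymmetricBase := 𝒜.toBaseData.symmetric
  Tl := 𝒜.preTlam
  Tr := 𝒜.preTrho
  lT := 𝒜.preLamT
  rT := 𝒜.preRhoT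
  ΔL := fun a => 𝒜.ΔB a
  ΔR := fun a => (𝒜.ΔC a).unop
  ΔL_ml a b w := LinearMap.congr_fun (map_mul 𝒜.ΔB a b) w
  ΔR_mr a b w := LinearMap.congr_fun (congrArg MulOpposite.unop (map_mul 𝒜.ΔC b a)) w
  mrL₂_Tl := 𝒜.mulR₂_preTlam
  mrL₁_Tr a b c := 𝒜.mulR₁_preTrho b c a
  mlR₂_lT := 𝒜.mulL₂_preLamT
  mlR₁_rT a b c := 𝒜.mulL₁_preRhoT b c a
  nondegenerate_L₁ := 𝒜.nondegenerate_L₁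
  nondegenerate_L₂ := 𝒜.nondegenerate_L₂
  nondegenerate_R₁ := 𝒜.nondegenerate_R₁
  nondegenerate_R₂ := 𝒜.nondegenerate_R₂
  ΔL_lB := 𝒜.ΔB_lB
  ΔL_lC := 𝒜.ΔB_lSB
  ΔL_rB y a b c := 𝒜.ΔB_rB b (𝒜.SC y) a c
  ΔL_rC y a b c := by
    refine (𝒜.ΔB_rC b y a c).trans ?_
    change _ = 𝒜.ΔB b (Bal.π _ _ (𝒜.lC (𝒜.SB (𝒜.SB.symm y)) a ⊗ₜ c))
    rw [LinearEquiv.apply_symm_apply]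
  ΔR_rB := 𝒜.ΔC_rSC
  ΔR_rC := 𝒜.ΔC_rC
  ΔR_lB x a b c := by
    refine (𝒜.ΔC_lB b x a c).trans ?_
    change _ = (𝒜.ΔC b).unop (Bal.π _ _ (a ⊗ₜ 𝒜.rB (𝒜.SC (𝒜.SC.symm x)) c))
    rw [LinearEquiv.apply_symm_apply]
  ΔR_lC x a b c := 𝒜.ΔC_lC b (𝒜.SB x) a c
  coassoc_left := 𝒜.coassoc_left
  coassoc_right := 𝒜.coassoc_right
  coassoc_mixed₁ := 𝒜.coassoc_mixed₁
  coassoc_mixed₂ := 𝒜.coassoc_mixed₂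

end MultiplierBialgebroid

/-- An action that is additive in its index is idempotent on the span of a set if the action of the
set is. -/
theorem span_action_eq_top {V N : Type*} [AddCommGroup V] [Module ℂ V] [AddCommGroup N]
    [Module ℂ N] (f : V →ₗ[ℂ] N →ₗ[ℂ] N) (s : Set V)
    (h : Submodule.span ℂ {c | ∃ (i : Submodule.span ℂ s) (a : N), c = f i a} = ⊤) :
    Submodule.span ℂ {c | ∃ i ∈ s, ∃ a, c = f i a} = ⊤ := by
  rw [← top_le_iff, ← h, Submodule.span_le]
  rintro _ ⟨⟨i, hi⟩, a, rfl⟩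
  have : Submodule.span ℂ s ≤ (Submodule.span ℂ {c | ∃ i ∈ s, ∃ a, c = f i a}).comap (f.flip a) :=
    Submodule.span_le.2 fun i hi => Submodule.subset_span ⟨i, hi, a, rfl⟩
  exact this hi

/-- If `T ∘ f ∘ U` and `U ∘ g ∘ T` are isomorphisms, then `T` and `U` are bijective. -/
theorem bijective_of_comp {V₁ V₂ W₁ W₂ : Type*} [AddCommGroup V₁] [Module ℂ V₁] [AddCommGroup V₂]
    [Module ℂ V₂] [AddCommGroup W₁] [Module ℂ W₁] [AddCommGroup W₂] [Module ℂ W₂]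
    {T : V₁ →ₗ[ℂ] W₁} {U : V₂ →ₗ[ℂ] W₂} {f : W₂ →ₗ[ℂ] V₁} {g : W₁ →ₗ[ℂ] V₂}
    {e : V₂ ≃ₗ[ℂ] W₁} {e' : V₁ ≃ₗ[ℂ] W₂} (h : T ∘ₗ f ∘ₗ U = e.toLinearMap)
    (h' : U ∘ₗ g ∘ₗ T = e'.toLinearMap) : Function.Bijective T ∧ Function.Bijective U := by
  replace h : ∀ v, T (f (U v)) = e v := LinearMap.congr_fun h
  replace h' : ∀ v, U (g (T v)) = e' v := LinearMap.congr_fun h'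
  refine ⟨⟨fun v v' hv => e'.injective ?_, fun w => ?_⟩,
    ⟨fun v v' hv => e.injective ?_, fun w => ?_⟩⟩
  · rw [← h', ← h', hv]
  · exact ⟨f (U (e.symm w)), by rw [h, e.apply_symm_apply]⟩
  · rw [← h, ← h, hv]
  · exact ⟨g (T (e'.symm w)), by rw [h', e'.apply_symm_apply]⟩

theorem Bal.exists_lift_of_bijective {A : Type*} [NonUnitalRing A] [Module ℂ A] {ι : Type*}
    {f g : ι → A →ₗ[ℂ] A} {N : Type*} [AddCommGroup N] [Module ℂ N] {T : Bal f g →ₗ[ℂ] N}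
    (hT : Function.Bijective T) (Φ : A →ₗ[ℂ] A →ₗ[ℂ] A)
    (hΦ : ∀ i a b, Φ (f i a) b = Φ a (g i b)) :
    ∃ φ : N →ₗ[ℂ] A, ∀ a b, φ (T (Bal.π f g (a ⊗ₜ b))) = Φ a b :=
  ⟨Bal.lift (TensorProduct.lift Φ) (fun i a b => by simpa using hΦ i a b) ∘ₗ
    (LinearEquiv.ofBijective T hT).symm.toLinearMap, fun a b => by
      have : (LinearEquiv.ofBijective T hT).symm (T (Bal.π f g (a ⊗ₜ b))) = Bal.π f g (a ⊗ₜ b) :=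
        (LinearEquiv.ofBijective T hT).symm_apply_apply _
      rw [LinearMap.comp_apply, LinearEquiv.coe_coe, this, Bal.lift_π, TensorProduct.lift.tmul]⟩

/-! ### Transfer of regularity, counits and antipodes, and the converse direction -/

namespace MultiplierBialgebroid

variable {𝒜 : MultiplierBialgebroid A}

theorem IsRegularMultiplierHopfAlgebroid.symmetric (h : 𝒜.IsRegularMultiplierHopfAlgebroid) :
    𝒜.symmetric.Regular where
  Tl_surjective := h.bijective_Tlam.2.comp (Bal.π_surjective _ _)
  Tr_surjective := h.bijective_Trho.2.comp (Bal.π_surjective _ _)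
  lT_surjective := h.bijective_lamT.2.comp (Bal.π_surjective _ _)
  rT_surjective := h.bijective_rhoT.2.comp (Bal.π_surjective _ _)
  Tl_lift Φ hΦ := Bal.exists_lift_of_bijective h.bijective_Tlam Φ fun y a b => by
    obtain ⟨x, rfl⟩ := 𝒜.SB.surjective y
    exact hΦ x a b
  Tr_lift Φ hΦ := Bal.exists_lift_of_bijective h.bijective_Trho Φ fun x a b => by
    obtain ⟨y, rfl⟩ := 𝒜.SC.surjective x
    refine Eq.trans ?_ (hΦ (𝒜.SC y) a b)
    change _ = Φ (𝒜.rB (𝒜.SC (𝒜.SC.symm (𝒜.SC y))) a) b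
    rw [LinearEquiv.symm_apply_apply]
  lT_lift Φ hΦ := Bal.exists_lift_of_bijective h.bijective_lamT Φ fun y a b => by
    obtain ⟨x, rfl⟩ := 𝒜.SB.surjective y
    exact hΦ x a b
  rT_lift Φ hΦ := Bal.exists_lift_of_bijective h.bijective_rhoT Φ fun x a b => by
    obtain ⟨y, rfl⟩ := 𝒜.SC.surjective x
    refine (hΦ (𝒜.SC y) a b).trans ?_
    change Φ a (𝒜.rB (𝒜.SC (𝒜.SC.symm (𝒜.SC y))) b) = _
    rw [LinearEquiv.symm_apply_apply]
  full_L₁ := by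
    refine top_le_iff.1 ((span_action_eq_top 𝒜.symmetric.lC _ h.full_left_SB).symm.le.trans
      (Submodule.span_mono ?_))
    rintro _ ⟨_, ⟨ω, a, hω, rfl⟩, b, rfl⟩
    exact ⟨ω, a, b, hω, rfl⟩
  full_L₂ := by
    refine top_le_iff.1 ((span_action_eq_top 𝒜.symmetric.lB _ h.full_left_B).symm.le.trans
      (Submodule.span_mono ?_))
    rintro _ ⟨_, ⟨ω, a, hω, rfl⟩, b, rfl⟩
    exact ⟨ω, a, b, hω, rfl⟩
  full_R₁ := by
    refine top_le_iff.1 ((span_action_eq_top 𝒜.symmetric.rC _ h.full_right_C).symm.le.trans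
      (Submodule.span_mono ?_))
    rintro _ ⟨_, ⟨ω, a, hω, rfl⟩, b, rfl⟩
    exact ⟨ω, a, b, hω, rfl⟩
  full_R₂ := by
    refine top_le_iff.1 ((span_action_eq_top 𝒜.symmetric.rB _ h.full_right_SC).symm.le.trans
      (Submodule.span_mono ?_))
    rintro _ ⟨_, ⟨ω, a, hω, rfl⟩, b, rfl⟩
    exact ⟨ω, a, b, hω, rfl⟩

theorem isLeftCounit_iff {ε : A →ₗ[ℂ] 𝒜.B} : 𝒜.IsLeftCounit ε ↔ 𝒜.symmetric.IsCounit ε := by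
  have h₁ : ∀ hl w, 𝒜.sliceL₁ ε hl w = 𝒜.symmetric.slice₁ ε hl w := fun hl =>
    Bal.congr (φ := 𝒜.sliceL₁ ε hl) (ψ := 𝒜.symmetric.slice₁ ε hl) fun _ _ => rfl
  have h₂ : ∀ hr w, 𝒜.sliceL₂ ε hr w = 𝒜.symmetric.slice₂ ε hr w := fun hr =>
    Bal.congr (φ := 𝒜.sliceL₂ ε hr) (ψ := 𝒜.symmetric.slice₂ ε hr) fun _ _ => rfl
  exact ⟨fun h => ⟨h.hom_left, h.hom_right, fun a b => (h₁ _ _).symm.trans (h.counit_Trho a b),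
      fun a b => (h₂ _ _).symm.trans (h.counit_Tlam a b)⟩,
    fun h => ⟨h.hom_left, h.hom_right, fun a b => (h₁ _ _).trans (h.slice_Tr a b),
      fun a b => (h₂ _ _).trans (h.slice_Tl a b)⟩⟩

theorem isRightCounit_iff {ε : A →ₗ[ℂ] 𝒜.C} :
    𝒜.IsRightCounit ε ↔ 𝒜.symmetric.op.IsCounit ε := by
  have h₁ : ∀ hl w, 𝒜.sliceR₁ ε hl w = 𝒜.symmetric.op.slice₁ ε hl w := fun hl =>
    Bal.congr (φ := 𝒜.sliceR₁ ε hl) (ψ := 𝒜.symmetric.op.slice₁ ε hl) fun _ _ => rfl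
  have h₂ : ∀ hr w, 𝒜.sliceR₂ ε hr w = 𝒜.symmetric.op.slice₂ ε hr w := fun hr =>
    Bal.congr (φ := 𝒜.sliceR₂ ε hr) (ψ := 𝒜.symmetric.op.slice₂ ε hr) fun _ _ => rfl
  exact ⟨fun h => ⟨h.hom_left, h.hom_right, fun a b => (h₁ _ _).symm.trans (h.counit_rhoT a b),
      fun a b => (h₂ _ _).symm.trans (h.counit_lamT a b)⟩,
    fun h => ⟨h.hom_right, h.hom_left, fun a b => (h₁ _ _).trans (h.slice_Tr a b),
      fun a b => (h₂ _ _).trans (h.slice_Tl a b)⟩⟩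

theorem IsInvertibleAntipode.exists_isAntipode {S : A ≃ₗ[ℂ] A} (hS : 𝒜.IsInvertibleAntipode S) :
    ∃ ε ε', 𝒜.symmetric.IsCounit ε ∧ 𝒜.symmetric.op.IsCounit ε' ∧
      𝒜.symmetric.IsAntipode S ε ε' := by
  obtain ⟨ε, ε', hε, hε', h₁, h₂⟩ := hS.antipode
  refine ⟨ε, ε', isLeftCounit_iff.1 hε, isRightCounit_iff.1 hε', hS.anti_mul, hS.map_lB,
    fun x a => hS.map_lC (𝒜.SB x) a, fun x a => ?_, fun x a => ?_,
    ⟨𝒜.multC ∘ₗ hS.targetLToDomLamT.toLinearMap, h₁, fun _ _ => rfl⟩,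
    ⟨𝒜.multB ∘ₗ hS.targetRToDomTrho.toLinearMap, h₂, fun _ _ => rfl⟩⟩
  · change S (𝒜.rB (𝒜.SC (𝒜.SC.symm x)) a) = 𝒜.lC (𝒜.SB x) (S a)
    rw [LinearEquiv.apply_symm_apply, hS.map_rB]
  · change S (𝒜.rC (𝒜.SC.symm x) a) = 𝒜.lB x (S a)
    rw [hS.map_rC, LinearEquiv.apply_symm_apply]

theorem isInvertibleAntipode_of_isAntipode {S : A ≃ₗ[ℂ] A} {ε : A →ₗ[ℂ] 𝒜.B}
    {ε' : A →ₗ[ℂ] 𝒜.C} (hε : 𝒜.symmetric.IsCounit ε) (hε' : 𝒜.symmetric.op.IsCounit ε')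
    (hS : 𝒜.symmetric.IsAntipode S ε ε') : 𝒜.IsInvertibleAntipode S := by
  have hrC : ∀ y a, S (𝒜.rC y a) = 𝒜.lB (𝒜.SC y) (S a) := fun y a => by
    have h : S (𝒜.rC (𝒜.SC.symm (𝒜.SC y)) a) = 𝒜.lB (𝒜.SC y) (S a) := hS.map_rC (𝒜.SC y) a
    rwa [LinearEquiv.symm_apply_apply] at h
  have hrB : ∀ x a, S (𝒜.rB x a) = 𝒜.lC (𝒜.SB x) (S a) := fun x a => by
    have h : S (𝒜.rB (𝒜.SC (𝒜.SC.symm x)) a) = 𝒜.lC (𝒜.SB x) (S a) := hS.map_rB x a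
    rwa [LinearEquiv.apply_symm_apply] at h
  have hlC : ∀ y a, S (𝒜.lC y a) = 𝒜.rB (𝒜.SC y) (S a) := fun y a => by
    obtain ⟨x, rfl⟩ := 𝒜.SB.surjective y
    exact hS.map_lC x a
  have hlB : ∀ x a, S (𝒜.lB x a) = 𝒜.rC (𝒜.SB x) (S a) := hS.map_lB
  have hS' : 𝒜.IsCompatibleAntiAut S := ⟨hS.map_ml, fun x y a x' y' => by
    rw [BaseData.sandwich, hrC, hrB, hlB, hlC]⟩
  refine ⟨hS', ε, ε', isLeftCounit_iff.2 hε, isRightCounit_iff.2 hε', fun a b => ?_,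
    fun a b => ?_⟩
  · obtain ⟨P, hP, hPS⟩ := hS.exists_left
    exact (Bal.congr (φ := 𝒜.multC ∘ₗ hS'.targetLToDomLamT.toLinearMap) (ψ := P)
      (fun a b => (hPS a b).symm) _).trans (hP a b)
  · obtain ⟨Q, hQ, hQS⟩ := hS.exists_right
    exact (Bal.congr (φ := 𝒜.multB ∘ₗ hS'.targetRToDomTrho.toLinearMap) (ψ := Q)
      (fun a b => (hQS a b).symm) _).trans (hQ a b)

namespace IsInvertibleAntipode

variable {S : A ≃ₗ[ℂ] A}

theorem Trho_rhoT (hS : 𝒜.IsInvertibleAntipode S) :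
    𝒜.Trho ∘ₗ hS.targetRToDomTrho.toLinearMap ∘ₗ 𝒜.rhoT = hS.domRhoTToTargetL.toLinearMap := by
  obtain ⟨ε, ε', hε, -, h⟩ := hS.exists_isAntipode
  exact Bal.ext (h.Tr_rT hε (𝒜.Trho ∘ₗ hS.targetRToDomTrho.toLinearMap) fun _ _ => rfl)

theorem rhoT_Trho (hS : 𝒜.IsInvertibleAntipode S) :
    𝒜.rhoT ∘ₗ hS.domRhoTToTargetL.symm.toLinearMap ∘ₗ 𝒜.Trho =
      hS.targetRToDomTrho.symm.toLinearMap := by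
  obtain ⟨ε, ε', -, hε', h⟩ := hS.exists_isAntipode
  -- This is the preceding formula for the opposite, whose antipode is `S⁻¹`.
  exact Bal.ext (h.op.Tr_rT hε' (𝒜.rhoT ∘ₗ hS.domRhoTToTargetL.symm.toLinearMap) fun _ _ => rfl)

theorem lamT_Tlam (hS : 𝒜.IsInvertibleAntipode S) :
    𝒜.lamT ∘ₗ hS.targetLToDomLamT.toLinearMap ∘ₗ 𝒜.Tlam =
      hS.domTlamToTargetR.toLinearMap := by
  obtain ⟨ε, ε', -, hε', h⟩ := hS.exists_isAntipode
  exact Bal.ext (h.lT_Tl hε' (𝒜.lamT ∘ₗ hS.targetLToDomLamT.toLinearMap) fun _ _ => rfl)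

theorem Tlam_lamT (hS : 𝒜.IsInvertibleAntipode S) :
    𝒜.Tlam ∘ₗ hS.domTlamToTargetR.symm.toLinearMap ∘ₗ 𝒜.lamT =
      hS.targetLToDomLamT.symm.toLinearMap := by
  obtain ⟨ε, ε', hε, -, h⟩ := hS.exists_isAntipode
  exact Bal.ext (h.op.lT_Tl (ε' := ε) hε (𝒜.Tlam ∘ₗ hS.domTlamToTargetR.symm.toLinearMap)
    fun _ _ => rfl)

theorem isRegularMultiplierHopfAlgebroid (hS : 𝒜.IsInvertibleAntipode S) :
    𝒜.IsRegularMultiplierHopfAlgebroid := by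
  obtain ⟨ε, ε', hε, hε', -⟩ := hS.exists_isAntipode
  -- The right-hand sides `ι ⊗ S` and `ι ⊗ S⁻¹` are isomorphisms of balanced tensor products, so
  -- that `T_ρ` and `_ρ T` are each both injective and surjective.
  have hρ := bijective_of_comp hS.Trho_rhoT hS.rhoT_Trho
  have hlam := bijective_of_comp hS.lamT_Tlam hS.Tlam_lamT
  refine ⟨?_, ?_, ?_, ?_, hlam.2, hρ.1, hlam.1, hρ.2⟩
  -- For fullness, the counits themselves serve as the functionals `ω`.
  · refine top_le_iff.1 (hε.span_lC.symm.le.trans (Submodule.span_mono ?_))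
    rintro _ ⟨a, b, rfl⟩
    exact ⟨⟨ε a, Submodule.subset_span ⟨ε, a, hε.hom_left, rfl⟩⟩, b, rfl⟩
  · refine top_le_iff.1 (hε.span_lB.symm.le.trans (Submodule.span_mono ?_))
    rintro _ ⟨a, b, rfl⟩
    exact ⟨⟨ε a, Submodule.subset_span ⟨ε, a, hε.hom_right, rfl⟩⟩, b, rfl⟩
  · refine top_le_iff.1 (hε'.span_lB.symm.le.trans (Submodule.span_mono ?_))
    rintro _ ⟨a, b, rfl⟩
    exact ⟨⟨ε' a, Submodule.subset_span ⟨ε', a, hε'.hom_right, rfl⟩⟩, b, rfl⟩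
  · refine top_le_iff.1 (hε'.span_lC.symm.le.trans (Submodule.span_mono ?_))
    rintro _ ⟨a, b, rfl⟩
    exact ⟨⟨ε' a, Submodule.subset_span ⟨ε', a, hε'.hom_left, rfl⟩⟩, b, rfl⟩

/-- Each antipode comes with its own right counit, but right counits are unique because `_ρ T` is
onto. The maps `a ⊗ b ↦ S(a) b` and `a ⊗ b ↦ S'(a) b` therefore agree on the range of `T_ρ`, which
is everything. -/
theorem unique {S' : A ≃ₗ[ℂ] A} (hS : 𝒜.IsInvertibleAntipode S)
    (hS' : 𝒜.IsInvertibleAntipode S') : S = S' := by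
  have hr := hS.isRegularMultiplierHopfAlgebroid.symmetric
  obtain ⟨_, ε, -, hε, h⟩ := hS.exists_isAntipode
  obtain ⟨_, ε', -, hε', h'⟩ := hS'.exists_isAntipode
  obtain rfl : ε = ε' := hε.unique hε' hr.rT_surjective
  obtain ⟨P, hP, hPS⟩ := h.exists_left
  obtain ⟨P', hP', hPS'⟩ := h'.exists_left
  refine LinearEquiv.ext fun a => 𝒜.symmetric.eq_of_ml fun b => ?_
  rw [← hPS, ← hPS']
  exact congr_of_surjective hr.Tr_surjective (fun a b => (hP a b).trans (hP' a b).symm) _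

end IsInvertibleAntipode

end MultiplierBialgebroid

end Main

end MultHopf

end

theorem mainTheorem1 {A : Type*} [NonUnitalRing A] [Module ℂ A] [IsScalarTower ℂ A A]
    [SMulCommClass ℂ A A] (𝒜 : MultHopf.MultiplierBialgebroid A) :
    (𝒜.IsRegularMultiplierHopfAlgebroid ↔ ∃ S : A ≃ₗ[ℂ] A, 𝒜.IsInvertibleAntipode S) ∧
    (𝒜.IsRegularMultiplierHopfAlgebroid →
      (∃! S : A ≃ₗ[ℂ] A, 𝒜.IsInvertibleAntipode S) ∧
      (∃! εB : A →ₗ[ℂ] 𝒜.B, 𝒜.IsLeftCounit εB) ∧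
      (∃! εC : A →ₗ[ℂ] 𝒜.C, 𝒜.IsRightCounit εC) ∧
      ∀ (S : A ≃ₗ[ℂ] A) (hS : 𝒜.IsInvertibleAntipode S),
        (𝒜.Trho ∘ₗ hS.targetRToDomTrho.toLinearMap ∘ₗ 𝒜.rhoT =
          hS.domRhoTToTargetL.toLinearMap) ∧
        (𝒜.rhoT ∘ₗ hS.domRhoTToTargetL.symm.toLinearMap ∘ₗ 𝒜.Trho =
          hS.targetRToDomTrho.symm.toLinearMap) ∧
        (𝒜.lamT ∘ₗ hS.targetLToDomLamT.toLinearMap ∘ₗ 𝒜.Tlam =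
          hS.domTlamToTargetR.toLinearMap) ∧
        (𝒜.Tlam ∘ₗ hS.domTlamToTargetR.symm.toLinearMap ∘ₗ 𝒜.lamT =
          hS.targetLToDomLamT.symm.toLinearMap)) := by
  have exists_S : 𝒜.IsRegularMultiplierHopfAlgebroid →
      ∃ S : A ≃ₗ[ℂ] A, 𝒜.IsInvertibleAntipode S := fun h => by
    obtain ⟨ε, hε⟩ := h.symmetric.exists_counit
    obtain ⟨ε', hε'⟩ := h.symmetric.op.exists_counit
    obtain ⟨S, hS⟩ := h.symmetric.exists_isAntipode hε hε'
    exact ⟨S, MultHopf.MultiplierBialgebroid.isInvertibleAntipode_of_isAntipode hε hε' hS⟩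
  refine ⟨⟨exists_S, fun ⟨S, hS⟩ => hS.isRegularMultiplierHopfAlgebroid⟩, fun h => ⟨?_, ?_, ?_,
    fun S hS => ⟨hS.Trho_rhoT, hS.rhoT_Trho, hS.lamT_Tlam, hS.Tlam_lamT⟩⟩⟩
  · obtain ⟨S, hS⟩ := exists_S h
    exact ⟨S, hS, fun S' hS' => hS'.unique hS⟩
  · obtain ⟨ε, hε⟩ := h.symmetric.exists_counit
    exact ⟨ε, MultHopf.MultiplierBialgebroid.isLeftCounit_iff.2 hε, fun η hη =>
      (MultHopf.MultiplierBialgebroid.isLeftCounit_iff.1 hη).unique hε h.symmetric.Tr_surjective⟩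
  · obtain ⟨ε, hε⟩ := h.symmetric.op.exists_counit
    exact ⟨ε, MultHopf.MultiplierBialgebroid.isRightCounit_iff.2 hε, fun η hη =>
      (MultHopf.MultiplierBialgebroid.isRightCounit_iff.1 hη).unique hε
        h.symmetric.rT_surjective⟩
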